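/- **Setting.** Let $d:\mathbb U\times\mathbb U\to\mathbb R$ be a distance function, $r>0$, $c>1$, and $0<p_2<p_1<1$. Let $\mathcal H$ be an $(r,cr,p_1,p_2)$ locality-sensitive hash family for $d$: for a random $h\in\mathcal H$, $\Pr[h(x)=h(y)]$ is at least $p_1$ if $d(x,y)\le r$ (a *near* pair), at most $p_1$ if $r<d(x,y)\le cr$, and at most $p_2$ if $d(x,y)>cr$. (This holds if the collision probability is a nonincreasing function $P$ of the distance, $p_1=P(r)$ and $p_2=P(cr)$.) Let $\mathcal H_i$ be the family of concatenations of $i$ independent functions from $\mathcal H$. Put $\rho=\log p_1/\log p_2$, $\kappa=\lceil\frac{\rho}{1+\rho}\log_{1/p_1}p\rceil$ and, for a constant $a>0$, $t_i=\lceil (a+2)\,p_1^{-i}\log n\rceil$. The input consists of two finite sets $R,S\subseteq\mathbb U$ with $n=|R|+|S|$; a point lying in both sets counts as two input points. **Sizes.** For an input point $x$ let $N_r(x)$ be the number of near points of $x$ in the other set. The point $x$ is *$i$-dense*, $0\le i<\kappa$, if $np_2^{i+1}\le N_r(x)<np_2^{i}$, and *$\kappa$-dense* if $N_r(x)<np_2^\kappa$.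 $\mathrm{OUT}_{r,i}$ is the number of near pairs $(x,y)\in R\times S$ containing at least one $i$-dense point, and $\mathrm{OUT}_{cr}$ is the number of pairs $(x,y)\in R\times S$ with $r<d(x,y)\le cr$. **Model.** In the (tuple-based) MPC model there are $p\ge 2$ processors. In each round every processor, after free local computation, sends messages to the others; a message carries at most one indivisible data item (an input point or a hash function from $\mathcal H$) held by its sender, and $O(1)$ integers of $O(\log n)$ bits. A pair can be generated only by a processor that holds both of its points. The *load* is the maximum number of messages sent or received by a processor in a round. Assume $p<n^{\varepsilon}$ for a constant $0<\varepsilon<1$. Initially each processor holds at most $\lceil n/p\rceil$ input points, and one processor holds the drawn hash functions. **Algorithm.** Each input point $x$ comes with a level $k_x\in\{1,\dots,\kappa\}$ minimizing $p_1^{-i}\bigl(1+\sum_{y}\Pr_{h\in\mathcal H_i}[h(x)=h(y)]\bigr)$ over $i\in\{1,\dots,\kappa\}$, the sum being over the points $y$ of the other set. In phase $i$ ($1\le i\le\kappa$; the phases run concurrently), $x$ is active if $i=k_x$, passive if $i<k_x$, and dead if $i>k_x$. Independent random functions $h^i_1,\dots,h^i_{t_i}\in\mathcal H_i$ are drawn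 and broadcast to all processors; every active or passive point $x$ generates for every $j\le t_i$ a tuple with key $(i,j,h^i_j(x))$; tuples whose key has no active point are removed; and an equi-join of the remaining tuples generates all $(i,j,x,y)$ with $x\in R$, $y\in S$, $h^i_j(x)=h^i_j(y)$ and at least one of $x,y$ active. The output consists of those generated pairs $(x,y)$ with $d(x,y)\le r$. **Theorem.** For all constants $\varepsilon,p_1,p_2,a$ as above, this algorithm can be implemented in the MPC model, for all $n$ and $p$ with $2\le p<n^\varepsilon$, in $O(1)$ rounds (the bound depends only on $\varepsilon$), by a protocol that may depend on $n,p,\varepsilon,a,d,r,c,\mathcal H,p_1,p_2$ but not on the input and that is deterministic once the hash functions are drawn, so that for all inputs $R,S$ with $|R|+|S|=n$, all minimizing levels, and all even initial distributions: 1. for every draw of the hash functions, the protocol generates exactly the $(i,j,x,y)$ described above; 2. with probability at least $1-n^{-a}$ the output is exactly $\{(x,y)\in R\times S: d(x,y)\le r\}$; 3. the expected load is $$\tilde O\left(\sqrt{\sum_{i=0}^{\kappa}\frac{\mathrm{OUT}_{r,i}}{p\,p_1^{\,i}}}+\sqrt{\frac{\mathrm{OUT}_{cr}}{p}}+\frac{n}{p^{1/(1+\rho)}}\right),$$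 where $\tilde O$ hides a factor $C\log^b n$, and $C$, $b$ and the number of integers per message depend only on $\varepsilon,p_1,p_2,a$. -/

import Mathlib

open MeasureTheory
open scoped ENNReal

namespace LSHJoin

/-! ### Locality-sensitive hashing -/

/-- `h ω`, with `ω` drawn from `μ`, is an `(r, cr, p₁, p₂)` locality-sensitive hash family for the
distance function `d`: near pairs collide with probability at least `p₁`, far pairs with probability
at most `p₂`. A pair at distance in `(r, cr]` collides with probability at most `p₁`: this is the
monotonicity of the collision probability in the distance, `p₁` being the collision probability at
distance `r`. (If the collision probability is a nonincreasing function `P` of the distance, the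
conditions hold with `p₁ = P r` and `p₂ = P (c r)`.) -/
structure IsLSH {U Ω B : Type*} [MeasurableSpace Ω] (d : U → U → ℝ) (μ : Measure Ω)
    (h : Ω → U → B) (r c p₁ p₂ : ℝ) : Prop where
  measurableSet_collision : ∀ x y, MeasurableSet {ω | h ω x = h ω y}
  near : ∀ x y, d x y ≤ r → p₁ ≤ μ.real {ω | h ω x = h ω y}
  cnear : ∀ x y, r < d x y → d x y ≤ c * r → μ.real {ω | h ω x = h ω y} ≤ p₁
  far : ∀ x y, c * r < d x y → μ.real {ω | h ω x = h ω y} ≤ p₂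

/-- The probability that `x` and `y` collide under a random function of the `i`-fold concatenated
family, i.e. under `i` independent base functions simultaneously. -/
noncomputable def concatProb {U Ω B : Type*} [MeasurableSpace Ω] (μ : Measure Ω) (h : Ω → U → B)
    (i : ℕ) (x y : U) : ℝ :=
  (Measure.pi fun _ : Fin i => μ).real {g | ∀ a, h (g a) x = h (g a) y}

/-- `ρ = log p₁ / log p₂`. -/
noncomputable def rho (p₁ p₂ : ℝ) : ℝ := Real.log p₁ / Real.log p₂

/-- The number of levels `κ = ⌈(ρ / (1 + ρ)) log_{1/p₁} p⌉`. -/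
noncomputable def kappa (p₁ p₂ : ℝ) (p : ℕ) : ℕ :=
  ⌈rho p₁ p₂ / (1 + rho p₁ p₂) * Real.logb p₁⁻¹ p⌉₊

/-- The number `t_i = ⌈(a + 2) p₁^{-i} log n⌉` of hash functions used at level `i`, where `n^{-a}` is
the error probability aimed at. -/
noncomputable def reps (p₁ a : ℝ) (n i : ℕ) : ℕ := ⌈(a + 2) * (p₁ ^ i)⁻¹ * Real.log n⌉₊

/-! ### Sizes of the join -/

/-- The similarity join `{(x, y) ∈ R × S | d x y ≤ r}`. -/
def simJoin {U : Type*} (d : U → U → ℝ) (r : ℝ) (R S : Finset U) : Set (U × U) :=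
  {g | g.1 ∈ R ∧ g.2 ∈ S ∧ d g.1 g.2 ≤ r}

/-- The number `N_r(z)` of points of the other relation that are near `z`. Here and below an
input point is an element of `R.disjSum S`: `Sum.inl x` stands for `x ∈ R` and `Sum.inr y` for
`y ∈ S`. -/
noncomputable def nearCount {U : Type*} (d : U → U → ℝ) (r : ℝ) (R S : Finset U) : U ⊕ U → ℕ
  | Sum.inl x => {y : U | y ∈ S ∧ d x y ≤ r}.ncard
  | Sum.inr y => {x : U | x ∈ R ∧ d x y ≤ r}.ncard

/-- `z` is `i`-dense (`0 ≤ i ≤ κ`): for `i < κ` this means `n p₂^{i+1} ≤ N_r(z) < n p₂^i`, and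
for `i = κ` it means `N_r(z) < n p₂^κ`, where `n = |R| + |S|`. -/
def IsDense {U : Type*} (d : U → U → ℝ) (r p₂ : ℝ) (κ : ℕ) (R S : Finset U) (i : ℕ)
    (z : U ⊕ U) : Prop :=
  (i < κ ∧ ((R.card + S.card : ℕ) : ℝ) * p₂ ^ (i + 1) ≤ nearCount d r R S z ∧
      (nearCount d r R S z : ℝ) < ((R.card + S.card : ℕ) : ℝ) * p₂ ^ i) ∨
    (i = κ ∧ (nearCount d r R S z : ℝ) < ((R.card + S.card : ℕ) : ℝ) * p₂ ^ κ)

/-- `OUT_{r,i}`: the number of near pairs that contain at least one `i`-dense point. -/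
noncomputable def outNear {U : Type*} (d : U → U → ℝ) (r p₂ : ℝ) (κ : ℕ) (R S : Finset U)
    (i : ℕ) : ℕ :=
  {g : U × U | g.1 ∈ R ∧ g.2 ∈ S ∧ d g.1 g.2 ≤ r ∧
    (IsDense d r p₂ κ R S i (Sum.inl g.1) ∨ IsDense d r p₂ κ R S i (Sum.inr g.2))}.ncard

/-- `OUT_{cr}`: the number of pairs at distance in `(r, cr]`. -/
noncomputable def outCNear {U : Type*} (d : U → U → ℝ) (r c : ℝ) (R S : Finset U) : ℕ :=
  {g : U × U | g.1 ∈ R ∧ g.2 ∈ S ∧ r < d g.1 g.2 ∧ d g.1 g.2 ≤ c * r}.ncard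

/-! ### The algorithm -/

/-- The expected cost `E[W_{z,i}] = p₁^{-i} (1 + ∑_y Pr[h_i(z) = h_i(y)])` of handling the input
point `z` at level `i`, the sum being over the points `y` of the other relation. -/
noncomputable def expectedCost {U Ω B : Type*} [MeasurableSpace Ω] (μ : Measure Ω)
    (h : Ω → U → B) (p₁ : ℝ) (R S : Finset U) (i : ℕ) : U ⊕ U → ℝ
  | Sum.inl x => (p₁ ^ i)⁻¹ * (1 + ∑ y ∈ S, concatProb μ h i x y)
  | Sum.inr y => (p₁ ^ i)⁻¹ * (1 + ∑ x ∈ R, concatProb μ h i x y)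

/-- `lvl z` is a level in `{1, …, κ}` that minimizes the expected cost of `z`, for every input
point `z` (ties are broken arbitrarily). -/
def IsBestLevel {U Ω B : Type*} [MeasurableSpace Ω] (μ : Measure Ω) (h : Ω → U → B) (p₁ : ℝ)
    (κ : ℕ) (R S : Finset U) (lvl : U ⊕ U → ℕ) : Prop :=
  ∀ z ∈ R.disjSum S, 1 ≤ lvl z ∧ lvl z ≤ κ ∧ ∀ i, 1 ≤ i → i ≤ κ →
    expectedCost μ h p₁ R S (lvl z) z ≤ expectedCost μ h p₁ R S i z

/-- Indices `(i, j)` of the concatenated hash functions `h^i_j`, with `j < t i`. -/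
abbrev FunIdx (κ : ℕ) (t : ℕ → ℕ) : Type := (i : Fin (κ + 1)) × Fin (t i)

/-- Indices of the base hash functions: `h^i_j` is a concatenation of `i` of them. -/
abbrev BaseIdx (κ : ℕ) (t : ℕ → ℕ) : Type := (k : FunIdx κ t) × Fin k.1

/-- The hash value `h^i_j(z)`, where `k = (i, j)`; `ω` is the family of all drawn base functions. -/
def hashVal {U Ω B : Type*} (h : Ω → U → B) {κ : ℕ} {t : ℕ → ℕ} (ω : BaseIdx κ t → Ω)
    (k : FunIdx κ t) (z : U ⊕ U) : Fin k.1 → B :=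
  fun a => h (ω ⟨k, a⟩) (z.elim id id)

/-- The tuples generated for all phases `1 ≤ i ≤ κ`: one for each hash function `k = (i, j)` and each
input point that is active (`i = lvl z`) or passive (`i < lvl z`), i.e. not dead, in phase `i`.
The key of the tuple is `k` together with `hashVal h ω k z`. -/
def tuples {U : Type*} {κ : ℕ} {t : ℕ → ℕ} (R S : Finset U) (lvl : U ⊕ U → ℕ) :
    Set (FunIdx κ t × (U ⊕ U)) :=
  {τ | τ.2 ∈ R.disjSum S ∧ 1 ≤ (τ.1.1 : ℕ) ∧ (τ.1.1 : ℕ) ≤ lvl τ.2}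

/-- The tuples that remain when all tuples are removed whose key has no active point. -/
def keptTuples {U Ω B : Type*} (h : Ω → U → B) {κ : ℕ} {t : ℕ → ℕ} (ω : BaseIdx κ t → Ω)
    (R S : Finset U) (lvl : U ⊕ U → ℕ) : Set (FunIdx κ t × (U ⊕ U)) :=
  {τ | τ ∈ tuples R S lvl ∧ ∃ z, (τ.1, z) ∈ tuples R S lvl ∧ lvl z = (τ.1.1 : ℕ) ∧
    hashVal h ω τ.1 z = hashVal h ω τ.1 τ.2}

/-- The join results that the algorithm generates (before the distances are checked): all
`(k, x, y)` such that `x ∈ R` and `y ∈ S` have remaining tuples with the same key and hash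
function `k`, and at least one of `x` and `y` is active in that phase. -/
def joinResults {U Ω B : Type*} (h : Ω → U → B) {κ : ℕ} {t : ℕ → ℕ} (ω : BaseIdx κ t → Ω)
    (R S : Finset U) (lvl : U ⊕ U → ℕ) : Set (FunIdx κ t × U × U) :=
  {g | (g.1, Sum.inl g.2.1) ∈ keptTuples h ω R S lvl ∧
    (g.1, Sum.inr g.2.2) ∈ keptTuples h ω R S lvl ∧
    hashVal h ω g.1 (Sum.inl g.2.1) = hashVal h ω g.1 (Sum.inr g.2.2) ∧
    (lvl (Sum.inl g.2.1) = (g.1.1 : ℕ) ∨ lvl (Sum.inr g.2.2) = (g.1.1 : ℕ))}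

/-! ### The MPC model (tuple-based) -/

/-- The indivisible data items: an input point with its level, or a base hash function. -/
inductive Atom (U Ω I : Type*) where
  | point (z : U ⊕ U) (level : ℕ) : Atom U Ω I
  | hash (idx : I) (f : Ω) : Atom U Ω I

/-- A message: at most one data item and `w` integers smaller than `M`. -/
structure Msg (A : Type*) (w M : ℕ) where
  atom : Option A
  word : Fin w → Fin M

/-- What a processor has seen: its input, and for every past round (latest first) the messages
that it has received from each processor. -/
structure View (p : ℕ) (A : Type*) (w M : ℕ) where
  input : Set A
  inboxes : List (Fin p → List (Msg A w M))

/-- The data items that a processor holds. -/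
def View.held {p : ℕ} {A : Type*} {w M : ℕ} (v : View p A w M) : Set A :=
  {α | α ∈ v.input ∨ ∃ b ∈ v.inboxes, ∃ s, ∃ m ∈ b s, m.atom = some α}

/-- A tuple-based MPC algorithm on `p` processors that computes a set of join results `(k, x, y)`.
In every round each processor `q` sends to each processor `q'` the list `send q v q'` of messages,
where `v` is its current view; at the end it emits the join results `emit q v`. Local computation
is free, but data items are indivisible: a processor sends only items that it holds, and emits
`(k, x, y)` only if it holds both `x` and `y`. -/
structure Protocol (p w M : ℕ) (U Ω I K : Type*) where
  rounds : ℕ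
  send : Fin p → View p (Atom U Ω I) w M → Fin p → List (Msg (Atom U Ω I) w M)
  emit : Fin p → View p (Atom U Ω I) w M → Set (K × U × U)
  send_held : ∀ q v q', ∀ m ∈ send q v q', ∀ α, m.atom = some α → α ∈ v.held
  emit_held : ∀ q v, ∀ g ∈ emit q v,
    (∃ l, Atom.point (Sum.inl g.2.1) l ∈ v.held) ∧ (∃ l, Atom.point (Sum.inr g.2.2) l ∈ v.held)

/-- The views of all processors after the given number of rounds. -/
def Protocol.view {p w M : ℕ} {U Ω I K : Type*} (P : Protocol p w M U Ω I K)
    (input : Fin p → Set (Atom U Ω I)) : ℕ → Fin p → View p (Atom U Ω I) w M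
  | 0, q => ⟨input q, []⟩
  | s + 1, q => ⟨input q,
      (fun q' => P.send q' (P.view input s q') q) :: (P.view input s q).inboxes⟩

/-- The number of messages sent by `q` in round `s` (counted from `0`). -/
def Protocol.sent {p w M : ℕ} {U Ω I K : Type*} (P : Protocol p w M U Ω I K)
    (input : Fin p → Set (Atom U Ω I)) (s : ℕ) (q : Fin p) : ℕ :=
  ∑ q', (P.send q (P.view input s q) q').length

/-- The number of messages that are sent to `q` in round `s`. -/
def Protocol.received {p w M : ℕ} {U Ω I K : Type*} (P : Protocol p w M U Ω I K)
    (input : Fin p → Set (Atom U Ω I)) (s : ℕ) (q : Fin p) : ℕ :=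
  ∑ q', (P.send q' (P.view input s q') q).length

/-- The load: the maximum number of messages sent or received by a processor in a round. -/
def Protocol.load {p w M : ℕ} {U Ω I K : Type*} (P : Protocol p w M U Ω I K)
    (input : Fin p → Set (Atom U Ω I)) : ℕ :=
  (Finset.range P.rounds).sup fun s =>
    Finset.univ.sup fun q => max (P.sent input s q) (P.received input s q)

/-- The join results emitted by the processors at the end. -/
def Protocol.generated {p w M : ℕ} {U Ω I K : Type*} (P : Protocol p w M U Ω I K)
    (input : Fin p → Set (Atom U Ω I)) : Set (K × U × U) :=
  {g | ∃ q, g ∈ P.emit q (P.view input P.rounds q)}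

/-- The pairs that are output: those of the generated pairs that are near. -/
def Protocol.output {p w M : ℕ} {U Ω I K : Type*} (P : Protocol p w M U Ω I K)
    (d : U → U → ℝ) (r : ℝ) (input : Fin p → Set (Atom U Ω I)) : Set (U × U) :=
  {g | d g.1 g.2 ≤ r ∧ ∃ k, (k, g) ∈ P.generated input}

/-- The initial input of processor `q`: the input points `z` placed on it, each with its level,
and, on the first processor only, the drawn base hash functions. -/
def initialInput {U Ω I : Type*} {p : ℕ} (R S : Finset U) (lvl : U ⊕ U → ℕ)
    (owner : U ⊕ U → Fin p) (ω : I → Ω) (q : Fin p) : Set (Atom U Ω I) :=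
  {α | (∃ z ∈ R.disjSum S, owner z = q ∧ α = Atom.point z (lvl z)) ∨
    ((q : ℕ) = 0 ∧ ∃ idx, α = Atom.hash idx (ω idx))}

/-- The input points are evenly distributed over the `p` processors. -/
def IsEven {U : Type*} {p : ℕ} (R S : Finset U) (owner : U ⊕ U → Fin p) : Prop :=
  ∀ q, {z | z ∈ R.disjSum S ∧ owner z = q}.ncard ≤ ⌈((R.card + S.card : ℕ) : ℝ) / p⌉₊

/-! ### Expectation -/

/-- The outer expectation, the infimum of the integrals of the measurable functions above `f`. It is
the usual expectation if `f` is measurable. -/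
noncomputable def outerExpectation {X : Type*} [MeasurableSpace X] (ν : Measure X)
    (f : X → ℝ≥0∞) : ℝ≥0∞ :=
  ⨅ (g : X → ℝ≥0∞) (_ : Measurable g) (_ : ∀ x, f x ≤ g x), ∫⁻ x, g x ∂ν

end LSHJoin

open LSHJoin

/-! Communication. Local computation is free, so protocols are described from outside. A scenario is
an input together with the drawn hash functions. A round is a function of the scenario; it is
legitimate if every processor's messages are determined by its view (`Knows`) and carry only items
that it holds. `exists_protocol` turns such a schedule into a `Protocol`. The primitives run on `g ^
J` virtual processors with `p ≤ g ^ J ≤ 2 ^ J * p`, where `g` is about `p ^ (1 / J)` and `J` depends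
only on `ε` and is so large that `g ^ 2` is `O(n / p)`. Trees of degree `g` then have constant
depth, and a processor can afford `g` messages and blocks of length at least `2 * g ^ 2`.

Three primitives carry the join: scans over a monoid (`scan`), sorting (`HasArray.sort`) and
multicast (`multicast`). Sorting is a recursive columnsort: sorting `g` blocks and then the residue
classes modulo `g` leaves, for every threshold, an unsorted window of length `g ^ 2`; one more sort
of the blocks and one of shifted blocks remove it (`BlockSort.mul`).

The equi-join (`HasArray.join`) sorts the tuples by key and relation. A group of equal keys inside
one block needs nothing more. For any other group, the product of its two sides is cut into cells of
side length `L`, and each tuple is copied to the cells of its row or column. If `L` is about the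
block length plus the square root of the join size per virtual processor, there are `O(L)` copies
and `O(1)` cells per virtual processor, so the load is `O(L)`. The algorithm is a broadcast of the
hash functions and two such joins. In each, one relation contributes only tuples of active points,
so every pair that meets is a join result.

Correctness. At the smaller of the levels of a near pair, say `i`, each function makes the pair
collide with probability at least `p₁ ^ i`. The `t_i` independent functions all fail with
probability at most `n ^ (-(a + 2))`, and there are at most `n ^ 2` pairs (`measure_output_ne`).

Load. The expected number `W` of join results is at most the total expected cost times `O(log n)`
(`exists_joinWork_bound`). As levels are optimal, a point may be charged at its density `i` instead
(`expectedCost_lvl_le`): its `N` near points cost `N / p₁ ^ i`, points at distance in `(r, cr]` cost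
at most `1` each, and the far points cost at most `n * p₂ ^ i ≤ N / p₂` before scaling. For the
sparsest points the remainder `n * p₁ ^ (-κ) * (1 + n * p₂ ^ κ)` is `O(p * (n / p ^ (1 / (1 + ρ))) ^
2)` by the choice of `κ` (`kappa_bounds`). Hence `W` has expectation `Õ(p * s ^ 2)`, where `s` is
the target load. Bounding the square root in `L` by an affine function of `W` (`sqrt_le_add`) gives
expected load `Õ(s)`. -/

namespace LSHJoin

/-! ### Schedules: communication rounds as functions of the scenario -/

section Schedules

variable {p w m T T' : ℕ} {A X β γ δ : Type*}

/-- The messages of one round in every scenario: `D x q q'` is sent by `q` to `q'`. -/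
abbrev Round (X A : Type*) (p w m : ℕ) := X → Fin p → Fin p → List (Msg A w m)

/-- The view of processor `q` after the rounds `l` (latest first). -/
def viewAfter (inp : X → Fin p → Set A) (l : List (Round X A p w m)) (x : X) (q : Fin p) :
    View p A w m :=
  ⟨inp x q, l.map fun D s => D x s q⟩

/-- The data items that processor `q` holds after the rounds `l`. -/
def heldAfter (inp : X → Fin p → Set A) (l : List (Round X A p w m)) (x : X) (q : Fin p) :
    Set A :=
  (viewAfter inp l x q).held

/-- After the rounds `l`, processor `q` can compute `f` from its view. -/
def Knows (inp : X → Fin p → Set A) (l : List (Round X A p w m)) (q : Fin p) (f : X → β) : Prop :=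
  ∀ x x', viewAfter inp l x q = viewAfter inp l x' q → f x = f x'

/-- Every processor can compute its messages from its view, and holds the items it sends. -/
def Feasible (inp : X → Fin p → Set A) : List (Round X A p w m) → Prop
  | [] => True
  | D :: l => Feasible inp l ∧ (∀ q, Knows inp l q fun x => D x q) ∧
      ∀ x q q', ∀ μ ∈ D x q q', ∀ α, μ.atom = some α → α ∈ heldAfter inp l x q

/-- In the round `D` every processor sends and receives at most `Λ x` messages. -/
def LoadLE (D : Round X A p w m) (Λ : X → ℕ) : Prop :=
  ∀ x q, ∑ q', (D x q q').length ≤ Λ x ∧ ∑ q', (D x q' q).length ≤ Λ x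

/-- `l'` is a feasible schedule that arises from `l` by at most `T` further rounds of load `Λ`. -/
def Extends (inp : X → Fin p → Set A) (Λ : X → ℕ) (T : ℕ) (l l' : List (Round X A p w m)) : Prop :=
  Feasible inp l' ∧ ∃ l₂, l' = l₂ ++ l ∧ l₂.length ≤ T ∧ ∀ D ∈ l₂, LoadLE D Λ

variable {inp : X → Fin p → Set A} {Λ : X → ℕ} {l l' l'' : List (Round X A p w m)} {q : Fin p}

theorem mem_heldAfter {x : X} {α : A} : α ∈ heldAfter inp l x q ↔
    α ∈ inp x q ∨ ∃ D ∈ l, ∃ s, ∃ μ ∈ D x s q, μ.atom = some α := by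
  simp [heldAfter, viewAfter, View.held]

theorem viewAfter_cons {D : Round X A p w m} {x x' : X} :
    viewAfter inp (D :: l) x q = viewAfter inp (D :: l) x' q ↔
      viewAfter inp l x q = viewAfter inp l x' q ∧ ∀ s, D x s q = D x' s q := by
  simp only [viewAfter, View.mk.injEq, List.map_cons, List.cons.injEq, funext_iff]
  tauto

theorem viewAfter_of_append {l₂ : List (Round X A p w m)} {x x' : X}
    (h : viewAfter inp (l₂ ++ l) x q = viewAfter inp (l₂ ++ l) x' q) :
    viewAfter inp l x q = viewAfter inp l x' q := by
  induction l₂ with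
  | nil => exact h
  | cons D l₂ ih => exact ih (viewAfter_cons.1 h).1

theorem Extends.refl (h : Feasible inp l) : Extends inp Λ 0 l l := ⟨h, [], rfl, le_rfl, by simp⟩

theorem Extends.trans (h : Extends inp Λ T l l') (h' : Extends inp Λ T' l' l'') :
    Extends inp Λ (T + T') l l'' := by
  obtain ⟨-, l₂, rfl, hT, hL⟩ := h
  obtain ⟨hf, l₃, rfl, hT', hL'⟩ := h'
  refine ⟨hf, l₃ ++ l₂, by simp, by simp; omega, ?_⟩
  intro D hD
  rcases List.mem_append.1 hD with h | h
  exacts [hL' D h, hL D h]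

theorem Extends.mono (h : Extends inp Λ T l l') (hT : T ≤ T') : Extends inp Λ T' l l' := by
  obtain ⟨hf, l₂, rfl, hT', hL⟩ := h
  exact ⟨hf, l₂, rfl, hT'.trans hT, hL⟩

theorem Extends.feasible (h : Extends inp Λ T l l') : Feasible inp l' := h.1

theorem Knows.extend {f : X → β} (hf : Knows inp l q f) (h : Extends inp Λ T l l') :
    Knows inp l' q f := by
  obtain ⟨-, l₂, rfl, -, -⟩ := h
  exact fun x x' hx => hf x x' (viewAfter_of_append hx)

theorem heldAfter_extend (h : Extends inp Λ T l l') (x : X) (q : Fin p) :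
    heldAfter inp l x q ⊆ heldAfter inp l' x q := by
  obtain ⟨-, l₂, rfl, -, -⟩ := h
  intro α hα
  rw [mem_heldAfter] at hα ⊢
  rcases hα with h | ⟨D, hD, h⟩
  exacts [Or.inl h, Or.inr ⟨D, List.mem_append_right _ hD, h⟩]

theorem Knows.const (b : β) : Knows inp l q fun _ => b := fun _ _ _ => rfl

theorem Knows.comp {f : X → β} (hf : Knows inp l q f) (g : β → γ) :
    Knows inp l q fun x => g (f x) := fun x x' h => congrArg g (hf x x' h)

theorem Knows.comp₂ {f : X → β} {f' : X → γ} (hf : Knows inp l q f) (hf' : Knows inp l q f')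
    (g : β → γ → δ) : Knows inp l q fun x => g (f x) (f' x) := fun x x' h => by
  simp only [hf x x' h, hf' x x' h]

theorem knows_held : Knows inp l q fun x => heldAfter inp l x q := fun _ _ h => by
  simp only [heldAfter, h]

theorem knows_input : Knows inp l q fun x => inp x q := fun _ _ h => congrArg View.input h

/-- All items come from the initial input. -/
theorem Feasible.held_input (hf : Feasible inp l) {x : X} {α : A}
    (h : α ∈ heldAfter inp l x q) : ∃ q', α ∈ inp x q' := by
  induction l generalizing q with
  | nil => exact ⟨q, by simpa [mem_heldAfter] using h⟩
  | cons D l ih =>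
    rw [mem_heldAfter] at h
    rcases h with h | ⟨D', hD', s, μ, hμ, hα⟩
    · exact ⟨q, h⟩
    · rcases List.mem_cons.1 hD' with rfl | hD'
      · exact ih hf.1 (hf.2.2 x s q μ hμ α hα)
      · exact ih (q := q) hf.1 (mem_heldAfter.2 (Or.inr ⟨D', hD', s, μ, hμ, hα⟩))

theorem Feasible.suffix (hf : Feasible inp l) (h : l' <:+ l) : Feasible inp l' := by
  obtain ⟨t, rfl⟩ := h
  induction t with
  | nil => exact hf
  | cons D t ih => exact ih hf.1

/-- One more round of messages that are known to their senders. -/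
theorem Feasible.step (hf : Feasible inp l) (D : Round X A p w m)
    (hD : ∀ q, Knows inp l q fun x => D x q)
    (hh : ∀ x q q', ∀ μ ∈ D x q q', ∀ α, μ.atom = some α → α ∈ heldAfter inp l x q)
    (hL : LoadLE D Λ) : Extends inp Λ 1 l (D :: l) :=
  ⟨⟨hf, hD, hh⟩, [D], rfl, by simp, by simpa using hL⟩

open Classical in
/-- A feasible schedule is realized by a protocol. -/
theorem exists_protocol {U Ω I K : Type*} {inp : X → Fin p → Set (Atom U Ω I)}
    {l : List (Round X (Atom U Ω I) p w m)} (hf : Feasible inp l)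
    (E : X → Fin p → Set (K × U × U)) (hE : ∀ q, Knows inp l q fun x => E x q)
    (hheld : ∀ x q, ∀ g ∈ E x q,
      (∃ k, Atom.point (Sum.inl g.2.1) k ∈ heldAfter inp l x q) ∧
      (∃ k, Atom.point (Sum.inr g.2.2) k ∈ heldAfter inp l x q)) :
    ∃ P : Protocol p w m U Ω I K, P.rounds = l.length ∧
      (∀ x, P.generated (inp x) = {g | ∃ q, g ∈ E x q}) ∧
      ∀ Λ : X → ℕ, (∀ D ∈ l, LoadLE D Λ) → ∀ x, P.load (inp x) ≤ Λ x := by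
  -- A view does not reveal the scenario. Any scenario and any suffix of the schedule that produce
  -- this view may serve to define the messages: feasibility makes the result independent of the
  -- choice.
  let S (q : Fin p) (v : View p (Atom U Ω I) w m)
      (y : X × Round X (Atom U Ω I) p w m × List (Round X (Atom U Ω I) p w m)) : Prop :=
    (y.2.1 :: y.2.2) <:+ l ∧ viewAfter inp y.2.2 y.1 q = v
  let P : Protocol p w m U Ω I K :=
    { rounds := l.length
      send := fun q v q' => if h : ∃ y, S q v y then h.choose.2.1 h.choose.1 q q' else []
      emit := fun q v => if h : ∃ x, viewAfter inp l x q = v then E h.choose q else ∅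
      send_held := by
        intro q v q' μ hμ α hα
        split_ifs at hμ with h
        · obtain ⟨h1, h2⟩ := h.choose_spec
          rw [← h2]
          exact (hf.suffix h1).2.2 _ q q' μ hμ α hα
        · simp at hμ
      emit_held := by
        intro q v g hg
        split_ifs at hg with h
        · have := hheld _ q g hg
          rwa [heldAfter, h.choose_spec] at this
        · simp at hg }
  have hsend : ∀ D l', (D :: l') <:+ l → ∀ x q, P.send q (viewAfter inp l' x q) = D x q := by
    intro D l' hl x q
    funext q'
    have h : ∃ y, S q (viewAfter inp l' x q) y := ⟨(x, D, l'), hl, rfl⟩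
    change (if h : ∃ y, S q (viewAfter inp l' x q) y then h.choose.2.1 h.choose.1 q q' else []) = _
    rw [dif_pos h]
    obtain ⟨h1, h2⟩ := h.choose_spec
    -- The number of inboxes in a view reveals the round, so the chosen suffix is the actual one.
    have hlen : h.choose.2.2.length = l'.length := by
      have := congrArg (fun v => v.inboxes.length) h2
      simpa [viewAfter] using this
    have heq : h.choose.2.1 :: h.choose.2.2 = D :: l' := by
      rcases List.suffix_or_suffix_of_suffix h1 hl with h3 | h3
      · exact h3.eq_of_length (by simp [hlen])
      · exact (h3.eq_of_length (by simp [hlen])).symm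
    obtain ⟨h4, h5⟩ := List.cons.inj heq
    rw [h4]
    rw [h5] at h2
    exact congrFun ((hf.suffix hl).2.1 q _ _ h2) q'
  have hview : ∀ l', l' <:+ l → ∀ x q, P.view (inp x) l'.length q = viewAfter inp l' x q := by
    intro l'
    induction l' with
    | nil => intro _ x q; rfl
    | cons D l' ih =>
      intro hl x q
      have hl' : l' <:+ l := (List.suffix_cons D l').trans hl
      simp only [List.length_cons, Protocol.view]
      rw [ih hl' x q]
      simp only [viewAfter, List.map_cons, View.mk.injEq, true_and, List.cons.injEq, and_true]
      funext q'
      rw [ih hl' x q', hsend D l' hl]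
  refine ⟨P, rfl, ?_, ?_⟩
  · intro x
    ext g
    simp only [Protocol.generated, Set.mem_ofPred_eq]
    refine exists_congr fun q => ?_
    change g ∈ P.emit q (P.view (inp x) l.length q) ↔ _
    rw [hview l List.suffix_rfl]
    have h : ∃ x', viewAfter inp l x' q = viewAfter inp l x q := ⟨x, rfl⟩
    change g ∈ (if h : ∃ x', viewAfter inp l x' q = viewAfter inp l x q then E h.choose q else ∅) ↔ _
    rw [dif_pos h, show E h.choose q = E x q from hE q _ _ h.choose_spec]
  · intro Λ hΛ x
    refine Finset.sup_le fun s hs => Finset.sup_le fun q _ => ?_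
    have hs' : s < l.length := Finset.mem_range.1 hs
    have hdrop : l.drop (l.length - (s + 1)) <:+ l := List.drop_suffix _ _
    have hlen : (l.drop (l.length - (s + 1))).length = s + 1 := by simp; omega
    obtain ⟨D, l', hl'⟩ : ∃ D l', l.drop (l.length - (s + 1)) = D :: l' := by
      cases h : l.drop (l.length - (s + 1)) with
      | nil => simp [h] at hlen
      | cons D l' => exact ⟨D, l', rfl⟩
    rw [hl'] at hdrop hlen
    have hs2 : s = l'.length := by simpa using hlen.symm
    have hl'2 : l' <:+ l := (List.suffix_cons D l').trans hdrop
    have key : ∀ q', P.send q' (P.view (inp x) s q') = D x q' := fun q' => by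
      rw [hs2, hview l' hl'2, hsend D l' hdrop]
    simp only [Protocol.sent, Protocol.received, key]
    exact max_le (hΛ D (hdrop.subset (by simp)) x q).1 (hΛ D (hdrop.subset (by simp)) x q).2

/-! ### Rounds given by packets -/

open Classical in
/-- The round in which the packets `i ∈ pk x` with content `msg x i` are sent from `src x i` to
`dst x i`. -/
noncomputable def packetRound {ι : Type*} (pk : X → Finset ι) (src dst : X → ι → Fin p)
    (msg : X → ι → Msg A w m) : Round X A p w m :=
  fun x q q' => ((pk x).filter fun i => src x i = q ∧ dst x i = q').toList.map (msg x)

open Classical in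
-- Unlike in `route`, packets and targets may depend on the scenario. By `hk` the sender can tell
-- from its view that a packet exists, where it goes and what it contains. Applied in both
-- directions between two scenarios with equal views, this determines all that the processor sends.
theorem packet_step {ι : Type*} (hf : Feasible inp l) (pk : X → Finset ι)
    (src dst : X → ι → Fin p) (msg : X → ι → Msg A w m)
    (hk : ∀ q x x', viewAfter inp l x q = viewAfter inp l x' q → ∀ i ∈ pk x, src x i = q →
      i ∈ pk x' ∧ src x' i = q ∧ dst x i = dst x' i ∧ msg x i = msg x' i)
    (hh : ∀ x, ∀ i ∈ pk x, ∀ α, (msg x i).atom = some α → α ∈ heldAfter inp l x (src x i))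
    (hs : ∀ x q, ((pk x).filter fun i => src x i = q).card ≤ Λ x)
    (hd : ∀ x q, ((pk x).filter fun i => dst x i = q).card ≤ Λ x) :
    Extends inp Λ 1 l (packetRound pk src dst msg :: l) := by
  refine hf.step _ ?_ ?_ ?_
  · intro q x x' hx
    funext q'
    simp only [packetRound]
    have h : ((pk x).filter fun i => src x i = q ∧ dst x i = q') =
        (pk x').filter fun i => src x' i = q ∧ dst x' i = q' := by
      ext i
      simp only [Finset.mem_filter]
      constructor
      · rintro ⟨hi, h1, h2⟩
        obtain ⟨a, b, c, -⟩ := hk q x x' hx i hi h1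
        exact ⟨a, b, c ▸ h2⟩
      · rintro ⟨hi, h1, h2⟩
        obtain ⟨a, b, c, -⟩ := hk q x' x hx.symm i hi h1
        exact ⟨a, b, c ▸ h2⟩
    rw [← h]
    refine List.map_congr_left fun i hi => ?_
    simp only [Finset.mem_toList, Finset.mem_filter] at hi
    exact (hk q x x' hx i hi.1 hi.2.1).2.2.2
  · intro x q q' μ hμ α hα
    simp only [packetRound, List.mem_map, Finset.mem_toList, Finset.mem_filter] at hμ
    obtain ⟨i, ⟨hi, h1, -⟩, rfl⟩ := hμ
    exact h1 ▸ hh x i hi α hα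
  · intro x q
    simp only [packetRound, List.length_map, Finset.length_toList]
    constructor
    · refine le_trans (le_of_eq ?_) (hs x q)
      rw [Finset.card_eq_sum_card_fiberwise (f := dst x) (t := Finset.univ) (by simp)]
      refine Finset.sum_congr rfl fun q' _ => ?_
      rw [Finset.filter_filter]
    · refine le_trans (le_of_eq ?_) (hd x q)
      rw [Finset.card_eq_sum_card_fiberwise (f := src x) (t := Finset.univ) (by simp)]
      refine Finset.sum_congr rfl fun q' _ => ?_
      rw [Finset.filter_filter]
      congr 1
      ext i
      simp [and_comm]

theorem packet_held {ι : Type*} {pk : X → Finset ι} {src dst : X → ι → Fin p}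
    {msg : X → ι → Msg A w m} {x : X} {i : ι} (hi : i ∈ pk x) {α : A}
    (hα : (msg x i).atom = some α) :
    α ∈ heldAfter inp (packetRound pk src dst msg :: l) x (dst x i) := by
  classical
  refine mem_heldAfter.2 (Or.inr ⟨_, List.mem_cons_self, src x i, msg x i, ?_, hα⟩)
  simp only [packetRound, List.mem_map, Finset.mem_toList, Finset.mem_filter]
  exact ⟨i, ⟨hi, rfl, rfl⟩, rfl⟩

/-- The receiver of packets knows the set of their contents. -/
theorem packet_knows_set {ι : Type*} {pk : X → Finset ι} {src dst : X → ι → Fin p}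
    {msg : X → ι → Msg A w m} (q : Fin p) :
    Knows inp (packetRound pk src dst msg :: l) q
      fun x => {μ | ∃ i ∈ pk x, dst x i = q ∧ msg x i = μ} := by
  classical
  have key : ∀ x, {μ | ∃ i ∈ pk x, dst x i = q ∧ msg x i = μ} =
      {μ | ∃ s, μ ∈ packetRound pk src dst msg x s q} := by
    intro x
    ext μ
    simp only [packetRound, List.mem_map, Finset.mem_toList, Finset.mem_filter, Set.mem_ofPred_eq]
    constructor
    · rintro ⟨i, hi, h1, h2⟩
      exact ⟨_, i, ⟨hi, rfl, h1⟩, h2⟩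
    · rintro ⟨s, i, ⟨hi, -, h1⟩, h2⟩
      exact ⟨i, hi, h1, h2⟩
  intro x x' hx
  simp only [key]
  ext μ
  simp only [Set.mem_ofPred_eq, (viewAfter_cons.1 hx).2]

/-- If the packets, senders and receivers are fixed, each receiver knows the content of each packet. -/
theorem packet_knows_fixed {ι : Type*} {pk : Finset ι} {src dst : ι → Fin p}
    {msg : X → ι → Msg A w m} {i : ι} (hi : i ∈ pk) :
    Knows inp (packetRound (fun _ => pk) (fun _ => src) (fun _ => dst) msg :: l) (dst i)
      fun x => msg x i := by
  classical
  intro x x' hx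
  have := (viewAfter_cons.1 hx).2 (src i)
  simp only [packetRound, List.map_inj_left, Finset.mem_toList, Finset.mem_filter] at this
  exact this i ⟨hi, rfl, rfl⟩

open Classical in
/-- Routing along fixed connections. -/
theorem route {ι : Type*} (hf : Feasible inp l) (pk : Finset ι) (src dst : ι → Fin p)
    (msg : X → ι → Msg A w m) (hk : ∀ i ∈ pk, Knows inp l (src i) fun x => msg x i)
    (hh : ∀ x, ∀ i ∈ pk, ∀ α, (msg x i).atom = some α → α ∈ heldAfter inp l x (src i))
    (hs : ∀ x q, (pk.filter fun i => src i = q).card ≤ Λ x)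
    (hd : ∀ x q, (pk.filter fun i => dst i = q).card ≤ Λ x) :
    ∃ l', Extends inp Λ 1 l l' ∧ ∀ i ∈ pk, (Knows inp l' (dst i) fun x => msg x i) ∧
      ∀ x α, (msg x i).atom = some α → α ∈ heldAfter inp l' x (dst i) := by
  refine ⟨_, packet_step hf (fun _ => pk) (fun _ => src) (fun _ => dst) msg ?_ hh
    (fun x q => by convert hs x q) (fun x q => by convert hd x q), ?_⟩
  · rintro q x x' hx i hi rfl
    exact ⟨hi, rfl, rfl, hk i hi x x' hx⟩
  · intro i hi
    exact ⟨packet_knows_fixed hi, fun x α hα =>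
      packet_held (src := fun _ => src) (dst := fun _ => dst) (pk := fun _ => pk) hi hα⟩

end Schedules

/-! ### Messages that carry integers -/

section Messages

variable {A : Type*} {w m : ℕ}

/-- The message with data item `a` and integers `f 0, …, f (w - 1)`. -/
def mkMsg [NeZero m] (a : Option A) (f : ℕ → ℕ) : Msg A w m :=
  ⟨a, fun j => Fin.ofNat m (f j)⟩

/-- The `j`-th integer of a message. -/
def Msg.val (μ : Msg A w m) (j : ℕ) : ℕ := if h : j < w then μ.word ⟨j, h⟩ else 0

theorem mkMsg_val [NeZero m] {a : Option A} {f : ℕ → ℕ} {j : ℕ} (hj : j < w) (hf : f j < m) :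
    (mkMsg a f : Msg A w m).val j = f j := by
  simp [Msg.val, mkMsg, hj, Nat.mod_eq_of_lt hf]

end Messages

/-! ### Sums over windows -/

section WinSum

variable {V : Type*} [AddMonoid V]

/-- `f i + f (i + 1) + ⋯ + f (i + k - 1)`. -/
def winSum (f : ℕ → V) : ℕ → ℕ → V
  | _, 0 => 0
  | i, k + 1 => f i + winSum f (i + 1) k

theorem winSum_add (f : ℕ → V) (i k k' : ℕ) :
    winSum f i (k + k') = winSum f i k + winSum f (i + k) k' := by
  induction k generalizing i with
  | zero => simp [winSum]
  | succ k ih =>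
    rw [show k + 1 + k' = (k + k') + 1 by omega, winSum, winSum, ih, add_assoc (f i),
      show i + 1 + k = i + (k + 1) by omega]

theorem winSum_one (f : ℕ → V) (i : ℕ) : winSum f i 1 = f i := by simp [winSum]

theorem winSum_congr {f f' : ℕ → V} {i k : ℕ} (h : ∀ j, i ≤ j → j < i + k → f j = f' j) :
    winSum f i k = winSum f' i k := by
  induction k generalizing i with
  | zero => rfl
  | succ k ih =>
    rw [winSum, winSum, h i le_rfl (by omega), ih fun j hj hj' => h j (by omega) (by omega)]

theorem winSum_zero {f : ℕ → V} {i k : ℕ} (h : ∀ j, i ≤ j → j < i + k → f j = 0) :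
    winSum f i k = 0 := by
  induction k generalizing i with
  | zero => rfl
  | succ k ih =>
    rw [winSum, h i le_rfl (by omega), ih fun j hj hj' => h j (by omega) (by omega), add_zero]

theorem winSum_eq_of_zero {f : ℕ → V} {N i k k' : ℕ} (h : ∀ j, N ≤ j → f j = 0) (hk : N ≤ i + k)
    (hk' : N ≤ i + k') : winSum f i k = winSum f i k' := by
  wlog hkk : k ≤ k' generalizing k k'
  · exact (this hk' hk (by omega)).symm
  obtain ⟨d, rfl⟩ := Nat.exists_eq_add_of_le hkk
  rw [winSum_add, winSum_zero (i := i + k) fun j hj _ => h j (by omega), add_zero]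

theorem winSum_mul (f : ℕ → V) (M b k : ℕ) :
    winSum (fun β => winSum f (β * M) M) b k = winSum f (b * M) (k * M) := by
  induction k generalizing b with
  | zero => simp [winSum]
  | succ k ih => rw [winSum, ih, Nat.succ_mul k M, Nat.add_comm (k * M) M, winSum_add, Nat.succ_mul]

theorem winSum_nat (f : ℕ → ℕ) (i k : ℕ) : winSum f i k = ∑ j ∈ Finset.Ico i (i + k), f j := by
  induction k generalizing i with
  | zero => simp [winSum]
  | succ k ih =>
    rw [winSum, ih, Finset.sum_eq_sum_Ico_succ_bot (a := i) (by omega),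
      show i + 1 + k = i + (k + 1) by omega]

/-- The first of two optional values. -/
@[ext] structure First (V : Type*) where
  val : Option V

/-- A non-commutative monoid, which is why window sums are defined by an ordered recursion instead
of `Finset.sum`. Scans over it find the nearest marked position. -/
instance {V : Type*} : Zero (First V) := ⟨⟨none⟩⟩

instance {V : Type*} : Add (First V) := ⟨fun a b => ⟨a.val.or b.val⟩⟩

instance {V : Type*} : AddMonoid (First V) where
  add_assoc a b c := by
    ext1
    exact Option.or_assoc
  zero_add _ := by
    ext1
    exact Option.none_or
  add_zero _ := by
    ext1
    exact Option.or_none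
  nsmul := nsmulRec

theorem First.add_val {V : Type*} (a b : First V) : (a + b).val = a.val.or b.val := rfl

theorem First.zero_val {V : Type*} : (0 : First V).val = none := rfl

theorem winSum_first_none {V : Type*} {f : ℕ → First V} {i k : ℕ} :
    (winSum f i k).val = none ↔ ∀ j, i ≤ j → j < i + k → (f j).val = none := by
  induction k generalizing i with
  | zero => simp only [winSum, First.zero_val, true_iff]; intros; omega
  | succ k ih =>
    rw [winSum, First.add_val, Option.or_eq_none_iff, ih]
    constructor
    · rintro ⟨h1, h2⟩ j hj hj'
      rcases hj.eq_or_lt with rfl | hj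
      exacts [h1, h2 j hj (by omega)]
    · exact fun h => ⟨h i le_rfl (by omega), fun j hj hj' => h j (by omega) (by omega)⟩

theorem winSum_first_some {V : Type*} {f : ℕ → First V} {i k : ℕ} {b : V} :
    (winSum f i k).val = some b ↔ ∃ j, i ≤ j ∧ j < i + k ∧ (f j).val = some b ∧
      ∀ j', i ≤ j' → j' < j → (f j').val = none := by
  induction k generalizing i with
  | zero =>
    simp only [winSum, First.zero_val, reduceCtorEq, false_iff]
    rintro ⟨j, h1, h2, -⟩
    omega
  | succ k ih =>
    rw [winSum, First.add_val, Option.or_eq_some_iff, ih]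
    constructor
    · rintro (h | ⟨h, j, h1, h2, h3, h4⟩)
      · exact ⟨i, le_rfl, by omega, h, by intros; omega⟩
      · refine ⟨j, by omega, by omega, h3, fun j' hj' hj'' => ?_⟩
        rcases hj'.eq_or_lt with rfl | hj'
        exacts [h, h4 j' hj' hj'']
    · rintro ⟨j, h1, h2, h3, h4⟩
      rcases h1.eq_or_lt with rfl | h1
      · exact Or.inl h3
      · exact Or.inr ⟨h4 i le_rfl h1, j, h1, by omega, h3, fun j' hj' => h4 j' (by omega)⟩

end WinSum

/-! ### Scans -/

section Scan

variable {p w m : ℕ} {A X V : Type*} {inp : X → Fin p → Set A} {Λ : X → ℕ}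
  {l : List (Round X A p w m)} {h : ℕ → Fin p} {v φ g J M : ℕ}

/-- Every processor hosts at most `φ` of the virtual processors `0, …, v - 1`. -/
def HostLE (h : ℕ → Fin p) (v φ : ℕ) : Prop :=
  ∀ q, ((Finset.range v).filter fun b => h b = q).card ≤ φ

/-- Each virtual processor owns `k` consecutive positions. This count bounds the load whenever every
position of an array sends or receives one message. -/
theorem HostLE.div (hφ : HostLE h v φ) (k : ℕ) (q : Fin p) :
    ((Finset.range (k * v)).filter fun c => h (c / k) = q).card ≤ k * φ := by
  refine le_trans (Finset.card_le_mul_card_image_of_maps_to (f := fun c => c / k)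
    (t := (Finset.range v).filter fun b => h b = q) ?_ k ?_) (Nat.mul_le_mul_left k (hφ q))
  · intro c hc
    simp only [Finset.mem_filter, Finset.mem_range] at hc ⊢
    exact ⟨Nat.div_lt_of_lt_mul hc.1, hc.2⟩
  · intro b _
    rcases Nat.eq_zero_or_pos k with rfl | hk
    · simp
    · refine le_trans (Finset.card_le_card (t := Finset.Ico (b * k) (b * k + k)) ?_) (by simp)
      intro c hc
      simp only [Finset.mem_filter, Finset.mem_Ico] at hc ⊢
      rw [Nat.div_eq_iff hk] at hc
      omega

/-- Every virtual processor `b` obtains the values of the virtual processors `b + off c`, `c < g`. -/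
theorem route_shift (hf : Feasible inp l) (hφ : HostLE h v φ) (hΛ : ∀ x, φ * g ≤ Λ x)
    (off : ℕ → ℕ) (val : X → ℕ → Msg A w m)
    (hk : ∀ b < v, Knows inp l (h b) fun x => val x b)
    (hh : ∀ b < v, ∀ x α, (val x b).atom = some α → α ∈ heldAfter inp l x (h b)) :
    ∃ l', Extends inp Λ 1 l l' ∧ ∀ b < v, ∀ c < g, b + off c < v →
      (Knows inp l' (h b) fun x => val x (b + off c)) ∧
      ∀ x α, (val x (b + off c)).atom = some α → α ∈ heldAfter inp l' x (h b) := by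
  classical
  let pk : Finset (ℕ × ℕ) :=
    (Finset.range v ×ˢ Finset.range g).filter fun i => i.1 + off i.2 < v
  have hpk : ∀ i, i ∈ pk ↔ (i.1 < v ∧ i.2 < g) ∧ i.1 + off i.2 < v := by simp [pk]
  have hcard : ∀ q, (((Finset.range v).filter fun b => h b = q) ×ˢ Finset.range g).card ≤ φ * g :=
    fun q => by
      rw [Finset.card_product, Finset.card_range]
      exact Nat.mul_le_mul_right g (hφ q)
  obtain ⟨l', hl', H⟩ := route (Λ := Λ) hf pk (fun i => h (i.1 + off i.2)) (fun i => h i.1)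
    (fun x i => val x (i.1 + off i.2)) (fun i hi => hk _ ((hpk i).1 hi).2)
    (fun x i hi α hα => hh _ ((hpk i).1 hi).2 x α hα)
    (fun x q => by
      refine le_trans (Finset.card_le_card_of_injOn (fun i => (i.1 + off i.2, i.2)) ?_ ?_)
        ((hcard q).trans (hΛ x))
      · intro i hi
        simp only [Finset.coe_filter, Set.mem_ofPred_eq, hpk] at hi
        simp [hi.1.2, hi.1.1.2, hi.2]
      · rintro ⟨a, b⟩ _ ⟨a', b'⟩ _ hab
        simp only [Prod.mk.injEq] at hab
        obtain ⟨h1, rfl⟩ := hab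
        simp at h1
        simp [h1])
    (fun x q => by
      refine le_trans (Finset.card_le_card ?_) ((hcard q).trans (hΛ x))
      intro i hi
      simp only [Finset.mem_filter, hpk] at hi
      simp [hi.1.1.1, hi.1.1.2, hi.2])
  exact ⟨l', hl', fun b hb c hc hbc => H (b, c) ((hpk _).2 ⟨⟨hb, hc⟩, hbc⟩)⟩

variable [AddMonoid V]

/-- Every virtual processor `b` obtains the sum of the values of all later virtual processors. -/
theorem scan (hf : Feasible inp l) (hg : 1 ≤ g) (hφ : HostLE h (g ^ J) φ)
    (hΛ : ∀ x, φ * g ≤ Λ x) (G : X → ℕ → V) (hG : ∀ x b, g ^ J ≤ b → G x b = 0)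
    (enc : V → Msg A w m)
    (hinj : ∀ x x' i k, enc (winSum (G x) i k) = enc (winSum (G x') i k) →
      winSum (G x) i k = winSum (G x') i k)
    (h0 : (enc 0).atom = none)
    (hatom : ∀ a b α, (enc (a + b)).atom = some α →
      (enc a).atom = some α ∨ (enc b).atom = some α)
    (hk : ∀ b < g ^ J, Knows inp l (h b) fun x => G x b)
    (hh : ∀ b < g ^ J, ∀ x α, (enc (G x b)).atom = some α → α ∈ heldAfter inp l x (h b)) :
    ∃ l', Extends inp Λ (J + 1) l l' ∧ ∀ b < g ^ J,
      (Knows inp l' (h b) fun x => winSum (G x) (b + 1) (g ^ J)) ∧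
      ∀ x α, (enc (winSum (G x) (b + 1) (g ^ J))).atom = some α →
        α ∈ heldAfter inp l' x (h b) := by
  -- After `t + 1` rounds, `b` knows the sum over the `g ^ t` values behind it. A window of length
  -- `g ^ (t + 1)` splits into `g` windows of length `g ^ t`, and the `c`-th one is known to `b + c
  -- * g ^ t`.
  suffices H : ∀ t ≤ J, ∃ l', Extends inp Λ (t + 1) l l' ∧ ∀ b < g ^ J,
      (Knows inp l' (h b) fun x => winSum (G x) (b + 1) (g ^ t)) ∧
      ∀ x α, (enc (winSum (G x) (b + 1) (g ^ t))).atom = some α →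
        α ∈ heldAfter inp l' x (h b) from H J le_rfl
  intro t
  induction t with
  | zero =>
    intro _
    obtain ⟨l', hl', H⟩ := route_shift (Λ := Λ) hf hφ hΛ (fun _ => 1) (fun x b => enc (G x b))
      (fun b hb => (hk b hb).comp enc) hh
    refine ⟨l', hl', fun b hb => ?_⟩
    simp only [pow_zero, winSum_one]
    by_cases hb1 : b + 1 < g ^ J
    · obtain ⟨h1, h2⟩ := H b hb 0 hg hb1
      refine ⟨fun x x' hx => ?_, h2⟩
      simpa [winSum_one] using hinj x x' (b + 1) 1 (by simpa [winSum_one] using h1 x x' hx)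
    · refine ⟨fun x x' _ => by simp only [hG _ _ (not_lt.1 hb1)], fun x α hα => ?_⟩
      rw [hG _ _ (not_lt.1 hb1)] at hα
      rw [h0] at hα
      simp at hα
  | succ t ih =>
    intro ht
    obtain ⟨l₁, hl₁, H₁⟩ := ih (by omega)
    obtain ⟨l', hl', H⟩ := route_shift (Λ := Λ) hl₁.feasible hφ hΛ (fun c => c * g ^ t)
      (fun x b => enc (winSum (G x) (b + 1) (g ^ t))) (fun b hb => (H₁ b hb).1.comp enc)
      (fun b hb => (H₁ b hb).2)
    refine ⟨l', hl₁.trans hl', fun b hb => ⟨fun x x' hx => ?_, fun x α hα => ?_⟩⟩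
    · have key : ∀ c < g, winSum (G x) (b + 1 + c * g ^ t) (g ^ t) =
          winSum (G x') (b + 1 + c * g ^ t) (g ^ t) := by
        intro c hc
        by_cases hbc : b + c * g ^ t < g ^ J
        · refine hinj x x' _ _ ?_
          have := (H b hb c hc hbc).1 x x' hx
          simpa only [Nat.add_right_comm b 1] using this
        · rw [winSum_zero fun j hj _ => hG x j (by omega),
            winSum_zero fun j hj _ => hG x' j (by omega)]
      have : ∀ c ≤ g, winSum (G x) (b + 1) (c * g ^ t) = winSum (G x') (b + 1) (c * g ^ t) := by
        intro c
        induction c with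
        | zero => intro _; simp [winSum]
        | succ c ihc =>
          intro hc
          rw [Nat.succ_mul, winSum_add, winSum_add, ihc (by omega), key c hc]
      simpa only [pow_succ, mul_comm] using this g le_rfl
    · have : ∀ c ≤ g, (enc (winSum (G x) (b + 1) (c * g ^ t))).atom = some α →
          α ∈ heldAfter inp l' x (h b) := by
        intro c
        induction c with
        | zero => intro _ hα; simp [winSum, h0] at hα
        | succ c ihc =>
          intro hc hα
          rw [Nat.succ_mul, winSum_add] at hα
          rcases hatom _ _ _ hα with hα | hα
          · exact ihc (by omega) hα
          · by_cases hbc : b + c * g ^ t < g ^ J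
            · exact (H b hb c hc hbc).2 x α (by simpa only [Nat.add_right_comm b 1] using hα)
            · rw [winSum_zero fun j hj _ => hG x j (by omega), h0] at hα
              simp at hα
      refine this g le_rfl ?_
      rwa [pow_succ, mul_comm] at hα

end Scan

/-! ### Scans over arrays: position `i` is hosted by the virtual processor `i / M` -/

section ArrayScan

variable {p w m : ℕ} {A X V : Type*} {inp : X → Fin p → Set A} {Λ : X → ℕ}
  {l : List (Round X A p w m)} {h : ℕ → Fin p} {φ g J M : ℕ}

/-- The array `f` of length `N` in reverse order, continued by zeros. -/
def revArr [Zero V] (N : ℕ) (f : ℕ → V) (i : ℕ) : V := if i < N then f (N - 1 - i) else 0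

/-- The array `f` of length `N`, continued by zeros. -/
def cutArr [Zero V] (N : ℕ) (f : ℕ → V) (i : ℕ) : V := if i < N then f i else 0

theorem HostLE.rev {v : ℕ} (hφ : HostLE h v φ) : HostLE (fun b => h (v - 1 - b)) v φ := by
  intro q
  refine le_trans (Finset.card_le_card_of_injOn (fun b => v - 1 - b) ?_ ?_) (hφ q)
  · intro b hb
    simp only [Finset.coe_filter, Finset.mem_range, Set.mem_ofPred_eq] at hb ⊢
    exact ⟨by omega, hb.2⟩
  · intro a ha b hb hab
    simp only [Finset.coe_filter, Finset.mem_range, Set.mem_ofPred_eq] at ha hb hab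
    omega

theorem rev_div {M v i : ℕ} (hi : i < M * v) : (M * v - 1 - i) / M = v - 1 - i / M := by
  have hM : 0 < M := Nat.pos_of_ne_zero (by rintro rfl; simp at hi)
  have h1 : i / M < v := Nat.div_lt_of_lt_mul hi
  have h2 := Nat.div_add_mod i M
  have h3 := Nat.mod_lt i hM
  rw [Nat.div_eq_iff hM]
  obtain ⟨t, rfl⟩ : ∃ t, v = i / M + 1 + t := ⟨v - (i / M + 1), by omega⟩
  rw [show i / M + 1 + t - 1 - i / M = t by omega]
  have : M * (i / M + 1 + t) = M * (i / M) + M + t * M := by ring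
  omega

variable [AddMonoid V] [NeZero m]

/-- Only block sums are scanned. What follows position `i` is the rest of its own block, known to
the host, and then the sum of all later blocks. -/
theorem array_scan (hf : Feasible inp l) (hg : 1 ≤ g) (hφ : HostLE h (g ^ J) φ)
    (hΛ : ∀ x, φ * g ≤ Λ x) (hw : 0 < w) (f : X → ℕ → V)
    (hf0 : ∀ x i, M * g ^ J ≤ i → f x i = 0) (code : V → ℕ)
    (hcode : ∀ x i k, code (winSum (f x) i k) < m)
    (hinj : ∀ x x' i k, code (winSum (f x) i k) = code (winSum (f x') i k) →
      winSum (f x) i k = winSum (f x') i k)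
    (hk : ∀ i < M * g ^ J, Knows inp l (h (i / M)) fun x => f x i) :
    ∃ l', Extends inp Λ (J + 1) l l' ∧ ∀ i < M * g ^ J,
      Knows inp l' (h (i / M)) fun x => winSum (f x) (i + 1) (M * g ^ J) := by
  rcases Nat.eq_zero_or_pos M with rfl | hM
  · exact ⟨l, (Extends.refl hf).mono (by omega), by simp⟩
  have hmsg : ∀ x i k, (mkMsg none (fun _ => code (winSum (f x) i k)) : Msg A w m).val 0 =
      code (winSum (f x) i k) := fun x i k => mkMsg_val hw (hcode x i k)
  have hkw : ∀ b < g ^ J, ∀ i k, b * M ≤ i → i + k ≤ b * M + M →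
      Knows inp l (h b) fun x => winSum (f x) i k := by
    intro b hb i k hi hik x x' hx
    refine winSum_congr fun j hj hj' => ?_
    have hjb : j / M = b := by
      rw [Nat.div_eq_iff hM]
      omega
    have hjN : j < M * g ^ J := by
      calc j < b * M + M := by omega
        _ = M * (b + 1) := by ring
        _ ≤ M * g ^ J := Nat.mul_le_mul_left M hb
    exact hk j hjN x x' (hjb ▸ hx)
  obtain ⟨l', hl', H⟩ := scan (Λ := Λ) (V := V) hf hg hφ hΛ
    (fun x b => winSum (f x) (b * M) M)
    (fun x b hb => winSum_zero fun j hj _ => hf0 x j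
      (le_trans (by rw [mul_comm]; exact Nat.mul_le_mul_right M hb) hj))
    (fun s => mkMsg none fun _ => code s)
    (fun x x' i k hx => by
      simp only [winSum_mul] at hx ⊢
      have := congrArg (fun μ => μ.val 0) hx
      simp only [hmsg] at this
      exact hinj _ _ _ _ this)
    rfl (fun a b α hα => by simp [mkMsg] at hα)
    (fun b hb => hkw b hb _ _ le_rfl le_rfl)
    (fun b _ x α hα => by simp [mkMsg] at hα)
  refine ⟨l', hl', fun i hi x x' hx => ?_⟩
  have hb : i / M < g ^ J := Nat.div_lt_of_lt_mul hi
  have h1 := (H _ hb).1 x x' hx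
  simp only [winSum_mul] at h1
  have h2 := Nat.div_add_mod i M
  have h3 := Nat.mod_lt i hM
  have h4 : i / M * M = M * (i / M) := mul_comm _ _
  have h5 : (i / M + 1) * M = M * (i / M) + M := by ring
  have key : ∀ x, winSum (f x) (i + 1) (M * g ^ J) =
      winSum (f x) (i + 1) (M - 1 - i % M) +
        winSum (f x) ((i / M + 1) * M) (g ^ J * M) := by
    intro x
    rw [show (i / M + 1) * M = i + 1 + (M - 1 - i % M) by omega, ← winSum_add]
    refine winSum_eq_of_zero (hf0 x) (by omega) ?_
    have : g ^ J * M = M * g ^ J := mul_comm _ _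
    omega
  have h6 : winSum (f x) (i + 1) (M - 1 - i % M) = winSum (f x') (i + 1) (M - 1 - i % M) :=
    ((hkw _ hb (i + 1) (M - 1 - i % M) (by omega) (by omega)).extend hl') x x' hx
  simp only [key]
  rw [h1, h6]

/-- Scans look towards later positions. Reversing both the array and the assignment of hosts makes
them look at the earlier positions, nearest first. -/
theorem array_scan_rev (hf : Feasible inp l) (hg : 1 ≤ g) (hφ : HostLE h (g ^ J) φ)
    (hΛ : ∀ x, φ * g ≤ Λ x) (hw : 0 < w) (f : X → ℕ → V) (code : V → ℕ)
    (hcode : ∀ x i k, code (winSum (revArr (M * g ^ J) (f x)) i k) < m)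
    (hinj : ∀ x x' i k, code (winSum (revArr (M * g ^ J) (f x)) i k) =
        code (winSum (revArr (M * g ^ J) (f x')) i k) →
      winSum (revArr (M * g ^ J) (f x)) i k = winSum (revArr (M * g ^ J) (f x')) i k)
    (hk : ∀ i < M * g ^ J, Knows inp l (h (i / M)) fun x => f x i) :
    ∃ l', Extends inp Λ (J + 1) l l' ∧ ∀ i < M * g ^ J,
      Knows inp l' (h (i / M)) fun x =>
        winSum (revArr (M * g ^ J) (f x)) (M * g ^ J - 1 - i + 1) (M * g ^ J) := by
  obtain ⟨l', hl', H⟩ := array_scan (Λ := Λ) (M := M) hf hg hφ.rev hΛ hw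
    (fun x => revArr (M * g ^ J) (f x)) (fun x i hi => by simp [revArr, hi]) code hcode hinj
    (fun i hi => by
      simp only [revArr, if_pos hi]
      have := hk (M * g ^ J - 1 - i) (by omega)
      rwa [rev_div hi] at this)
  refine ⟨l', hl', fun i hi => ?_⟩
  have := H (M * g ^ J - 1 - i) (by omega)
  have hsub : ∀ a b : ℕ, b < a → a - 1 - (a - 1 - b) = b := by omega
  rwa [rev_div hi, hsub _ _ (Nat.div_lt_of_lt_mul hi)] at this

theorem sum_Ico_revArr (N : ℕ) (f : ℕ → ℕ) (i : ℕ) (hi : i < N) :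
    winSum (revArr N f) (N - 1 - i + 1) N = ∑ j ∈ Finset.range i, f j := by
  rw [winSum_nat]
  have : ∑ j ∈ Finset.Ico (N - 1 - i + 1) (N - 1 - i + 1 + N), revArr N f j =
      ∑ j ∈ Finset.Ico (N - i) N, revArr N f j := by
    symm
    refine Finset.sum_subset (fun j hj => ?_) (fun j hj hj' => ?_)
    · simp only [Finset.mem_Ico] at hj ⊢
      omega
    · simp only [Finset.mem_Ico] at hj hj'
      simp [revArr, show ¬ j < N by omega]
  rw [this]
  symm
  refine Finset.sum_bij' (fun j _ => N - 1 - j) (fun j _ => N - 1 - j) ?_ ?_ ?_ ?_ ?_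
  all_goals intro j hj; simp only [Finset.mem_range, Finset.mem_Ico] at hj ⊢
  any_goals omega
  simp [revArr, show N - 1 - j < N by omega, show N - 1 - (N - 1 - j) = j by omega]

/-- Sums over all later positions, and over all positions, of an array of integers. -/
theorem sum_scan (hf : Feasible inp l) (hg : 1 ≤ g) (hφ : HostLE h (g ^ J) φ)
    (hΛ : ∀ x, φ * g ≤ Λ x) (hw : 0 < w) (f : X → ℕ → ℕ)
    (hm : ∀ x, ∑ j ∈ Finset.range (M * g ^ J), f x j < m)
    (hk : ∀ i < M * g ^ J, Knows inp l (h (i / M)) fun x => f x i) :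
    ∃ l', Extends inp Λ (2 * (J + 1)) l l' ∧ ∀ i < M * g ^ J,
      (Knows inp l' (h (i / M)) fun x => ∑ j ∈ Finset.Ico (i + 1) (M * g ^ J), f x j) ∧
      (Knows inp l' (h (i / M)) fun x => ∑ j ∈ Finset.range (M * g ^ J), f x j) := by
  have hcut : ∀ x i k, winSum (cutArr (M * g ^ J) (f x)) i k =
      ∑ j ∈ (Finset.Ico i (i + k)).filter (· < M * g ^ J), f x j := by
    intro x i k
    rw [winSum_nat, Finset.sum_filter]
    rfl
  have hrev : ∀ x i k, winSum (revArr (M * g ^ J) (f x)) i k ≤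
      ∑ j ∈ Finset.range (M * g ^ J), f x j := by
    intro x i k
    rw [winSum_nat]
    calc ∑ j ∈ Finset.Ico i (i + k), revArr (M * g ^ J) (f x) j
        = ∑ j ∈ (Finset.Ico i (i + k)).filter (· < M * g ^ J), f x (M * g ^ J - 1 - j) := by
          rw [Finset.sum_filter]; rfl
      _ ≤ ∑ j ∈ Finset.range (M * g ^ J), f x (M * g ^ J - 1 - j) :=
          Finset.sum_le_sum_of_subset fun j hj => by
            simp only [Finset.mem_filter] at hj
            simpa using hj.2
      _ = _ := Finset.sum_range_reflect _ _
  obtain ⟨l₁, hl₁, H₁⟩ := array_scan (Λ := Λ) (M := M) hf hg hφ hΛ hw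
    (fun x => cutArr (M * g ^ J) (f x)) (fun x i hi => by simp [cutArr, hi]) id
    (fun x i k => lt_of_le_of_lt (by
      simp only [id, hcut]
      exact Finset.sum_le_sum_of_subset fun j hj => by
        simp only [Finset.mem_filter] at hj
        simpa using hj.2) (hm x))
    (fun _ _ _ _ h => h) (fun i hi => by simpa only [cutArr, if_pos hi] using hk i hi)
  obtain ⟨l₂, hl₂, H₂⟩ := array_scan_rev (Λ := Λ) (M := M) hl₁.feasible hg hφ hΛ hw f id
    (fun x i k => (hrev x i k).trans_lt (hm x)) (fun _ _ _ _ h => h)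
    (fun i hi => (hk i hi).extend hl₁)
  have hsuf : ∀ i < M * g ^ J, Knows inp l₂ (h (i / M))
      fun x => ∑ j ∈ Finset.Ico (i + 1) (M * g ^ J), f x j := by
    intro i hi
    have := (H₁ i hi).extend hl₂
    simp only [hcut] at this
    convert this using 3
    ext j
    simp only [Finset.mem_Ico, Finset.mem_filter]
    omega
  refine ⟨l₂, (hl₁.trans hl₂).mono (by omega), fun i hi => ⟨hsuf i hi, ?_⟩⟩
  have h1 := H₂ i hi
  simp only [sum_Ico_revArr _ _ _ hi] at h1
  have h2 := (h1.comp₂ ((hk i hi).extend (hl₁.trans hl₂)) (· + ·)).comp₂ (hsuf i hi) (· + ·)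
  convert h2 using 2 with x
  rw [← Finset.sum_range_succ, Finset.sum_range_add_sum_Ico _ (by omega)]

/-- An array of integers or blanks as a sequence of optional values. -/
def firstCode : First ℕ → ℕ
  | ⟨none⟩ => 0
  | ⟨some i⟩ => i + 1

theorem firstCode_injective : Function.Injective firstCode := by
  rintro ⟨_ | i⟩ ⟨_ | j⟩ h <;> simp_all [firstCode]

theorem firstCode_winSum_le {N : ℕ} {f : ℕ → First ℕ}
    (hf : ∀ j b, (f j).val = some b → b < N) (i k : ℕ) : firstCode (winSum f i k) ≤ N := by
  rcases hv : winSum f i k with ⟨_ | b⟩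
  · simp [firstCode]
  · obtain ⟨j, -, -, h, -⟩ := winSum_first_some.1 (congrArg First.val hv)
    exact hf j b h

/-- By monotonicity the smaller entries are exactly those in front of the run of equal entries that
contains `i`, so their number is the start `j` of that run. -/
theorem card_lt_eq {O : Type*} [LinearOrder O] {N : ℕ} {o : ℕ → O}
    (ho : ∀ i j, i ≤ j → j < N → o i ≤ o j) {i j : ℕ} (hji : j ≤ i) (hi : i < N)
    (hj : j = 0 ∨ o (j - 1) ≠ o j) (hc : ∀ k, j < k → k ≤ i → o (k - 1) = o k) :
    ((Finset.range N).filter fun k => o k < o i).card = j := by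
  have hoj : ∀ k, j ≤ k → k ≤ i → o k = o j := by
    intro k hk
    induction k, hk using Nat.le_induction with
    | base => intro _; rfl
    | succ k hk ih => intro hki; rw [← hc (k + 1) (by omega) hki, Nat.add_sub_cancel, ih (by omega)]
  have : (Finset.range N).filter (fun k => o k < o i) = Finset.range j := by
    ext k
    simp only [Finset.mem_filter, Finset.mem_range]
    rw [hoj i hji le_rfl]
    constructor
    · rintro ⟨hk, h⟩
      by_contra hkj
      exact absurd (ho j k (by omega) hk) (not_le.2 h)
    · intro hk
      refine ⟨by omega, lt_of_le_of_lt (ho k (j - 1) (by omega) (by omega)) ?_⟩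
      exact lt_of_le_of_ne (ho _ _ (by omega) (by omega)) (hj.resolve_left (by omega))
  rw [this, Finset.card_range]

theorem card_le_eq {O : Type*} [LinearOrder O] {N : ℕ} {o : ℕ → O}
    (ho : ∀ i j, i ≤ j → j < N → o i ≤ o j) {i j : ℕ} (hij : i ≤ j) (hj : j < N)
    (hj' : j + 1 = N ∨ o j ≠ o (j + 1)) (hc : ∀ k, i ≤ k → k < j → o k = o (k + 1)) :
    ((Finset.range N).filter fun k => o k ≤ o i).card = j + 1 := by
  have hoj : ∀ k, i ≤ k → k ≤ j → o k = o i := by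
    intro k hk
    induction k, hk using Nat.le_induction with
    | base => intro _; rfl
    | succ k hk ih => intro hki; rw [← hc k (by omega) (by omega), ih (by omega)]
  have : (Finset.range N).filter (fun k => o k ≤ o i) = Finset.range (j + 1) := by
    ext k
    simp only [Finset.mem_filter, Finset.mem_range]
    rw [← hoj j hij le_rfl]
    constructor
    · rintro ⟨hk, h⟩
      by_contra hkj
      have h1 := ho (j + 1) k (by omega) hk
      have h2 := ho j (j + 1) (by omega) (by omega)
      exact hj'.resolve_left (by omega) (le_antisymm h2 (h1.trans h))
    · intro hk
      exact ⟨by omega, ho k j (by omega) hj⟩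
  rw [this, Finset.card_range]

/-- The ranks of the entries of a monotone array, if every host knows which neighbouring entries
differ. -/
theorem rank_scan {O : Type*} [LinearOrder O] (hf : Feasible inp l) (hg : 1 ≤ g)
    (hφ : HostLE h (g ^ J) φ) (hΛ : ∀ x, φ * g ≤ Λ x) (hw : 0 < w) (hm : M * g ^ J + 1 < m)
    (o : X → ℕ → O) (ho : ∀ x i j, i ≤ j → j < M * g ^ J → o x i ≤ o x j)
    (hk₁ : ∀ i < M * g ^ J, 0 < i → Knows inp l (h (i / M)) fun x => o x (i - 1) = o x i)
    (hk₂ : ∀ i, i + 1 < M * g ^ J → Knows inp l (h (i / M)) fun x => o x i = o x (i + 1)) :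
    ∃ l', Extends inp Λ (2 * (J + 1)) l l' ∧ ∀ i < M * g ^ J,
      (Knows inp l' (h (i / M)) fun x =>
        ((Finset.range (M * g ^ J)).filter fun j => o x j < o x i).card) ∧
      (Knows inp l' (h (i / M)) fun x =>
        ((Finset.range (M * g ^ J)).filter fun j => o x j ≤ o x i).card) := by
  classical
  let N := M * g ^ J
  -- `f₁` marks the first position of every run and `f₂` the last one. The nearest mark to the left
  -- and to the right gives the two ranks by `card_lt_eq` and `card_le_eq`.
  let f₁ : X → ℕ → First ℕ := fun x i => ⟨if i = 0 ∨ o x (i - 1) ≠ o x i then some i else none⟩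
  let f₂ : X → ℕ → First ℕ := fun x i =>
    cutArr N (fun i => ⟨if i + 1 = N ∨ o x i ≠ o x (i + 1) then some i else none⟩) i
  have hf₁ : ∀ x i b, (f₁ x i).val = some b ↔ b = i ∧ (i = 0 ∨ o x (i - 1) ≠ o x i) := by
    intro x i b
    simp only [f₁, Option.ite_none_right_eq_some, Option.some.injEq]
    tauto
  have hf₁n : ∀ x i, (f₁ x i).val = none ↔ i ≠ 0 ∧ o x (i - 1) = o x i := by
    intro x i
    simp only [f₁, ite_eq_right_iff, reduceCtorEq, imp_false]
    tauto
  have hf₂ : ∀ x i b, i < N → ((f₂ x i).val = some b ↔ b = i ∧ (i + 1 = N ∨ o x i ≠ o x (i + 1))) := by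
    intro x i b hi
    simp only [f₂, cutArr, if_pos hi, Option.ite_none_right_eq_some, Option.some.injEq]
    tauto
  have hf₂n : ∀ x i, i < N → ((f₂ x i).val = none ↔ i + 1 ≠ N ∧ o x i = o x (i + 1)) := by
    intro x i hi
    simp only [f₂, cutArr, if_pos hi, ite_eq_right_iff, reduceCtorEq, imp_false]
    tauto
  have hf₂N : ∀ x i, N ≤ i → f₂ x i = 0 := by
    intro x i hi
    simp [f₂, cutArr, hi]
  have hkf₁ : ∀ i < N, Knows inp l (h (i / M)) fun x => f₁ x i := by
    intro i hi
    rcases Nat.eq_zero_or_pos i with rfl | h0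
    · simpa [f₁] using Knows.const _
    · intro x x' hx
      have := iff_of_eq (hk₁ i hi h0 x x' hx)
      simp only [f₁, ne_eq, this]
  have hkf₂ : ∀ i < N, Knows inp l (h (i / M)) fun x => f₂ x i := by
    intro i hi
    by_cases h0 : i + 1 = N
    · simpa [f₂, cutArr, hi, h0] using Knows.const _
    · intro x x' hx
      have := iff_of_eq (hk₂ i (by omega) x x' hx)
      simp only [f₂, cutArr, if_pos hi, ne_eq, this]
  obtain ⟨l₁, hl₁, H₁⟩ := array_scan_rev (Λ := Λ) (M := M) hf hg hφ hΛ hw f₁ firstCode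
    (fun x i k => lt_of_le_of_lt (firstCode_winSum_le (N := N) (fun j b hb => by
      by_cases hj : j < N
      · rw [revArr, if_pos hj, hf₁] at hb
        omega
      · simp [revArr, N, hj, First.zero_val] at hb) i k) (by omega))
    (fun _ _ _ _ hh => firstCode_injective hh) hkf₁
  obtain ⟨l₂, hl₂, H₂⟩ := array_scan (Λ := Λ) (M := M) hl₁.feasible hg hφ hΛ hw f₂ hf₂N firstCode
    (fun x i k => lt_of_le_of_lt (firstCode_winSum_le (N := N) (fun j b hb => by
      by_cases hj : j < N
      · rw [hf₂ x j b hj] at hb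
        omega
      · simp [hf₂N x j (not_lt.1 hj), First.zero_val] at hb) i k) (by omega))
    (fun _ _ _ _ hh => firstCode_injective hh) (fun i hi => (hkf₂ i hi).extend hl₁)
  refine ⟨l₂, (hl₁.trans hl₂).mono (by omega), fun i hi => ⟨?_, ?_⟩⟩
  · have hk := ((hkf₁ i hi).extend (hl₁.trans hl₂)).comp₂ ((H₁ i hi).extend hl₂)
      fun a b => ((a + b).val).getD 0
    convert hk using 2 with x
    rcases hv : (f₁ x i).val with _ | b
    · rcases hv' : (winSum (revArr N (f₁ x)) (N - 1 - i + 1) N).val with _ | c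
      -- This case is impossible: position `0`, which has index `N - 1` in the reversed array, is
      -- always marked.
      · rw [winSum_first_none] at hv'
        have := hv' (N - 1) (by rw [hf₁n] at hv; omega) (by omega)
        rw [revArr, if_pos (by omega), Nat.sub_self, hf₁n] at this
        exact absurd rfl this.1
      · obtain ⟨j, h1, h2, h3, h4⟩ := winSum_first_some.1 hv'
        have hjN : j < N := by
          by_contra hj
          simp [revArr, hj, First.zero_val] at h3
        rw [revArr, if_pos hjN, hf₁] at h3
        rw [First.add_val, hv, hv', Option.none_or, Option.getD_some, h3.1]
        refine card_lt_eq (ho x) (by omega) hi h3.2 fun k hk hki => ?_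
        rcases hki.eq_or_lt with rfl | hki
        · exact ((hf₁n x _).1 hv).2
        · have := h4 (N - 1 - k) (by omega) (by omega)
          rw [revArr, if_pos (by omega), show N - 1 - (N - 1 - k) = k by omega, hf₁n] at this
          exact this.2
    · rw [First.add_val, hv, Option.some_or, Option.getD_some]
      rw [hf₁] at hv
      rw [hv.1]
      exact card_lt_eq (ho x) le_rfl hi hv.2 fun k hk hki => by omega
  · have hk := ((hkf₂ i hi).extend (hl₁.trans hl₂)).comp₂ (H₂ i hi)
      fun a b => ((a + b).val).getD 0 + 1
    convert hk using 2 with x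
    rcases hv : (f₂ x i).val with _ | b
    · rcases hv' : (winSum (f₂ x) (i + 1) N).val with _ | c
      · rw [winSum_first_none] at hv'
        have := hv' (N - 1) (by rw [hf₂n x i hi] at hv; omega) (by omega)
        rw [hf₂n x _ (by omega)] at this
        omega
      · obtain ⟨j, h1, h2, h3, h4⟩ := winSum_first_some.1 hv'
        have hjN : j < N := by
          by_contra hj
          simp [hf₂N x j (not_lt.1 hj), First.zero_val] at h3
        rw [hf₂ x j c hjN] at h3
        rw [First.add_val, hv, hv', Option.none_or, Option.getD_some, h3.1]
        refine card_le_eq (ho x) (by omega) hjN h3.2 fun k hk hki => ?_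
        rcases hk.eq_or_lt with rfl | hk
        · exact ((hf₂n x _ hi).1 hv).2
        · exact ((hf₂n x k (by omega)).1 (h4 k (by omega) (by omega))).2
    · rw [First.add_val, hv, Option.some_or, Option.getD_some]
      rw [hf₂ x i b hi] at hv
      rw [hv.1]
      exact card_le_eq (ho x) le_rfl hi hv.2 fun k hk hki => by omega

end ArrayScan

/-! ### Sorting long blocks by sorting short blocks -/

section BlockSort

variable {α O : Type*} [LinearOrder O] {D g K : ℕ} {Q : ℕ → Prop} {κ : α → O}

/-- `a'` arises from `a` by sorting by the key `κ` in each of those blocks of length `D` whose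
index satisfies `Q`. -/
def BlockSort (D : ℕ) (Q : ℕ → Prop) (κ : α → O) (a a' : ℕ → α) : Prop :=
  ∃ σ : Equiv.Perm ℕ, (∀ i, σ i / D = i / D) ∧ (∀ i, ¬ Q (i / D) → σ i = i) ∧
    (∀ i, a' i = a (σ i)) ∧ ∀ i j, i ≤ j → i / D = j / D → Q (i / D) → κ (a' i) ≤ κ (a' j)

theorem card_filter_lt (D k : ℕ) (P : ℕ → Prop) [DecidablePred P] (h : ∀ t < D, P t ↔ t < k) :
    ((Finset.range D).filter P).card = min k D := by
  have : (Finset.range D).filter P = Finset.range (min k D) := by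
    ext t
    simp only [Finset.mem_filter, Finset.mem_range, lt_min_iff]
    constructor
    · rintro ⟨h1, h2⟩; exact ⟨(h t h1).1 h2, h1⟩
    · rintro ⟨h1, h2⟩; exact ⟨h2, (h t h2).2 h1⟩
  rw [this, Finset.card_range]

theorem div_block {D b t : ℕ} (ht : t < D) : (b * D + t) / D = b := by
  rw [Nat.div_eq_iff (by omega)]
  omega

/-- In a sorted block the entries with small keys come first. -/
theorem BlockSort.le_iff {a a' : ℕ → α} (h : BlockSort D Q κ a a') {b : ℕ} (hb : Q b) (θ : O)
    {t : ℕ} (ht : t < D) : κ (a' (b * D + t)) ≤ θ ↔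
      t < ((Finset.range D).filter fun t => κ (a (b * D + t)) ≤ θ).card := by
  obtain ⟨σ, h1, h2, h3, h4⟩ := h
  have hD : 0 < D := by omega
  have hcard : ((Finset.range D).filter fun t => κ (a (b * D + t)) ≤ θ).card =
      ((Finset.range D).filter fun t => κ (a' (b * D + t)) ≤ θ).card := by
    have hσ : ∀ t < D, ∃ s < D, σ (b * D + t) = b * D + s := by
      intro t ht
      have := h1 (b * D + t)
      rw [div_block ht, Nat.div_eq_iff hD] at this
      exact ⟨σ (b * D + t) - b * D, by omega, by omega⟩
    symm
    refine Finset.card_bij (fun t _ => σ (b * D + t) - b * D) ?_ ?_ ?_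
    · intro t ht
      simp only [Finset.mem_filter, Finset.mem_range] at ht ⊢
      obtain ⟨s, hs, hs'⟩ := hσ t ht.1
      rw [hs', Nat.add_sub_cancel_left, ← hs', ← h3]
      exact ⟨hs, ht.2⟩
    · intro t ht t' ht' htt
      simp only [Finset.mem_filter, Finset.mem_range] at ht ht'
      obtain ⟨s, hs, hs'⟩ := hσ t ht.1
      obtain ⟨s', hss, hss'⟩ := hσ t' ht'.1
      have : σ (b * D + t) = σ (b * D + t') := by omega
      have := σ.injective this
      omega
    · intro s hs
      simp only [Finset.mem_filter, Finset.mem_range] at hs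
      have h5 := h1 (σ.symm (b * D + s))
      rw [Equiv.apply_symm_apply, div_block hs.1, eq_comm, Nat.div_eq_iff hD] at h5
      have h6 : b * D + (σ.symm (b * D + s) - b * D) = σ.symm (b * D + s) := by omega
      refine ⟨σ.symm (b * D + s) - b * D, ?_, ?_⟩
      · simp only [Finset.mem_filter, Finset.mem_range]
        refine ⟨by omega, ?_⟩
        rw [h6, h3, Equiv.apply_symm_apply]
        exact hs.2
      · rw [h6, Equiv.apply_symm_apply, Nat.add_sub_cancel_left]
  rw [hcard]
  have hmono : ∀ t t', t ≤ t' → t' < D → κ (a' (b * D + t')) ≤ θ → κ (a' (b * D + t)) ≤ θ := by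
    intro t t' htt ht' h
    refine le_trans (h4 _ _ (by omega) ?_ ?_) h
    · rw [div_block ht', div_block (by omega)]
    · rwa [div_block (by omega)]
  constructor
  · intro h
    have : Finset.range (t + 1) ⊆ (Finset.range D).filter fun t => κ (a' (b * D + t)) ≤ θ := by
      intro s hs
      simp only [Finset.mem_filter, Finset.mem_range] at hs ⊢
      exact ⟨by omega, hmono s t (by omega) ht h⟩
    simpa using Finset.card_le_card this
  · intro h
    by_contra hc
    have : ((Finset.range D).filter fun t => κ (a' (b * D + t)) ≤ θ) ⊆ Finset.range t := by
      intro s hs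
      simp only [Finset.mem_filter, Finset.mem_range] at hs ⊢
      by_contra hst
      exact hc (hmono t s (by omega) hs.1 hs.2)
    have := Finset.card_le_card this
    simp only [Finset.card_range] at this
    omega

/-- Position `c D + t` of a block of length `g D` is sent to position `t g + c`. -/
def transposeFun (g D i : ℕ) : ℕ :=
  i / (g * D) * (g * D) + (i % (g * D) % D * g + i % (g * D) / D)

theorem transposeFun_eq {g D u c t : ℕ} (hc : c < g) (ht : t < D) :
    transposeFun g D (u * (g * D) + (c * D + t)) = u * (g * D) + (t * g + c) := by
  have h1 : c * D + t < g * D := by nlinarith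
  have h2 : (u * (g * D) + (c * D + t)) % (g * D) = c * D + t := by
    rw [Nat.add_comm, Nat.add_mul_mod_self_right, Nat.mod_eq_of_lt h1]
  rw [transposeFun, div_block h1, h2, div_block ht, Nat.add_comm (c * D),
    Nat.add_mul_mod_self_right, Nat.mod_eq_of_lt ht]

theorem exists_block {g D : ℕ} (hg : 0 < g) (hD : 0 < D) (i : ℕ) : ∃ u c t, c < g ∧ t < D ∧
    i = u * (g * D) + (c * D + t) := by
  refine ⟨i / (g * D), i % (g * D) / D, i % (g * D) % D, ?_, Nat.mod_lt _ hD, ?_⟩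
  · exact Nat.div_lt_of_lt_mul (by rw [mul_comm D g]; exact Nat.mod_lt _ (Nat.mul_pos hg hD))
  · rw [mul_comm (i % (g * D) / D) D, Nat.div_add_mod, mul_comm _ (g * D), Nat.div_add_mod]

/-- The permutation of `ℕ` that transposes every block of length `g D`. -/
def transposePerm (g D : ℕ) (hg : 0 < g) (hD : 0 < D) : Equiv.Perm ℕ where
  toFun := transposeFun g D
  invFun := transposeFun D g
  left_inv i := by
    obtain ⟨u, c, t, hc, ht, rfl⟩ := exists_block hg hD i
    rw [transposeFun_eq hc ht, mul_comm g D, transposeFun_eq ht hc]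
  right_inv i := by
    obtain ⟨u, c, t, hc, ht, rfl⟩ := exists_block hD hg i
    rw [transposeFun_eq hc ht, mul_comm D g, transposeFun_eq ht hc]

theorem transposePerm_apply {hg : 0 < g} {hD : 0 < D} {u c t : ℕ} (hc : c < g) (ht : t < D) :
    transposePerm g D hg hD (u * (g * D) + (c * D + t)) = u * (g * D) + (t * g + c) :=
  transposeFun_eq hc ht

theorem transposePerm_symm_apply {hg : 0 < g} {hD : 0 < D} {u c t : ℕ} (hc : c < g) (ht : t < D) :
    (transposePerm g D hg hD).symm (u * (g * D) + (t * g + c)) = u * (g * D) + (c * D + t) := by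
  rw [Equiv.symm_apply_eq, transposePerm_apply hc ht]

theorem transposePerm_div {hg : 0 < g} {hD : 0 < D} (i : ℕ) :
    transposePerm g D hg hD i / (g * D) = i / (g * D) := by
  obtain ⟨u, c, t, hc, ht, rfl⟩ := exists_block hg hD i
  rw [transposePerm_apply hc ht, div_block (by nlinarith), div_block (by nlinarith)]

/-- Rotation of the positions `0, …, N - 1` by `H` to the left. -/
def rotPerm (N H : ℕ) (hH : H ≤ N) : Equiv.Perm ℕ where
  toFun i := if i < H then i + (N - H) else if i < N then i - H else i
  invFun i := if i < N - H then i + H else if i < N then i - (N - H) else i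
  left_inv i := by grind
  right_inv i := by grind

/-- If the entries with small keys form an initial segment up to a window that is contained in a
single shifted block, sorting the shifted blocks makes them an initial segment. -/
theorem exists_initial_of_shifted {H : ℕ} (hHD : H ≤ D) (P P' : ℕ → Prop) [DecidablePred P]
    {s e : ℕ} (hs : ∀ i < g * D, i < s → P i) (he : ∀ i < g * D, e ≤ i → ¬ P i)
    (hse : s = e ∨ ∃ β, 1 ≤ β ∧ β < g ∧ β * D - H ≤ s ∧ e ≤ β * D - H + D)
    (h₁ : ∀ i < g * D, (i + H < D ∨ g * D ≤ i + H) → (P' i ↔ P i))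
    (h₂ : ∀ β, 1 ≤ β → β < g → ∀ t < D, P' (β * D - H + t) ↔
      t < ((Finset.range D).filter fun t => P (β * D - H + t)).card) :
    ∃ s', ∀ i < g * D, P' i ↔ i < s' := by
  -- Position `i` belongs to the shifted block `β = (i + H) / D`. The first `D - H` and the last `H`
  -- positions lie in no shifted block.
  have hcase : ∀ i < g * D, (i + H < D ∨ g * D ≤ i + H) ∨ ∃ β t, 1 ≤ β ∧ β < g ∧ t < D ∧
      i = β * D - H + t := by
    intro i hi
    by_cases h : i + H < D ∨ g * D ≤ i + H
    · exact Or.inl h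
    · push Not at h
      have hD : 0 < D := by
        rcases Nat.eq_zero_or_pos D with rfl | hD
        · simp at hi
        · exact hD
      have h3 := Nat.div_add_mod (i + H) D
      have h4 := Nat.mod_lt (i + H) hD
      have h5 : 1 ≤ (i + H) / D := (Nat.one_le_div_iff hD).2 h.1
      have h6 : D ≤ (i + H) / D * D := by nlinarith
      refine Or.inr ⟨(i + H) / D, (i + H) % D, h5,
        (Nat.div_lt_iff_lt_mul hD).2 h.2, h4, ?_⟩
      rw [mul_comm] at h3
      omega
  have hmul : ∀ β, 1 ≤ β → β < g → D ≤ β * D ∧ β * D + D ≤ g * D := fun β h1 h2 =>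
    ⟨by nlinarith, by nlinarith⟩
  rcases hse with rfl | ⟨β, hβ1, hβg, hβs, hβe⟩
  -- The small entries already form an initial segment, hence also in every shifted block, and
  -- sorting these changes nothing.
  · refine ⟨s, fun i hi => ?_⟩
    have hP : ∀ i < g * D, P i ↔ i < s := fun i hi =>
      ⟨fun h => by by_contra hc; exact he i hi (not_lt.1 hc) h, hs i hi⟩
    rcases hcase i hi with h | ⟨β, t, h1, h2, h3, rfl⟩
    · rw [h₁ i hi h, hP i hi]
    · have := hmul β h1 h2
      rw [h₂ β h1 h2 t h3, card_filter_lt D (s - (β * D - H)) _ fun t ht => by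
        rw [hP _ (by omega)]; omega]
      omega
  -- Shifted blocks before `β` contain only small entries and later ones none, so the new border is
  -- determined by the number of small entries in block `β`.
  · refine ⟨β * D - H + ((Finset.range D).filter fun t => P (β * D - H + t)).card,
      fun i hi => ?_⟩
    have hm := hmul β hβ1 hβg
    have hle : ((Finset.range D).filter fun t => P (β * D - H + t)).card ≤ D := by
      simpa using Finset.card_filter_le (Finset.range D) fun t => P (β * D - H + t)
    have hge : s - (β * D - H) ≤ ((Finset.range D).filter fun t => P (β * D - H + t)).card ∨
        D ≤ s - (β * D - H) := by
      by_cases hc : D ≤ s - (β * D - H)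
      · exact Or.inr hc
      · left
        rw [← Finset.card_range (s - (β * D - H))]
        refine Finset.card_le_card fun t ht => ?_
        simp only [Finset.mem_filter, Finset.mem_range] at ht ⊢
        exact ⟨by omega, hs _ (by omega) (by omega)⟩
    rcases hcase i hi with h | ⟨γ, t, h1, h2, h3, rfl⟩
    · rw [h₁ i hi h]
      rcases h with h | h
      · exact iff_of_true (hs i hi (by omega)) (by omega)
      · exact iff_of_false (he i hi (by omega)) (by omega)
    · have hm' := hmul γ h1 h2
      rw [h₂ γ h1 h2 t h3]
      rcases lt_trichotomy γ β with h | rfl | h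
      · have h4 : γ * D + D ≤ β * D := by nlinarith
        rw [card_filter_lt D D _ fun t ht => iff_of_true (hs _ (by omega) (by omega)) ht]
        omega
      · omega
      · have h4 : β * D + D ≤ γ * D := by nlinarith
        rw [card_filter_lt D 0 _ fun t ht => iff_of_false (he _ (by omega) (by omega)) (by omega)]
        omega

end BlockSort

/-! ### Correctness of the columnsort step -/

section BlockSort

variable {α O : Type*} [LinearOrder O] {D g K : ℕ} {Q : ℕ → Prop} {κ : α → O}

theorem card_filter_range_mul (P : ℕ → Prop) [DecidablePred P] (g E : ℕ) :
    ((Finset.range (g * E)).filter P).card =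
      ∑ c ∈ Finset.range g, ((Finset.range E).filter fun s => P (c * E + s)).card := by
  simp only [Finset.card_filter]
  induction g with
  | zero => simp
  | succ g ih => rw [Finset.sum_range_succ, ← ih, Nat.succ_mul, Finset.sum_range_add]

/-- Among any `g` consecutive positions exactly one lies in a given residue class, so an initial
segment is split evenly among the classes, up to one element. -/
theorem card_stride {E g c z : ℕ} (hc : c < g) (hz : z ≤ E * g) :
    z / g ≤ ((Finset.range E).filter fun s => s * g + c < z).card ∧
      ((Finset.range E).filter fun s => s * g + c < z).card ≤ z / g + 1 := by
  have hg : 0 < g := by omega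
  have h1 := Nat.div_add_mod z g
  have h2 := Nat.mod_lt z hg
  constructor
  · rw [← Finset.card_range (z / g)]
    refine Finset.card_le_card fun s hs => ?_
    simp only [Finset.mem_filter, Finset.mem_range] at hs ⊢
    have h3 : (s + 1) * g ≤ z / g * g := Nat.mul_le_mul_right g hs
    have h4 := Nat.div_mul_le_self z g
    have h5 : z / g ≤ E := Nat.div_le_of_le_mul (by rwa [mul_comm])
    exact ⟨by omega, by rw [Nat.succ_mul] at h3; omega⟩
  · rw [← Finset.card_range (z / g + 1)]
    refine Finset.card_le_card fun s hs => ?_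
    simp only [Finset.mem_filter, Finset.mem_range] at hs ⊢
    rw [Nat.lt_succ_iff, Nat.le_div_iff_mul_le hg]
    omega

/-- After sorting all blocks of length `D` and then all residue classes modulo `g`, every block of
length `g D` is sorted up to a window of length `g ^ 2`. -/
theorem exists_dirty_window {E : ℕ} (hD : D = E * g)
    {a a₁ a₂ a₃ : ℕ → α} (h₁ : BlockSort D (fun b => Q (b / g)) κ a a₁)
    (h₂ : ∀ u c t, c < g → t < D → a₂ (u * (g * D) + (c * D + t)) = a₁ (u * (g * D) + (t * g + c)))
    (h₃ : BlockSort D (fun b => Q (b / g)) κ a₂ a₃) {u : ℕ} (hu : Q u) (θ : O) :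
    ∃ s, ∀ t < D, ∀ c < g,
      (t * g + c < s → κ (a₃ (u * (g * D) + (c * D + t))) ≤ θ) ∧
      (s + g * g ≤ t * g + c → ¬ κ (a₃ (u * (g * D) + (c * D + t))) ≤ θ) := by
  have hblk : ∀ c t, u * (g * D) + (c * D + t) = (u * g + c) * D + t := fun c t => by ring
  have hQ : ∀ c < g, Q ((u * g + c) / g) := fun c hc => by rwa [div_block hc]
  -- `z c` counts the small entries of the `c`-th block, which come first once it is sorted; `y c`
  -- counts those of the residue class `c`.
  let z : ℕ → ℕ := fun c =>
    ((Finset.range D).filter fun t => κ (a ((u * g + c) * D + t)) ≤ θ).card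
  have hz : ∀ c, z c ≤ E * g := fun c => by
    rw [← hD]
    simpa using Finset.card_filter_le (Finset.range D) _
  let y : ℕ → ℕ := fun c =>
    ((Finset.range D).filter fun t => κ (a₂ ((u * g + c) * D + t)) ≤ θ).card
  -- Because `g` divides `D`, every block meets the class `c` in its positions `s * g + c` with `s <
  -- E`, and a small entry is one at a position before `z c'`.
  have hy : ∀ c < g, y c = ∑ c' ∈ Finset.range g,
      ((Finset.range E).filter fun s => s * g + c < z c').card := by
    intro c hc
    have hDg : D = g * E := by rw [hD, mul_comm]
    simp only [y]
    rw [Finset.filter_congr (q := fun t => κ (a₁ (u * (g * D) + (t * g + c))) ≤ θ)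
      (fun t ht => by rw [← hblk, h₂ u c t hc (Finset.mem_range.1 ht)])]
    rw [show Finset.range D = Finset.range (g * E) by rw [hDg], card_filter_range_mul]
    refine Finset.sum_congr rfl fun c' hc' => ?_
    congr 1
    refine Finset.filter_congr fun s hs => ?_
    rw [Finset.mem_range] at hs hc'
    have h4 : s * g + c < D := by rw [hD]; nlinarith
    rw [show u * (g * D) + ((c' * E + s) * g + c) = (u * g + c') * D + (s * g + c) by
      rw [hD]; ring]
    exact h₁.le_iff (hQ c' hc') θ h4
  -- The counts of the `g` classes differ by at most `g`. When the sorted classes are interleaved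
  -- again, this leaves a window of `g * g` positions.
  have hlo : ∀ c < g, ∑ c' ∈ Finset.range g, z c' / g ≤ y c ∧
      y c ≤ ∑ c' ∈ Finset.range g, z c' / g + g := by
    intro c hc
    rw [hy c hc]
    constructor
    · exact Finset.sum_le_sum fun c' _ => (card_stride hc (hz c')).1
    · calc _ ≤ ∑ c' ∈ Finset.range g, (z c' / g + 1) :=
            Finset.sum_le_sum fun c' _ => (card_stride hc (hz c')).2
        _ = _ := by simp [Finset.sum_add_distrib]
  refine ⟨(∑ c' ∈ Finset.range g, z c' / g) * g, fun t ht c hc => ?_⟩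
  rw [hblk, h₃.le_iff (hQ c hc) θ ht]
  obtain ⟨h5, h6⟩ := hlo c hc
  change _ ≤ y c at h5
  constructor
  · intro h
    refine lt_of_lt_of_le ?_ h5
    by_contra hc'
    have := Nat.mul_le_mul_right g (not_lt.1 hc')
    omega
  · intro h h'
    have h7 : t + 1 ≤ ∑ c' ∈ Finset.range g, z c' / g + g := le_trans h' h6
    have := Nat.mul_le_mul_right g h7
    rw [Nat.succ_mul, Nat.add_mul] at this
    omega

/-- Sorting blocks of length `g D`: sort the blocks of length `D`, transpose, sort, transpose back,
sort, and sort the blocks shifted by `g ^ 2`. -/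
theorem BlockSort.mul {E N : ℕ} (hg : 0 < g) (hD : D = E * g) (hgD : 2 * (g * g) ≤ D)
    (hN : N = K * (g * D)) (hQ : ∀ u, Q u → u < K) (hH : g * g ≤ N) (hD0 : 0 < D)
    {a a₁ a₃ a₅ a₇ : ℕ → α}
    (h₁ : BlockSort D (fun b => Q (b / g)) κ a a₁)
    (h₃ : BlockSort D (fun b => Q (b / g)) κ (fun i => a₁ (transposePerm g D hg hD0 i)) a₃)
    (h₅ : BlockSort D (fun b => Q (b / g)) κ (fun i => a₃ ((transposePerm g D hg hD0).symm i)) a₅)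
    (h₇ : BlockSort D (fun b => Q (b / g) ∧ b % g ≠ 0) κ
      (fun i => a₅ ((rotPerm N (g * g) hH) i)) a₇) :
    BlockSort (g * D) Q κ a fun i => a₇ ((rotPerm N (g * g) hH).symm i) := by
  have hgD0 : 0 < g * D := Nat.mul_pos hg hD0
  have hgg : 0 < g * g := Nat.mul_pos hg hg
  obtain ⟨σ₁, h₁a, h₁b, h₁c, -⟩ := id h₁
  obtain ⟨σ₃, h₃a, h₃b, h₃c, -⟩ := id h₃
  obtain ⟨σ₅, h₅a, h₅b, h₅c, -⟩ := id h₅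
  obtain ⟨σ₇, h₇a, h₇b, h₇c, -⟩ := id h₇
  set e := transposePerm g D hg hD0 with he
  set ρ := rotPerm N (g * g) hH with hρ
  have hdd : ∀ i, i / D / g = i / (g * D) := fun i => by rw [Nat.div_div_eq_div_mul, mul_comm]
  have hsup : ∀ i j, i / D = j / D → i / (g * D) = j / (g * D) := fun i j h => by
    rw [← hdd, h, hdd]
  have hediv : ∀ i, e i / (g * D) = i / (g * D) := transposePerm_div
  have hesdiv : ∀ i, e.symm i / (g * D) = i / (g * D) := fun i => by
    rw [← hediv (e.symm i), Equiv.apply_symm_apply]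
  have hin : ∀ u i, Q u → i < g * D → u * (g * D) + i < N := by
    intro u i hu hi
    have : (u + 1) * (g * D) ≤ K * (g * D) := Nat.mul_le_mul_right _ (hQ u hu)
    rw [hN]
    rw [Nat.succ_mul] at this
    omega
  have hρ₁ : ∀ i, g * g ≤ i → i < N → ρ i = i - g * g := by
    intro i h1 h2
    change (if i < g * g then _ else if i < N then _ else _) = _
    rw [if_neg (by omega), if_pos h2]
  -- Seen in the unrotated positions, the last sort moves entries only inside the intervals of
  -- length `D` starting at `β * D - g * g`, `1 ≤ β < g`, of one long block.
  have hη : ∀ i, ρ (σ₇ (ρ.symm i)) = i ∨ ∃ u β t t', Q u ∧ 1 ≤ β ∧ β < g ∧ t < D ∧ t' < D ∧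
      i = u * (g * D) + (β * D - g * g + t) ∧
      ρ (σ₇ (ρ.symm i)) = u * (g * D) + (β * D - g * g + t') := by
    intro i
    by_cases hm : Q (ρ.symm i / D / g) ∧ ρ.symm i / D % g ≠ 0
    · right
      obtain ⟨hu, hβ⟩ := hm
      set j := ρ.symm i
      have hβg := Nat.mod_lt (j / D) hg
      have hb : j / D = j / D / g * g + j / D % g := by
        have := Nat.div_add_mod (j / D) g
        rw [mul_comm] at this
        omega
      set u := j / D / g
      set β := j / D % g
      have hblk : ∀ k, k / D = j / D → ∃ t < D, k = u * (g * D) + (β * D + t) := by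
        intro k hk
        refine ⟨k % D, Nat.mod_lt _ hD0, ?_⟩
        have := Nat.div_add_mod k D
        rw [hk, hb] at this
        exact this.symm.trans (by ring)
      have hβD : D ≤ β * D ∧ β * D + D ≤ g * D := ⟨by
        have : 1 ≤ β := by omega
        nlinarith, by nlinarith⟩
      obtain ⟨t, ht, hjt⟩ := hblk j rfl
      obtain ⟨t', ht', hjt'⟩ := hblk (σ₇ j) (h₇a j)
      refine ⟨u, β, t, t', hu, by omega, hβg, ht, ht', ?_, ?_⟩
      · have : ρ j = i := Equiv.apply_symm_apply _ _
        rw [← this, hjt, hρ₁ _ (by omega) (hin _ _ hu (by omega))]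
        omega
      · rw [hjt', hρ₁ _ (by omega) (hin _ _ hu (by omega))]
        omega
    · left
      rw [h₇b _ hm, Equiv.apply_symm_apply]
  have hηdiv : ∀ i, ρ (σ₇ (ρ.symm i)) / (g * D) = i / (g * D) := by
    intro i
    rcases hη i with h | ⟨u, β, t, t', -, h1, h2, h3, h4, h5, h6⟩
    · rw [h]
    · have : β * D + D ≤ g * D := by nlinarith
      have : D ≤ β * D := by nlinarith
      rw [h6, div_block (by omega), h5, div_block (by omega)]
  have ha₇ : ∀ i, a₇ (ρ.symm i) = a₅ (ρ (σ₇ (ρ.symm i))) := fun i => h₇c _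
  refine ⟨ρ.symm.trans (σ₇.trans (ρ.trans (σ₅.trans (e.symm.trans (σ₃.trans (e.trans σ₁)))))),
    ?_, ?_, ?_, ?_⟩
  · intro i
    simp only [Equiv.trans_apply]
    rw [hsup _ _ (h₁a _), hediv, hsup _ _ (h₃a _), hesdiv, hsup _ _ (h₅a _), hηdiv]
  · intro i hi
    have h8 : ρ (σ₇ (ρ.symm i)) = i := by
      rcases hη i with h | ⟨u, β, t, t', hu, h1, h2, h3, h4, h5, h6⟩
      · exact h
      · have : β * D + D ≤ g * D := by nlinarith
        have : D ≤ β * D := by nlinarith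
        rw [h5, div_block (by omega)] at hi
        exact absurd hu hi
    simp only [Equiv.trans_apply]
    rw [h8, h₅b i (by simpa only [hdd] using hi), h₃b _ (by simpa only [hdd, hesdiv] using hi),
      Equiv.apply_symm_apply, h₁b i (by simpa only [hdd] using hi)]
  · intro i
    simp only [Equiv.trans_apply]
    simp only [ha₇, h₅c, h₃c, h₁c]
  -- A form of the zero-one principle: a block is sorted as soon as, for every threshold `θ`, the
  -- entries with key at most `θ` form an initial segment.
  · suffices H : ∀ u, Q u → ∀ θ, ∃ s', ∀ i < g * D,
        κ (a₇ (ρ.symm (u * (g * D) + i))) ≤ θ ↔ i < s' by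
      intro i j hij hd hq
      obtain ⟨s', hs'⟩ := H _ hq (κ (a₇ (ρ.symm j)))
      have h1 := Nat.div_add_mod i (g * D)
      have h2 := Nat.div_add_mod j (g * D)
      have h3 := hs' (i % (g * D)) (Nat.mod_lt _ hgD0)
      have h4 := hs' (j % (g * D)) (Nat.mod_lt _ hgD0)
      rw [mul_comm, h1] at h3
      rw [hd, mul_comm, h2] at h4
      rw [h3]
      have h5 := h4.1 le_rfl
      rw [hd] at h1
      omega
    intro u hu θ
    obtain ⟨s₀, hs₀⟩ := exists_dirty_window hD h₁
      (fun u c t hc ht => by rw [he, transposePerm_apply hc ht]) h₃ hu θ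
    have hblk : ∀ c t, u * (g * D) + (c * D + t) = (u * g + c) * D + t := fun c t => by ring
    have hQc : ∀ c < g, Q ((u * g + c) / g) := fun c hc => by rwa [div_block hc]
    have hP4 : ∀ i < g * D, (i < s₀ → κ (a₃ (e.symm (u * (g * D) + i))) ≤ θ) ∧
        (s₀ + g * g ≤ i → ¬ κ (a₃ (e.symm (u * (g * D) + i))) ≤ θ) := by
      intro i hi
      have h1 : i / g < D := Nat.div_lt_of_lt_mul hi
      have h2 := Nat.mod_lt i hg
      have h3 := Nat.div_add_mod i g
      have h4 := hs₀ _ h1 _ h2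
      rw [← transposePerm_symm_apply (hg := hg) (hD := hD0) h2 h1, mul_comm (i / g), h3] at h4
      exact h4
    let w : ℕ → ℕ := fun c => ((Finset.range D).filter fun t =>
      κ (a₃ (e.symm ((u * g + c) * D + t))) ≤ θ).card
    have hw : ∀ c < g, ∀ t < D, κ (a₅ (u * (g * D) + (c * D + t))) ≤ θ ↔ t < w c := by
      intro c hc t ht
      rw [hblk]
      exact h₅.le_iff (hQc c hc) θ ht
    have hcD : ∀ c < g, c * D + D ≤ g * D := fun c hc => by nlinarith
    have hdec : ∀ i < g * D, ∃ c < g, ∃ t < D, i = c * D + t := fun i hi =>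
      ⟨i / D, (Nat.div_lt_iff_lt_mul hD0).2 hi, i % D, Nat.mod_lt _ hD0, by
        rw [mul_comm, Nat.div_add_mod]⟩
    -- Sorting the short blocks does not enlarge the window: within each of them, the entries before
    -- the window are small and remain in front, and those behind it are large and remain at the
    -- end.
    have hF1 : ∀ i < g * D, i < s₀ → κ (a₅ (u * (g * D) + i)) ≤ θ := by
      intro i hi his
      obtain ⟨c, hc, t, ht, rfl⟩ := hdec i hi
      rw [hw c hc t ht]
      have hle : Finset.range (t + 1) ⊆ (Finset.range D).filter fun t =>
          κ (a₃ (e.symm ((u * g + c) * D + t))) ≤ θ := by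
        intro s hs
        simp only [Finset.mem_filter, Finset.mem_range] at hs ⊢
        rw [← hblk]
        have := hcD c hc
        exact ⟨by omega, (hP4 _ (by omega)).1 (by omega)⟩
      simpa using Finset.card_le_card hle
    have hF2 : ∀ i < g * D, s₀ + g * g ≤ i → ¬ κ (a₅ (u * (g * D) + i)) ≤ θ := by
      intro i hi his
      obtain ⟨c, hc, t, ht, rfl⟩ := hdec i hi
      rw [hw c hc t ht, not_lt]
      have hle : ((Finset.range D).filter fun t =>
          κ (a₃ (e.symm ((u * g + c) * D + t))) ≤ θ) ⊆ Finset.range t := by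
        intro s hs
        simp only [Finset.mem_filter, Finset.mem_range] at hs ⊢
        rw [← hblk] at hs
        have := hcD c hc
        by_contra hst
        exact (hP4 _ (by omega)).2 (by omega) hs.2
      simpa using Finset.card_le_card hle
    have hshift₁ : ∀ i < g * D, (i + g * g < D ∨ g * D ≤ i + g * g) →
        (κ (a₇ (ρ.symm (u * (g * D) + i))) ≤ θ ↔ κ (a₅ (u * (g * D) + i)) ≤ θ) := by
      intro i hi hi'
      rw [ha₇]
      rcases hη (u * (g * D) + i) with h | ⟨u', β, t, t', -, h1, h2, h3, h4, h5, h6⟩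
      · rw [h]
      · exfalso
        have h7 := hcD β h2
        have h8 : D ≤ β * D := by nlinarith
        have h9 : u = u' := by
          have := congrArg (· / (g * D)) h5
          simp only [div_block hi] at this
          rwa [div_block (by omega)] at this
        subst h9
        omega
    have hshift₂ : ∀ β, 1 ≤ β → β < g → ∀ t < D,
        (κ (a₇ (ρ.symm (u * (g * D) + (β * D - g * g + t)))) ≤ θ ↔
          t < ((Finset.range D).filter fun t =>
            κ (a₅ (u * (g * D) + (β * D - g * g + t))) ≤ θ).card) := by
      intro β hβ1 hβg t ht
      have h7 := hcD β hβg
      have h8 : D ≤ β * D := by nlinarith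
      have h9 : ∀ t < D, ρ ((u * g + β) * D + t) = u * (g * D) + (β * D - g * g + t) := by
        intro t ht
        rw [← hblk, hρ₁ _ (by omega) (hin _ _ hu (by omega))]
        omega
      rw [← h9 t ht, Equiv.symm_apply_apply,
        h₇.le_iff ⟨hQc β hβg, by rw [Nat.mul_add_mod_self_right, Nat.mod_eq_of_lt hβg]; omega⟩ θ ht]
      rw [Finset.filter_congr fun t ht => by rw [h9 t (Finset.mem_range.1 ht)]]
    have h5 := Nat.div_add_mod s₀ D
    have h6 := Nat.mod_lt s₀ hD0
    have h7 : D * (s₀ / D) = s₀ / D * D := mul_comm _ _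
    have h8 : (s₀ / D + 1) * D = s₀ / D * D + D := by ring
    -- If the window lies in a single short block, or starts in the last one, sorting that block has
    -- already removed it. Otherwise it crosses the border at `β * D` with `β = s₀ / D + 1`, and `2
    -- * (g * g) ≤ D` puts it entirely into the shifted block `β`.
    by_cases hc : s₀ + g * g ≤ (s₀ / D + 1) * D ∨ g ≤ s₀ / D + 1
    · have hcl : ∀ i < g * D, κ (a₅ (u * (g * D) + i)) ≤ θ ↔ i < s₀ / D * D + w (s₀ / D) := by
        intro i hi
        obtain ⟨c, hcg, t, ht, rfl⟩ := hdec i hi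
        rcases lt_trichotomy c (s₀ / D) with h | rfl | h
        · have h9 : (c + 1) * D ≤ s₀ / D * D := Nat.mul_le_mul_right D h
          rw [Nat.succ_mul] at h9
          exact iff_of_true (hF1 _ hi (by omega)) (by omega)
        · rw [hw _ hcg t ht]
          omega
        · have h9 : (s₀ / D + 1) * D ≤ c * D := Nat.mul_le_mul_right D h
          have hwle : w (s₀ / D) ≤ D := by
            simpa using Finset.card_filter_le (Finset.range D) _
          exact iff_of_false (hF2 _ hi (by omega)) (by omega)
      exact exists_initial_of_shifted (by omega) _ _ (fun i hi => (hcl i hi).2)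
        (fun i hi h h' => absurd ((hcl i hi).1 h') (not_lt.2 h)) (Or.inl rfl) hshift₁ hshift₂
    · push Not at hc
      exact exists_initial_of_shifted (by omega) _ _ hF1 hF2
        (Or.inr ⟨s₀ / D + 1, Nat.le_add_left 1 _, hc.2, by omega, by omega⟩) hshift₁ hshift₂

end BlockSort

/-! ### Distributed sorting -/

section ArraySort

variable {p w m : ℕ} {A X α O : Type*} {inp : X → Fin p → Set A} {Λ : X → ℕ}
  {l l' : List (Round X A p w m)} {h : ℕ → Fin p} {φ g J M v T : ℕ} {enc : α → Msg A w m}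
  {a : X → ℕ → α}

/-- The array `a` of length `M v` is stored: the host of virtual processor `b` knows the `b`-th
block of length `M` and holds the data items of its entries. -/
structure HasArray (inp : X → Fin p → Set A) (l : List (Round X A p w m)) (h : ℕ → Fin p)
    (M v : ℕ) (enc : α → Msg A w m) (a : X → ℕ → α) : Prop where
  knows : ∀ i < M * v, Knows inp l (h (i / M)) fun x => a x i
  held : ∀ i < M * v, ∀ x y, (enc (a x i)).atom = some y → y ∈ heldAfter inp l x (h (i / M))

theorem HasArray.extend (H : HasArray inp l h M v enc a) (hl : Extends inp Λ T l l') :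
    HasArray inp l' h M v enc a :=
  ⟨fun i hi => (H.knows i hi).extend hl,
    fun i hi x y hy => heldAfter_extend hl x _ (H.held i hi x y hy)⟩

/-- The permutation is the same in all scenarios, so no addresses have to be communicated, and
injectivity of `enc` lets the receiver decode the entry. -/
theorem HasArray.permute (H : HasArray inp l h M v enc a) (hf : Feasible inp l)
    (hφ : HostLE h v φ) (hΛ : ∀ x, M * φ ≤ Λ x) (henc : Function.Injective enc)
    (π : Equiv.Perm ℕ) (hπ : ∀ i < M * v, π i < M * v) :
    ∃ l', Extends inp Λ 1 l l' ∧ HasArray inp l' h M v enc fun x i => a x (π i) := by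
  classical
  obtain ⟨l', hl', H'⟩ := route (Λ := Λ) hf (Finset.range (M * v)) (fun i => h (π i / M))
    (fun i => h (i / M)) (fun x i => enc (a x (π i)))
    (fun i hi => (H.knows _ (hπ i (Finset.mem_range.1 hi))).comp enc)
    (fun x i hi y hy => H.held _ (hπ i (Finset.mem_range.1 hi)) x y hy)
    (fun x q => by
      refine le_trans (Finset.card_le_card_of_injOn π ?_ π.injective.injOn)
        ((hφ.div M q).trans (hΛ x))
      intro i hi
      simp only [Finset.coe_filter, Finset.mem_range, Set.mem_ofPred_eq] at hi ⊢
      exact ⟨hπ i hi.1, hi.2⟩)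
    (fun x q => (hφ.div M q).trans (hΛ x))
  refine ⟨l', hl', ⟨fun i hi x x' hx => ?_, fun i hi x y hy => ?_⟩⟩
  · exact henc ((H' i (Finset.mem_range.2 hi)).1 x x' hx)
  · exact (H' i (Finset.mem_range.2 hi)).2 x y hy

/-- The permutation of `ℕ` that acts by `τ b` on the `b`-th block of length `M`. -/
def blockPerm (M : ℕ) (hM : 0 < M) (τ : ℕ → Equiv.Perm (Fin M)) : Equiv.Perm ℕ where
  toFun i := i / M * M + τ (i / M) ⟨i % M, Nat.mod_lt i hM⟩
  invFun i := i / M * M + (τ (i / M)).symm ⟨i % M, Nat.mod_lt i hM⟩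
  left_inv i := by
    have h1 := div_block (b := i / M) (τ (i / M) ⟨i % M, Nat.mod_lt i hM⟩).2
    simp only [h1, Nat.mul_add_mod_self_right, Nat.mod_eq_of_lt (Fin.is_lt _), Fin.eta,
      Equiv.symm_apply_apply]
    rw [mul_comm, Nat.div_add_mod]
  right_inv i := by
    have h1 := div_block (b := i / M) ((τ (i / M)).symm ⟨i % M, Nat.mod_lt i hM⟩).2
    simp only [h1, Nat.mul_add_mod_self_right, Nat.mod_eq_of_lt (Fin.is_lt _), Fin.eta,
      Equiv.apply_symm_apply]
    rw [mul_comm, Nat.div_add_mod]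

variable [LinearOrder O] {key : X → α → O}

open Classical in
/-- Local sorting of blocks. -/
theorem HasArray.sort_local (H : HasArray inp l h M v enc a) (hM : 0 < M)
    (hkey : ∀ q, Knows inp l q key) (Q : ℕ → Prop) :
    ∃ a', HasArray inp l h M v enc a' ∧ ∀ x, BlockSort M Q (key x) (a x) (a' x) := by
  let τ : X → ℕ → Equiv.Perm (Fin M) := fun x b =>
    if Q b then Tuple.sort (fun t : Fin M => key x (a x (b * M + t))) else 1
  let σ : X → Equiv.Perm ℕ := fun x => blockPerm M hM (τ x)
  have hσ : ∀ x i, σ x i = i / M * M + τ x (i / M) ⟨i % M, Nat.mod_lt i hM⟩ := fun _ _ => rfl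
  have hσd : ∀ x i, σ x i / M = i / M := fun x i => by
    rw [hσ]
    exact div_block (Fin.is_lt _)
  have hlt : ∀ i j, i < M * v → j / M = i / M → j < M * v := by
    intro i j hi hj
    have := Nat.div_lt_of_lt_mul hi
    rw [← hj] at this
    rw [mul_comm]
    exact (Nat.div_lt_iff_lt_mul hM).1 this
  refine ⟨fun x i => a x (σ x i), ⟨fun i hi x x' hx => ?_, fun i hi x y hy => ?_⟩,
    fun x => ⟨σ x, hσd x, fun i hi => ?_, fun _ => rfl, fun i j hij hd hq => ?_⟩⟩
  · have hb : ∀ t : Fin M, a x (i / M * M + t) = a x' (i / M * M + t) := by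
      intro t
      have h1 : (i / M * M + t) / M = i / M := div_block t.2
      have := H.knows (i / M * M + t) (hlt i _ hi h1)
      rw [h1] at this
      exact this x x' hx
    have hτ : τ x (i / M) = τ x' (i / M) := by
      simp only [τ, hb, hkey _ x x' hx]
    simp only [hσ, hτ, hb]
  · have := H.held (σ x i) (hlt i _ hi (hσd x i)) x y hy
    rwa [hσd] at this
  · rw [hσ]
    simp only [τ, if_neg hi, Equiv.Perm.one_apply]
    rw [mul_comm, Nat.div_add_mod]
  · have hs := Tuple.monotone_sort (fun t : Fin M => key x (a x (i / M * M + t)))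
    have h1 : (⟨i % M, Nat.mod_lt i hM⟩ : Fin M) ≤ ⟨j % M, Nat.mod_lt j hM⟩ := by
      have h2 := Nat.div_add_mod i M
      have h3 := Nat.div_add_mod j M
      rw [← hd] at h3
      simp only [Fin.mk_le_mk]
      omega
    have := hs h1
    simp only [Function.comp_apply] at this
    simp only [hσ, ← hd, τ, if_pos hq]
    exact this

/-- The number of rounds used to sort blocks of length `M g ^ j`. -/
def sortRounds : ℕ → ℕ
  | 0 => 0
  | j + 1 => 4 * sortRounds j + 4

/-- Blocks of length `M` are sorted locally. Each step of the induction multiplies the length by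
`g`, at the price of four sorts of shorter blocks and four fixed permutations. -/
theorem HasArray.sort_blocks {E : ℕ} (hg : 0 < g) (hM : 0 < M) (hME : M = E * g)
    (hMg : 2 * (g * g) ≤ M) (hφ : HostLE h (g ^ J) φ) (hΛ : ∀ x, M * φ ≤ Λ x)
    (henc : Function.Injective enc) (j : ℕ) (hj : j ≤ J) (l : List (Round X A p w m))
    (a : X → ℕ → α) (H : HasArray inp l h M (g ^ J) enc a) (hf : Feasible inp l)
    (hkey : ∀ q, Knows inp l q key) (Q : ℕ → Prop) (hQ : ∀ u, Q u → u < g ^ (J - j)) :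
    ∃ l' a', Extends inp Λ (sortRounds j) l l' ∧ HasArray inp l' h M (g ^ J) enc a' ∧
      ∀ x, BlockSort (M * g ^ j) Q (key x) (a x) (a' x) := by
  induction j generalizing l a Q with
  | zero =>
    obtain ⟨a', h1, h2⟩ := H.sort_local hM hkey Q
    exact ⟨l, a', Extends.refl hf, h1, by simpa using h2⟩
  | succ j ih =>
    have hD0 : 0 < M * g ^ j := Nat.mul_pos hM (Nat.pow_pos hg)
    have hgj : 0 < g ^ j := Nat.pow_pos hg
    have hMD : M ≤ M * g ^ j := Nat.le_mul_of_pos_right M hgj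
    have hN : M * g ^ J = g ^ (J - (j + 1)) * (g * (M * g ^ j)) := by
      conv_lhs => rw [← Nat.sub_add_cancel hj, pow_add, pow_succ]
      ring
    have hHN : g * g ≤ M * g ^ J := by
      have := Nat.le_mul_of_pos_right M (Nat.pow_pos hg (n := J))
      omega
    have hQ' : ∀ b, Q (b / g) → b < g ^ (J - j) := by
      intro b hb
      have := (Nat.div_lt_iff_lt_mul hg).1 (hQ _ hb)
      rwa [← pow_succ, show J - (j + 1) + 1 = J - j by omega] at this
    have hdiv : ∀ {i i' : ℕ}, i' / (g * (M * g ^ j)) = i / (g * (M * g ^ j)) →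
        i < M * g ^ J → i' < M * g ^ J := by
      intro i i' hd hi
      rw [hN] at hi ⊢
      have hpos : 0 < g * (M * g ^ j) := Nat.mul_pos hg hD0
      rw [← Nat.div_lt_iff_lt_mul hpos] at hi ⊢
      rwa [hd]
    obtain ⟨l₁, a₁, e₁, H₁, S₁⟩ := ih (by omega) l a H hf hkey (fun b => Q (b / g)) hQ'
    obtain ⟨l₂, e₂, H₂⟩ := H₁.permute e₁.feasible hφ hΛ henc (transposePerm g (M * g ^ j) hg hD0)
      fun i hi => hdiv (transposePerm_div i) hi
    have hk₂ := fun q => ((hkey q).extend e₁).extend e₂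
    obtain ⟨l₃, a₃, e₃, H₃, S₃⟩ := ih (by omega) l₂ _ H₂ e₂.feasible hk₂ (fun b => Q (b / g)) hQ'
    obtain ⟨l₄, e₄, H₄⟩ := H₃.permute e₃.feasible hφ hΛ henc
      (transposePerm g (M * g ^ j) hg hD0).symm fun i hi => hdiv
        (by rw [← transposePerm_div (hg := hg) (hD := hD0), Equiv.apply_symm_apply]) hi
    have hk₄ := fun q => ((hk₂ q).extend e₃).extend e₄
    obtain ⟨l₅, a₅, e₅, H₅, S₅⟩ := ih (by omega) l₄ _ H₄ e₄.feasible hk₄ (fun b => Q (b / g)) hQ'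
    obtain ⟨l₆, e₆, H₆⟩ := H₅.permute e₅.feasible hφ hΛ henc (rotPerm (M * g ^ J) (g * g) hHN)
      fun i hi => by
        change (if i < g * g then _ else if i < M * g ^ J then _ else _) < _
        split_ifs <;> omega
    have hk₆ := fun q => ((hk₄ q).extend e₅).extend e₆
    -- After the rotation the blocks with `b % g = 0` contain parts of two different long blocks
    -- (cyclically) and must stay untouched. For this reason the induction is over all predicates
    -- `Q`.
    obtain ⟨l₇, a₇, e₇, H₇, S₇⟩ := ih (by omega) l₆ _ H₆ e₆.feasible hk₆
      (fun b => Q (b / g) ∧ b % g ≠ 0) fun b hb => hQ' b hb.1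
    obtain ⟨l₈, e₈, H₈⟩ := H₇.permute e₇.feasible hφ hΛ henc
      (rotPerm (M * g ^ J) (g * g) hHN).symm fun i hi => by
        change (if i < M * g ^ J - g * g then _ else if i < M * g ^ J then _ else _) < _
        split_ifs <;> omega
    refine ⟨l₈, _, ((((((e₁.trans e₂).trans e₃).trans e₄).trans e₅).trans e₆).trans
      e₇).trans e₈ |>.mono (by simp only [sortRounds]; omega), H₈, fun x => ?_⟩
    have := BlockSort.mul (E := E * g ^ j) (N := M * g ^ J) hg (by rw [hME]; ring) (by omega) hN
      hQ hHN hD0 (S₁ x) (S₃ x) (S₅ x) (S₇ x)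
    rwa [show M * g ^ (j + 1) = g * (M * g ^ j) by ring]

/-- Sorting the whole array. -/
theorem HasArray.sort {E : ℕ} (H : HasArray inp l h M (g ^ J) enc a) (hg : 0 < g) (hM : 0 < M)
    (hME : M = E * g) (hMg : 2 * (g * g) ≤ M) (hφ : HostLE h (g ^ J) φ) (hΛ : ∀ x, M * φ ≤ Λ x)
    (henc : Function.Injective enc) (hf : Feasible inp l) (hkey : ∀ q, Knows inp l q key) :
    ∃ l' a', Extends inp Λ (sortRounds J) l l' ∧ HasArray inp l' h M (g ^ J) enc a' ∧
      ∀ x, (∃ σ : Equiv.Perm ℕ, (∀ i, σ i < M * g ^ J ↔ i < M * g ^ J) ∧ ∀ i, a' x i = a x (σ i)) ∧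
        ∀ i j, i ≤ j → j < M * g ^ J → key x (a' x i) ≤ key x (a' x j) := by
  obtain ⟨l', a', h1, h2, h3⟩ := sort_blocks hg hM hME hMg hφ hΛ henc J le_rfl l a H hf hkey
    (fun u => u = 0) (by simp)
  have hN : 0 < M * g ^ J := Nat.mul_pos hM (Nat.pow_pos hg)
  have hz : ∀ i, i / (M * g ^ J) = 0 ↔ i < M * g ^ J := fun i => by
    rw [Nat.div_eq_zero_iff]
    omega
  refine ⟨l', a', h1, h2, fun x => ?_⟩
  obtain ⟨σ, h4, -, h5, h6⟩ := h3 x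
  refine ⟨⟨σ, fun i => by rw [← hz, h4, hz], h5⟩, fun i j hij hj => h6 i j hij ?_ ?_⟩
  · rw [(hz j).2 hj, (hz i).2 (by omega)]
  · exact (hz i).2 (by omega)

end ArraySort

/-! ### Join plans: combinatorics of a sorted array of labels

An entry has a label `(group, side)`; entries of the same group on different sides have to meet. -/

section Plan

variable {G : Type*} [LinearOrder G] {N M L v : ℕ} {κ : ℕ → G ×ₗ Bool}

/-- The group of position `i`. -/
def grp (κ : ℕ → G ×ₗ Bool) (i : ℕ) : G := (ofLex (κ i)).1

/-- The side of position `i`. -/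
def side (κ : ℕ → G ×ₗ Bool) (i : ℕ) : Bool := (ofLex (κ i)).2

/-- The number of positions with a smaller label. -/
def lowPos (N : ℕ) (κ : ℕ → G ×ₗ Bool) (i : ℕ) : ℕ :=
  ((Finset.range N).filter fun j => κ j < κ i).card

/-- The number of positions with the same label. -/
def ownCount (N : ℕ) (κ : ℕ → G ×ₗ Bool) (i : ℕ) : ℕ :=
  ((Finset.range N).filter fun j => κ j = κ i).card

/-- The number of positions in a smaller group. -/
def grpPos (N : ℕ) (κ : ℕ → G ×ₗ Bool) (i : ℕ) : ℕ :=
  ((Finset.range N).filter fun j => grp κ j < grp κ i).card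

/-- The number of positions in the same group on the other side. -/
def oppCount (N : ℕ) (κ : ℕ → G ×ₗ Bool) (i : ℕ) : ℕ :=
  ((Finset.range N).filter fun j => grp κ j = grp κ i ∧ κ j ≠ κ i).card

/-- The group of position `i` meets more than one block of length `M`. -/
def IsHeavy (N M : ℕ) (κ : ℕ → G ×ₗ Bool) (i : ℕ) : Prop :=
  grpPos N κ i / M ≠ (grpPos N κ i + ownCount N κ i + oppCount N κ i - 1) / M

/-- Division rounded up. -/
def ceilQuot (L x : ℕ) : ℕ := (x + L - 1) / L

open Classical in
/-- The number of copies of the entry at position `i`. -/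
noncomputable def copies (N M L : ℕ) (κ : ℕ → G ×ₗ Bool) (i : ℕ) : ℕ :=
  if IsHeavy N M κ i then ceilQuot L (oppCount N κ i) else 0

open Classical in
/-- The number of cells in the grid of the group that starts at position `i`. -/
noncomputable def gridSize (N M L : ℕ) (κ : ℕ → G ×ₗ Bool) (i : ℕ) : ℕ :=
  if IsHeavy N M κ i ∧ i = grpPos N κ i then
    ceilQuot L (ownCount N κ i) * ceilQuot L (oppCount N κ i) else 0

/-- The first cell of the grid of the group of position `i`. -/
noncomputable def gridBase (N M L : ℕ) (κ : ℕ → G ×ₗ Bool) (i : ℕ) : ℕ :=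
  ∑ j ∈ Finset.Ico (i + 1) N, gridSize N M L κ j

/-- The index of the first copy of the entry at position `i`. -/
noncomputable def copyPos (N M L : ℕ) (κ : ℕ → G ×ₗ Bool) (i : ℕ) : ℕ :=
  ∑ j ∈ Finset.Ico (i + 1) N, copies N M L κ j

/-- The cell of the `0`-th copy of the entry at position `i`. -/
noncomputable def cell₀ (N M L : ℕ) (κ : ℕ → G ×ₗ Bool) (i : ℕ) : ℕ :=
  gridBase N M L κ i + (i - lowPos N κ i) / L *
    (if side κ i then 1 else ceilQuot L (oppCount N κ i))

/-- The distance of the cells of consecutive copies of the entry at position `i`. -/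
def cellStep (N L : ℕ) (κ : ℕ → G ×ₗ Bool) (i : ℕ) : ℕ :=
  if side κ i then ceilQuot L (ownCount N κ i) else 1

theorem label_eq_iff {G : Type*} {κ : ℕ → G ×ₗ Bool} {i j : ℕ} : κ i = κ j ↔ grp κ i = grp κ j ∧ side κ i = side κ j := by
  rw [← ofLex_inj, Prod.ext_iff]
  rfl

theorem grp_le_of_le {i j : ℕ} (h : κ i ≤ κ j) : grp κ i ≤ grp κ j := by
  rcases Prod.Lex.le_iff.1 h with h | h
  exacts [h.le, h.1.le]

/-- `κ` is sorted on `{0, …, N - 1}`. -/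
def SortedOn (N : ℕ) (κ : ℕ → G ×ₗ Bool) : Prop := ∀ i j, i ≤ j → j < N → κ i ≤ κ j

theorem card_le_lowPos (i : ℕ) : ((Finset.range N).filter fun j => κ j ≤ κ i).card =
    lowPos N κ i + ownCount N κ i := by
  rw [lowPos, ownCount, ← Finset.card_union_of_disjoint]
  · congr 1
    ext j
    simp only [Finset.mem_filter, Finset.mem_union, le_iff_lt_or_eq, ← and_or_left]
  · rw [Finset.disjoint_filter]
    exact fun j _ h h' => h.ne h'

theorem card_grp_eq (i : ℕ) : ((Finset.range N).filter fun j => grp κ j = grp κ i).card =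
    ownCount N κ i + oppCount N κ i := by
  rw [ownCount, oppCount, ← Finset.card_union_of_disjoint]
  · congr 1
    ext j
    simp only [Finset.mem_filter, Finset.mem_union, label_eq_iff, ne_eq]
    tauto
  · rw [Finset.disjoint_filter]
    exact fun j _ h h' => h'.2 h

theorem card_le_grpPos (i : ℕ) : ((Finset.range N).filter fun j => grp κ j ≤ grp κ i).card =
    grpPos N κ i + ownCount N κ i + oppCount N κ i := by
  rw [add_assoc, ← card_grp_eq, grpPos, ← Finset.card_union_of_disjoint]
  · congr 1
    ext j
    simp only [Finset.mem_filter, Finset.mem_union, le_iff_lt_or_eq, ← and_or_left]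
  · rw [Finset.disjoint_filter]
    exact fun j _ h h' => h.ne h'

/-- A property inherited by smaller positions holds on an initial segment. This turns the counts
`lowPos` and `grpPos` into borders of runs of a sorted array. -/
theorem card_downset {P : ℕ → Prop} [DecidablePred P] (hP : ∀ i j, i ≤ j → j < N → P j → P i)
    {i : ℕ} (hi : i < N) : i < ((Finset.range N).filter P).card ↔ P i := by
  constructor
  · intro h
    by_contra hc
    have : (Finset.range N).filter P ⊆ Finset.range i := by
      intro j hj
      simp only [Finset.mem_filter, Finset.mem_range] at hj ⊢
      by_contra hij
      exact hc (hP i j (by omega) hj.1 hj.2)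
    have := Finset.card_le_card this
    rw [Finset.card_range] at this
    omega
  · intro h
    have : Finset.range (i + 1) ⊆ (Finset.range N).filter P := by
      intro j hj
      simp only [Finset.mem_filter, Finset.mem_range] at hj ⊢
      exact ⟨by omega, hP j i (by omega) hi h⟩
    simpa using Finset.card_le_card this

theorem SortedOn.lt_lowPos_iff (hκ : SortedOn N κ) {i j : ℕ} (hj : j < N) : j < lowPos N κ i ↔ κ j < κ i :=
  card_downset (fun a b hab hb h => (hκ a b hab hb).trans_lt h) hj

theorem SortedOn.lt_highPos_iff (hκ : SortedOn N κ) {i j : ℕ} (hj : j < N) : j < lowPos N κ i + ownCount N κ i ↔ κ j ≤ κ i := by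
  rw [← card_le_lowPos]
  exact card_downset (fun a b hab hb h => (hκ a b hab hb).trans h) hj

theorem SortedOn.lt_grpPos_iff (hκ : SortedOn N κ) {i j : ℕ} (hj : j < N) : j < grpPos N κ i ↔ grp κ j < grp κ i :=
  card_downset (fun a b hab hb h => (grp_le_of_le (hκ a b hab hb)).trans_lt h) hj

theorem SortedOn.lt_grpEnd_iff (hκ : SortedOn N κ) {i j : ℕ} (hj : j < N) :
    j < grpPos N κ i + ownCount N κ i + oppCount N κ i ↔ grp κ j ≤ grp κ i := by
  rw [← card_le_grpPos]
  exact card_downset (fun a b hab hb h => (grp_le_of_le (hκ a b hab hb)).trans h) hj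

theorem SortedOn.lowPos_le (hκ : SortedOn N κ) {i : ℕ} (hi : i < N) : lowPos N κ i ≤ i := by
  by_contra h
  exact lt_irrefl _ ((hκ.lt_lowPos_iff hi).1 (not_le.1 h))

theorem SortedOn.lt_high (hκ : SortedOn N κ) {i : ℕ} (hi : i < N) : i < lowPos N κ i + ownCount N κ i :=
  (hκ.lt_highPos_iff hi).2 le_rfl

theorem SortedOn.grpPos_le (hκ : SortedOn N κ) {i : ℕ} (hi : i < N) : grpPos N κ i ≤ i := by
  by_contra h
  exact lt_irrefl _ ((hκ.lt_grpPos_iff hi).1 (not_le.1 h))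

theorem SortedOn.lt_grpEnd (hκ : SortedOn N κ) {i : ℕ} (hi : i < N) : i < grpPos N κ i + ownCount N κ i + oppCount N κ i :=
  (hκ.lt_grpEnd_iff hi).2 le_rfl

theorem grpPos_congr {i j : ℕ} (h : grp κ i = grp κ j) : grpPos N κ i = grpPos N κ j := by
  simp only [grpPos, h]

theorem ownCount_congr {i j : ℕ} (h : κ i = κ j) : ownCount N κ i = ownCount N κ j := by
  simp only [ownCount, h]

theorem oppCount_congr {i j : ℕ} (h : κ i = κ j) : oppCount N κ i = oppCount N κ j := by
  simp only [oppCount, h, (label_eq_iff.1 h).1]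

theorem oppCount_eq_ownCount {i j : ℕ} (h : grp κ i = grp κ j) (hne : κ i ≠ κ j) :
    oppCount N κ i = ownCount N κ j := by
  rw [oppCount, ownCount]
  congr 1
  ext k
  have hs : side κ i ≠ side κ j := fun hs => hne (label_eq_iff.2 ⟨h, hs⟩)
  simp only [Finset.mem_filter, label_eq_iff, h, and_congr_right_iff, ne_eq]
  intro _
  revert hs
  cases side κ i <;> cases side κ j <;> cases side κ k <;> simp

theorem total_congr {i j : ℕ} (h : grp κ i = grp κ j) :
    ownCount N κ i + oppCount N κ i = ownCount N κ j + oppCount N κ j := by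
  rw [← card_grp_eq, ← card_grp_eq, h]

theorem isHeavy_congr {i j : ℕ} (h : grp κ i = grp κ j) : IsHeavy N M κ i ↔ IsHeavy N M κ j := by
  simp only [IsHeavy, add_assoc, total_congr h, grpPos_congr h]

theorem lowPos_congr {i j : ℕ} (h : κ i = κ j) : lowPos N κ i = lowPos N κ j := by
  simp only [lowPos, h]

theorem lt_ceilQuot {L x r : ℕ} (hL : 0 < L) (h : r < x) : r / L < ceilQuot L x := by
  rw [ceilQuot, Nat.div_lt_iff_lt_mul hL]
  have := Nat.lt_div_mul_add hL (a := x + L - 1)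
  omega

theorem ceilQuot_mul_le {L x : ℕ} : ceilQuot L x * L ≤ x + L := by
  have := Nat.div_mul_le_self (x + L - 1) L
  rw [ceilQuot]
  omega

theorem copies_mul_le (i : ℕ) : copies N M L κ i * L ≤ oppCount N κ i + L := by
  rw [copies]
  split_ifs
  · exact ceilQuot_mul_le
  · simp

/-- Twice the join size. -/
def joinSize (N : ℕ) (κ : ℕ → G ×ₗ Bool) : ℕ := ∑ i ∈ Finset.range N, oppCount N κ i

/-- An entry has at most `oppCount / L + 1` copies. In total this is at most `joinSize / L + N`, and
both summands are at most `L * v`. -/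
theorem sum_copies_le (hN : N = M * v) (hL : 0 < L) (hML : M ≤ L) (hQ : joinSize N κ ≤ L * L * v) :
    ∑ i ∈ Finset.range N, copies N M L κ i ≤ 2 * L * v := by
  refine Nat.le_of_mul_le_mul_right ?_ hL
  calc (∑ i ∈ Finset.range N, copies N M L κ i) * L
      ≤ ∑ i ∈ Finset.range N, (oppCount N κ i + L) := by
        rw [Finset.sum_mul]
        exact Finset.sum_le_sum fun i _ => copies_mul_le i
    _ = joinSize N κ + N * L := by simp [Finset.sum_add_distrib, joinSize]
    _ ≤ L * L * v + L * v * L := by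
        have : N ≤ L * v := hN ▸ Nat.mul_le_mul_right v hML
        exact Nat.add_le_add hQ (Nat.mul_le_mul_right L this)
    _ = 2 * L * v * L := by ring

open Classical in
-- A heavy group with `x` and `y` entries on its sides has at most `(x / L + 1) * (y / L + 1)`
-- cells. The products `x * y` sum to at most `L * L * v`, the sums `x + y` to at most `N ≤ L * v`,
-- and there are at most `v` heavy groups: if two groups start in the same block, the first one ends
-- there and is not heavy. Each of these three bounds contributes `v` cells.
theorem sum_gridSize_le (hκ : SortedOn N κ) (hN : N = M * v) (hM : 0 < M) (hML : M ≤ L)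
    (hQ : joinSize N κ ≤ L * L * v) :
    ∑ i ∈ Finset.range N, gridSize N M L κ i ≤ 3 * v := by
  have hL : 0 < L := by omega
  set S := (Finset.range N).filter fun i => IsHeavy N M κ i ∧ i = grpPos N κ i with hS
  have hmem : ∀ s ∈ S, s < N ∧ IsHeavy N M κ s ∧ s = grpPos N κ s := by
    intro s hs
    simpa [hS] using hs
  have hinj : ∀ s ∈ S, ∀ t ∈ S, grp κ s = grp κ t → s = t := by
    intro s hs t ht h
    rw [(hmem s hs).2.2, (hmem t ht).2.2, grpPos_congr h]
  have hfib : ∀ f : ℕ → ℕ, ∑ s ∈ S, ∑ j ∈ (Finset.range N).filter (fun j => grp κ j = grp κ s), f j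
      ≤ ∑ j ∈ Finset.range N, f j := by
    intro f
    simp only [Finset.sum_filter]
    rw [Finset.sum_comm]
    refine Finset.sum_le_sum fun j _ => ?_
    rw [← Finset.sum_filter, Finset.sum_const, smul_eq_mul]
    have : (S.filter fun s => grp κ j = grp κ s).card ≤ 1 := by
      refine Finset.card_le_one.2 fun s hs t ht => ?_
      simp only [Finset.mem_filter] at hs ht
      exact hinj s hs.1 t ht.1 (hs.2.symm.trans ht.2)
    nlinarith
  have h1 : ∑ s ∈ S, ownCount N κ s * oppCount N κ s ≤ joinSize N κ := by
    refine le_trans (Finset.sum_le_sum fun s _ => ?_) (hfib (oppCount N κ))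
    rw [ownCount, ← smul_eq_mul, ← Finset.sum_const]
    refine le_trans (Finset.sum_le_sum (g := oppCount N κ) fun j hj => ?_)
      (Finset.sum_le_sum_of_subset fun j hj => ?_)
    · exact (oppCount_congr (Finset.mem_filter.1 hj).2).ge
    · simp only [Finset.mem_filter] at hj ⊢
      exact ⟨hj.1, (label_eq_iff.1 hj.2).1⟩
  have h2 : ∑ s ∈ S, (ownCount N κ s + oppCount N κ s) ≤ N := by
    have := hfib fun _ => 1
    simp only [Finset.sum_const, smul_eq_mul, mul_one, card_grp_eq, Finset.card_range] at this
    exact this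
  have h3 : S.card ≤ v := by
    rw [← Finset.card_range v]
    refine Finset.card_le_card_of_injOn (fun s => s / M) ?_ ?_
    · intro s hs
      simp only [Finset.coe_range, Set.mem_Iio]
      exact Nat.div_lt_of_lt_mul (hN ▸ (hmem s hs).1)
    · intro s hs t ht hst
      simp only at hst
      wlog hlt : s < t generalizing s t
      · rcases lt_trichotomy s t with h | h | h
        exacts [absurd h hlt, h, (this ht hs hst.symm h).symm]
      exfalso
      obtain ⟨hsN, hh, hs0⟩ := hmem s hs
      obtain ⟨htN, -, ht0⟩ := hmem t ht
      refine hh ?_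
      rw [← hs0]
      have h4 := hκ.lt_grpEnd hsN
      rw [← hs0] at h4
      have h5 : s + ownCount N κ s + oppCount N κ s ≤ t := by
        have h6 : ¬ t < grpPos N κ s + ownCount N κ s + oppCount N κ s := by
          rw [hκ.lt_grpEnd_iff htN, not_le]
          have h7 := (hκ.lt_grpPos_iff (i := t) hsN)
          rw [← ht0] at h7
          exact h7.1 hlt
        rw [← hs0] at h6
        omega
      refine le_antisymm (Nat.div_le_div_right (by omega)) ?_
      rw [hst]
      exact Nat.div_le_div_right (by omega)
  have h4 : ∑ i ∈ Finset.range N, gridSize N M L κ i =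
      ∑ s ∈ S, ceilQuot L (ownCount N κ s) * ceilQuot L (oppCount N κ s) := by
    rw [hS, Finset.sum_filter]
    rfl
  rw [h4]
  refine Nat.le_of_mul_le_mul_right ?_ (Nat.mul_pos hL hL)
  calc (∑ s ∈ S, ceilQuot L (ownCount N κ s) * ceilQuot L (oppCount N κ s)) * (L * L)
      ≤ ∑ s ∈ S, (ownCount N κ s * oppCount N κ s + L * (ownCount N κ s + oppCount N κ s)
          + L * L) := by
        rw [Finset.sum_mul]
        refine Finset.sum_le_sum fun s _ => ?_
        calc _ = (ceilQuot L (ownCount N κ s) * L) * (ceilQuot L (oppCount N κ s) * L) := by ring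
          _ ≤ (ownCount N κ s + L) * (oppCount N κ s + L) :=
              Nat.mul_le_mul ceilQuot_mul_le ceilQuot_mul_le
          _ = _ := by ring
    _ = ∑ s ∈ S, ownCount N κ s * oppCount N κ s +
          L * ∑ s ∈ S, (ownCount N κ s + oppCount N κ s) + S.card * (L * L) := by
        simp only [Finset.sum_add_distrib, Finset.sum_const, smul_eq_mul, Finset.mul_sum, mul_add]
    _ ≤ L * L * v + L * (L * v) + v * (L * L) := by
        have : N ≤ L * v := hN ▸ Nat.mul_le_mul_right v hML
        exact Nat.add_le_add (Nat.add_le_add (h1.trans hQ) (Nat.mul_le_mul_left L (h2.trans this)))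
          (Nat.mul_le_mul_right _ h3)
    _ = 3 * v * (L * L) := by ring

/-- Only the first position of a group carries a grid size, so the sum behind any of its positions
comes from later groups alone. -/
theorem SortedOn.gridBase_congr (hκ : SortedOn N κ) {i j : ℕ} (hi : i < N) (hj : j < N)
    (h : grp κ i = grp κ j) : gridBase N M L κ i = gridBase N M L κ j := by
  wlog hij : i ≤ j generalizing i j
  · exact (this hj hi h.symm (by omega)).symm
  rw [gridBase, gridBase, ← Finset.sum_Ico_consecutive _ (Nat.succ_le_succ hij) (by omega),
    Finset.sum_eq_zero, zero_add]
  intro k hk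
  rw [Finset.mem_Ico] at hk
  have hg : grp κ k = grp κ i := le_antisymm
    (h ▸ grp_le_of_le (hκ k j (by omega) hj)) (grp_le_of_le (hκ i k (by omega) (by omega)))
  rw [gridSize, if_neg]
  rintro ⟨-, h1⟩
  have := hκ.grpPos_le hi
  rw [grpPos_congr hg] at h1
  omega

/-- The cells of a group lie in an interval of length `gridSize` from `gridBase` on. The last
inequality keeps these intervals disjoint: it bounds the end of the interval by the base of any
earlier group. -/
theorem SortedOn.cell_lt (hκ : SortedOn N κ) (hL : 0 < L) {i u : ℕ} (hi : i < N)
    (hu : u < copies N M L κ i) :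
    (i - lowPos N κ i) / L < ceilQuot L (ownCount N κ i) ∧
    u < ceilQuot L (oppCount N κ i) ∧
    cell₀ N M L κ i + u * cellStep N L κ i < gridBase N M L κ i + gridSize N M L κ (grpPos N κ i) ∧
    gridBase N M L κ i + gridSize N M L κ (grpPos N κ i) ≤
      ∑ j ∈ Finset.Ico (grpPos N κ i) N, gridSize N M L κ j := by
  have hh : IsHeavy N M κ i := by
    by_contra hc
    rw [copies, if_neg hc] at hu
    omega
  have hu' : u < ceilQuot L (oppCount N κ i) := by rwa [copies, if_pos hh] at hu
  have hlo := hκ.lowPos_le hi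
  have hhi := hκ.lt_high hi
  have hrow : (i - lowPos N κ i) / L < ceilQuot L (ownCount N κ i) := lt_ceilQuot hL (by omega)
  have hs : grpPos N κ i < N := (hκ.grpPos_le hi).trans_lt hi
  have hgs : grp κ (grpPos N κ i) = grp κ i := by
    refine le_antisymm (grp_le_of_le (hκ _ _ (hκ.grpPos_le hi) hi)) ?_
    by_contra hc
    exact lt_irrefl _ ((hκ.lt_grpPos_iff hs).2 (not_le.1 hc))
  have hsize : gridSize N M L κ (grpPos N κ i) =
      ceilQuot L (ownCount N κ i) * ceilQuot L (oppCount N κ i) := by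
    rw [gridSize, if_pos ⟨(isHeavy_congr hgs).2 hh, (grpPos_congr hgs).symm⟩]
    -- The group may start on the other side than that of `i`; this only exchanges the two factors.
    by_cases hk : κ (grpPos N κ i) = κ i
    · rw [ownCount_congr hk, oppCount_congr hk]
    · rw [oppCount_eq_ownCount hgs hk, oppCount_eq_ownCount hgs.symm (Ne.symm hk), mul_comm]
  refine ⟨hrow, hu', ?_, ?_⟩
  · rw [hsize, cell₀, cellStep, add_assoc]
    refine Nat.add_lt_add_left ?_ _
    split_ifs <;> nlinarith
  · rw [hκ.gridBase_congr hi hs hgs.symm, gridBase, add_comm,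
      ← Finset.sum_eq_sum_Ico_succ_bot hs]

/-- A cell determines the group, by disjointness of the grids, and the row and column, by division
with remainder. On a given side one coordinate is the quotient of the entry's offset by `L` and the
other is the index of the copy, so the remainder modulo `L` identifies the entry. Hence at most `L`
copies per side reach a cell. -/
theorem SortedOn.cell_inj (hκ : SortedOn N κ) (hL : 0 < L) {i u i' u' : ℕ} (hi : i < N)
    (hu : u < copies N M L κ i) (hi' : i' < N) (hu' : u' < copies N M L κ i')
    (hc : cell₀ N M L κ i + u * cellStep N L κ i = cell₀ N M L κ i' + u' * cellStep N L κ i')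
    (hs : side κ i = side κ i')
    (hmod : (i - lowPos N κ i) % L = (i' - lowPos N κ i') % L) : i = i' ∧ u = u' := by
  have hdisj : ∀ {i u i' u' : ℕ}, i < N → u < copies N M L κ i → i' < N →
      u' < copies N M L κ i' →
      cell₀ N M L κ i + u * cellStep N L κ i = cell₀ N M L κ i' + u' * cellStep N L κ i' →
      ¬ grp κ i < grp κ i' := by
    intro i u i' u' hi hu hi' hu' hc hlt
    obtain ⟨-, -, h1, h2⟩ := hκ.cell_lt hL hi' hu'
    have h3 : i < grpPos N κ i' := (hκ.lt_grpPos_iff hi).2 hlt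
    have h4 : ∑ j ∈ Finset.Ico (grpPos N κ i') N, gridSize N M L κ j ≤ gridBase N M L κ i :=
      Finset.sum_le_sum_of_subset (Finset.Ico_subset_Ico_left h3)
    have h5 : gridBase N M L κ i ≤ cell₀ N M L κ i := Nat.le_add_right _ _
    have : 0 ≤ u * cellStep N L κ i := Nat.zero_le _
    omega
  have hg : grp κ i = grp κ i' := le_antisymm (not_lt.1 (hdisj hi' hu' hi hu hc.symm))
    (not_lt.1 (hdisj hi hu hi' hu' hc))
  have hk : κ i = κ i' := label_eq_iff.2 ⟨hg, hs⟩
  obtain ⟨h1, h2, -, -⟩ := hκ.cell_lt hL hi hu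
  obtain ⟨h1', h2', -, -⟩ := hκ.cell_lt hL hi' hu'
  rw [cell₀, cell₀, cellStep, cellStep, hκ.gridBase_congr hi hi' hg, ← hs, oppCount_congr hk,
    ownCount_congr hk, add_assoc, add_assoc] at hc
  rw [ownCount_congr hk] at h1
  rw [oppCount_congr hk] at h2
  have hc' := Nat.add_left_cancel hc
  have hmain : (i - lowPos N κ i) / L = (i' - lowPos N κ i') / L ∧ u = u' := by
    have aux : ∀ {C x y x' y' : ℕ}, y < C → y' < C → x * C + y = x' * C + y' → x = x' ∧ y = y' := by
      intro C x y x' y' h h' he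
      have h3 := congrArg (· / C) he
      simp only [div_block h, div_block h'] at h3
      subst h3
      exact ⟨rfl, by omega⟩
    split_ifs at hc' with hside
    · simp only [mul_one] at hc'
      obtain ⟨h3, h4⟩ := aux h1 h1' ((add_comm _ _).trans (hc'.trans (add_comm _ _)))
      exact ⟨h4, h3⟩
    · simp only [mul_one] at hc'
      exact aux h2 h2' hc'
  have h3 := Nat.div_add_mod (i - lowPos N κ i) L
  have h4 := Nat.div_add_mod (i' - lowPos N κ i') L
  rw [hmain.1, hmod, h4] at h3
  have h5 := hκ.lowPos_le hi
  have h6 := hκ.lowPos_le hi'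
  rw [lowPos_congr hk] at h3 h5
  exact ⟨by omega, hmain.2⟩

/-- Two entries of the same group on different sides have copies in a common cell, or are in the
same block. -/
theorem SortedOn.exists_common_cell (hκ : SortedOn N κ) (hL : 0 < L) {i j : ℕ}
    (hi : i < N) (hj : j < N) (hg : grp κ i = grp κ j) (hsi : side κ i = false)
    (hsj : side κ j = true) :
    i / M = j / M ∨ ∃ u < copies N M L κ i, ∃ u' < copies N M L κ j,
      cell₀ N M L κ i + u * cellStep N L κ i = cell₀ N M L κ j + u' * cellStep N L κ j := by
  have hne : κ i ≠ κ j := fun h => by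
    have := (label_eq_iff.1 h).2
    simp [hsi, hsj] at this
  have h1 := hκ.lowPos_le hi
  have h2 := hκ.lt_high hi
  have h3 := hκ.lowPos_le hj
  have h4 := hκ.lt_high hj
  have h5 := hκ.grpPos_le hi
  have h6 := hκ.lt_grpEnd hi
  have h7 := hκ.grpPos_le hj
  have h8 := hκ.lt_grpEnd hj
  have ho : oppCount N κ i = ownCount N κ j := oppCount_eq_ownCount hg hne
  have ho' : oppCount N κ j = ownCount N κ i := oppCount_eq_ownCount hg.symm hne.symm
  by_cases hh : IsHeavy N M κ i
  · right
    refine ⟨(j - lowPos N κ j) / L, ?_, (i - lowPos N κ i) / L, ?_, ?_⟩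
    · rw [copies, if_pos hh, ho]
      exact lt_ceilQuot hL (by omega)
    · rw [copies, if_pos ((isHeavy_congr hg).1 hh), ho']
      exact lt_ceilQuot hL (by omega)
    · rw [cell₀, cell₀, cellStep, cellStep, hκ.gridBase_congr hi hj hg]
      simp only [hsi, hsj, Bool.false_eq_true, if_false, if_true, ho]
      ring
  · left
    rw [IsHeavy, not_not] at hh
    have h9 : ∀ k, grpPos N κ i ≤ k → k < grpPos N κ i + ownCount N κ i + oppCount N κ i →
        k / M = grpPos N κ i / M := fun k hk hk' =>
      le_antisymm (hh ▸ Nat.div_le_div_right (by omega)) (Nat.div_le_div_right hk)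
    have h10 := total_congr (N := N) hg
    rw [grpPos_congr hg] at h9 h5 h6
    rw [h9 i (by omega) (by omega), h9 j (by omega) (by omega)]

end Plan

/-! ### Multicast -/

section Multicast

variable {p w m : ℕ} {A X : Type*} {inp : X → Fin p → Set A} {Λ : X → ℕ}
  {l : List (Round X A p w m)} {h : ℕ → Fin p} {φ g J M : ℕ} [NeZero m]

/-- Encoding of an optional message; only messages with non-zero `val 1` are to be encoded. -/
def firstMsg : First (Msg A w m) → Msg A w m
  | ⟨none⟩ => mkMsg none fun _ => 0
  | ⟨some μ⟩ => μ

theorem firstMsg_add_atom (a b : First (Msg A w m)) (y : A)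
    (hy : (firstMsg (a + b)).atom = some y) :
    (firstMsg a).atom = some y ∨ (firstMsg b).atom = some y := by
  rcases a with ⟨_ | μ⟩
  · exact Or.inr hy
  · exact Or.inl hy

/-- The item `i` of an array is to be copied to the hosts of the cells `c₀ i + u * st i`,
`u < cnt i`. The copies have disjoint intervals `[pos i, pos i + cnt i)` of indices. -/
theorem multicast {N : ℕ} (hf : Feasible inp l) (hg : 1 ≤ g) (hN : N = M * g ^ J)
    (hφ : HostLE h (g ^ J) φ) (L : X → ℕ)
    (hgL : ∀ x, g ≤ L x) (hML : ∀ x, M ≤ L x) (hΛ : ∀ x, 6 * L x * φ ≤ Λ x) (hw : 4 ≤ w)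
    (at' : X → ℕ → Option A) (pos cnt c₀ st tag : X → ℕ → ℕ)
    (hm : ∀ x, ∀ i < N, pos x i < m ∧ cnt x i < m ∧ c₀ x i < m ∧ st x i < m)
    (hkL : ∀ b < g ^ J, Knows inp l (h b) L)
    (hk : ∀ i < N, Knows inp l (h (i / M)) fun x =>
      (at' x i, pos x i, cnt x i, c₀ x i, st x i))
    (hat : ∀ i < N, ∀ x y, at' x i = some y → y ∈ heldAfter inp l x (h (i / M)))
    (hdis : ∀ x, ∀ i < N, ∀ i' < N, ∀ c, pos x i ≤ c → c < pos x i + cnt x i →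
      pos x i' ≤ c → c < pos x i' + cnt x i' → i = i')
    (hpos : ∀ x, ∀ i < N, 0 < cnt x i → pos x i + cnt x i ≤ 2 * L x * g ^ J)
    (hcell : ∀ x, ∀ i < N, ∀ u < cnt x i, c₀ x i + u * st x i < 3 * g ^ J)
    (htag : ∀ x, ∀ i < N, 0 < cnt x i → tag x i < 2 * L x)
    (hinj : ∀ x, ∀ i < N, ∀ i' < N, ∀ u < cnt x i, ∀ u' < cnt x i',
      c₀ x i + u * st x i = c₀ x i' + u' * st x i' → tag x i = tag x i' → i = i' ∧ u = u') :
    ∃ l', Extends inp Λ (J + 3) l l' ∧ ∀ x, ∀ i < N, ∀ u < cnt x i, ∀ y, at' x i = some y →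
      y ∈ heldAfter inp l' x (h ((c₀ x i + u * st x i) / 3)) := by
  classical
  have hL0 : ∀ x, 0 < 2 * L x := fun x => by have := hgL x; omega
  let item : X → ℕ → Msg A w m := fun x i => mkMsg (at' x i) fun j =>
    if j = 0 then pos x i else if j = 1 then cnt x i else if j = 2 then c₀ x i else st x i
  have hv : ∀ x, ∀ i < N, (item x i).val 0 = pos x i ∧ (item x i).val 1 = cnt x i ∧
      (item x i).val 2 = c₀ x i ∧ (item x i).val 3 = st x i := by
    intro x i hi
    obtain ⟨h0, h1, h2, h3⟩ := hm x i hi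
    refine ⟨mkMsg_val (by omega) h0, mkMsg_val (by omega) h1, mkMsg_val (by omega) h2,
      mkMsg_val (by omega) h3⟩
  have hatom : ∀ x i, (item x i).atom = at' x i := fun _ _ => rfl
  let pk : X → Finset ℕ := fun x => (Finset.range N).filter fun i => 0 < cnt x i
  have hpk : ∀ x i, i ∈ pk x ↔ i < N ∧ 0 < cnt x i := by simp [pk]
  have hb : ∀ i < N, i / M < g ^ J := fun i hi => Nat.div_lt_of_lt_mul (hN ▸ hi)
  have hkitem : ∀ i < N, ∀ x x', viewAfter inp l x (h (i / M)) = viewAfter inp l x' (h (i / M)) →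
      item x i = item x' i ∧ (i ∈ pk x ↔ i ∈ pk x') ∧ L x = L x' ∧ pos x i = pos x' i := by
    intro i hi x x' hx
    have h1 := hk i hi x x' hx
    simp only [Prod.mk.injEq] at h1
    obtain ⟨e1, e2, e3, e4, e5⟩ := h1
    refine ⟨?_, ?_, hkL _ (hb i hi) x x' hx, e2⟩
    · simp only [item, e1, e2, e3, e4, e5]
    · rw [hpk, hpk, e3]
  -- the items are sent to the hosts of their first copies
  let dst : X → ℕ → Fin p := fun x i => h (pos x i / (2 * L x))
  have hposlt : ∀ x, ∀ i ∈ pk x, pos x i < 2 * L x * g ^ J := fun x i hi => by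
    have := hpos x i ((hpk x i).1 hi).1 ((hpk x i).1 hi).2
    have := ((hpk x i).1 hi).2
    omega
  have e₁ := packet_step (Λ := Λ) hf pk (fun _ i => h (i / M)) dst item
    (fun q x x' hx i hi hq => by
      have hiN := ((hpk x i).1 hi).1
      obtain ⟨a1, a2, a3, a4⟩ := hkitem i hiN x x' (hq ▸ hx)
      exact ⟨a2.1 hi, hq, by simp only [dst, a3, a4], a1⟩)
    (fun x i hi y hy => hat i ((hpk x i).1 hi).1 x y hy)
    (fun x q => by
      refine le_trans (Finset.card_le_card ?_) ((hφ.div M q).trans (le_trans ?_ (hΛ x)))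
      · intro i hi
        simp only [Finset.mem_filter, hpk, Finset.mem_range] at hi ⊢
        exact ⟨hN ▸ hi.1.1, hi.2⟩
      · exact Nat.mul_le_mul_right φ (by have := hML x; omega))
    (fun x q => by
      refine le_trans (Finset.card_le_card_of_injOn (pos x) ?_ ?_) ((hφ.div (2 * L x) q).trans
        (le_trans (Nat.mul_le_mul_right φ (by omega)) (hΛ x)))
      · intro i hi
        simp only [Finset.coe_filter, Set.mem_ofPred_eq, Finset.mem_range] at hi ⊢
        exact ⟨hposlt x i hi.1, hi.2⟩
      · intro i hi i' hi' hii
        simp only [Finset.coe_filter, Set.mem_ofPred_eq, hpk] at hi hi'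
        exact hdis x i hi.1.1 i' hi'.1.1 (pos x i) le_rfl (by omega) hii.ge (by omega))
  set l₁ := packetRound pk (fun _ i => h (i / M)) dst item :: l with hl₁
  let R : X → Fin p → Set (Msg A w m) := fun x q => {μ | ∃ i ∈ pk x, dst x i = q ∧ item x i = μ}
  have hR : ∀ q, Knows inp l₁ q fun x => R x q := fun q => packet_knows_set q
  have hRheld : ∀ x q μ, μ ∈ R x q → ∀ y, μ.atom = some y → y ∈ heldAfter inp l₁ x q := by
    rintro x q μ ⟨i, hi, rfl, rfl⟩ y hy
    exact packet_held hi hy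
  -- items that extend beyond their virtual processor
  let Cr : X → ℕ → Msg A w m → Prop := fun x γ μ => μ ∈ R x (h γ) ∧ μ.val 0 / (2 * L x) = γ ∧
    2 * L x * (γ + 1) ≤ μ.val 0 + μ.val 1
  let Cr' : ℕ → Set (Msg A w m) → ℕ → First (Msg A w m) := fun L' R' γ =>
    if H : ∃ μ, μ ∈ R' ∧ μ.val 0 / (2 * L') = γ ∧ 2 * L' * (γ + 1) ≤ μ.val 0 + μ.val 1
      then ⟨some H.choose⟩ else 0
  -- The order is reversed because a virtual processor needs the nearest item that crosses a border
  -- before it. Intervals are disjoint, so at most one item crosses the end of each virtual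
  -- processor and the choice in `Cr'` is forced.
  let G : X → ℕ → First (Msg A w m) := fun x b =>
    if b < g ^ J then Cr' (L x) (R x (h (g ^ J - 1 - b))) (g ^ J - 1 - b) else 0
  have hGsome : ∀ x b μ, (G x b).val = some μ → b < g ^ J ∧ Cr x (g ^ J - 1 - b) μ := by
    intro x b μ hμ
    simp only [G, Cr'] at hμ
    split_ifs at hμ with hb H
    · have := H.choose_spec
      rw [Option.some.inj hμ] at this
      exact ⟨hb, this⟩
  have hGnone : ∀ x b, b < g ^ J → (G x b).val = none → ∀ μ, ¬ Cr x (g ^ J - 1 - b) μ := by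
    intro x b hb hn μ hμ
    simp only [G, Cr', if_pos hb] at hn
    rw [dif_pos ⟨μ, hμ⟩] at hn
    simp at hn
  have hitems : ∀ x i k μ, (winSum (G x) i k).val = some μ → ∃ j ∈ pk x, item x j = μ := by
    intro x i k μ hμ
    obtain ⟨j, -, -, hj, -⟩ := winSum_first_some.1 hμ
    obtain ⟨-, ⟨i', hi', -, hi''⟩, -⟩ := hGsome x j μ hj
    exact ⟨i', hi', hi''⟩
  have hinjG : ∀ x x' i k, firstMsg (winSum (G x) i k) = firstMsg (winSum (G x') i k) →
      winSum (G x) i k = winSum (G x') i k := by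
    intro x x' i k hx
    -- The blank message cannot be confused with an item, whose count in word `1` is positive.
    have hne : ∀ x j, j ∈ pk x → item x j ≠ mkMsg none fun _ => 0 := by
      intro x j hj he
      have h1 := (hv x j ((hpk x j).1 hj).1).2.1
      rw [he, mkMsg_val (by omega) (Nat.pos_of_ne_zero (NeZero.ne m))] at h1
      exact absurd h1.symm ((hpk x j).1 hj).2.ne'
    rcases h1 : winSum (G x) i k with ⟨_ | μ⟩ <;> rcases h2 : winSum (G x') i k with ⟨_ | μ'⟩
    · rfl
    · obtain ⟨j, hj, rfl⟩ := hitems x' i k μ' (congrArg First.val h2)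
      rw [h1, h2] at hx
      exact absurd hx.symm (hne x' j hj)
    · obtain ⟨j, hj, rfl⟩ := hitems x i k μ (congrArg First.val h1)
      rw [h1, h2] at hx
      exact absurd hx (hne x j hj)
    · rw [h1, h2] at hx
      exact congrArg (fun μ => (⟨some μ⟩ : First (Msg A w m))) hx
  have hkL₁ : ∀ b < g ^ J, Knows inp l₁ (h b) L := fun b hb => (hkL b hb).extend e₁
  obtain ⟨l₂, e₂, H₂⟩ := scan (Λ := Λ) e₁.feasible hg hφ.rev
    (fun x => by
      refine le_trans ?_ (hΛ x)
      rw [mul_comm]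
      exact Nat.mul_le_mul_right φ (by have := hgL x; omega))
    G (fun x b hb => if_neg (not_lt.2 hb)) firstMsg hinjG rfl firstMsg_add_atom
    (fun b hb x x' hx => by
      have h1 := hR _ x x' hx
      have h2 := hkL₁ (g ^ J - 1 - b) (by omega) x x' hx
      simp only [G, if_pos hb, h1, h2])
    (fun b hb x y hy => by
      rcases h1 : G x b with ⟨_ | μ⟩
      · rw [h1] at hy
        simp [firstMsg, mkMsg] at hy
      · rw [h1] at hy
        exact hRheld x _ μ (hGsome x b μ (congrArg First.val h1)).2.1 y hy)
  have hsub : ∀ b < g ^ J, g ^ J - 1 - (g ^ J - 1 - b) = b := fun b hb => by omega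
  let S : X → ℕ → First (Msg A w m) := fun x γ => winSum (G x) (g ^ J - 1 - γ + 1) (g ^ J)
  have hS : ∀ γ < g ^ J, (Knows inp l₂ (h γ) fun x => S x γ) ∧
      ∀ x y, (firstMsg (S x γ)).atom = some y → y ∈ heldAfter inp l₂ x (h γ) := by
    intro γ hγ
    have := H₂ (g ^ J - 1 - γ) (by omega)
    rwa [hsub γ hγ] at this
  -- the hosts of the copies know the items
  let Cand : X → ℕ → Msg A w m → Prop := fun x c μ =>
    (μ ∈ R x (h (c / (2 * L x))) ∨ (S x (c / (2 * L x))).val = some μ) ∧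
      μ.val 0 ≤ c ∧ c < μ.val 0 + μ.val 1
  have hCand : ∀ x c μ, Cand x c μ → ∃ i ∈ pk x, item x i = μ ∧ pos x i ≤ c ∧
      c < pos x i + cnt x i := by
    rintro x c μ ⟨h1, h2, h3⟩
    have : ∃ i ∈ pk x, item x i = μ := by
      rcases h1 with ⟨i, hi, -, h4⟩ | h1
      exacts [⟨i, hi, h4⟩, hitems x _ _ μ h1]
    obtain ⟨i, hi, rfl⟩ := this
    obtain ⟨v0, v1, -, -⟩ := hv x i ((hpk x i).1 hi).1
    exact ⟨i, hi, rfl, v0 ▸ h2, by omega⟩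
  -- An item that covers `c` either starts in the virtual processor of `c` or crosses the end of an
  -- earlier one. In the second case no other crossing item is nearer, since it would have to start
  -- inside the interval of the first.
  have hcov : ∀ x, ∀ i ∈ pk x, ∀ c, pos x i ≤ c → c < pos x i + cnt x i →
      Cand x c (item x i) := by
    intro x i hi c hc hc'
    have hiN := ((hpk x i).1 hi).1
    obtain ⟨v0, v1, -, -⟩ := hv x i hiN
    refine ⟨?_, by omega, by omega⟩
    have hle : pos x i / (2 * L x) ≤ c / (2 * L x) := Nat.div_le_div_right hc
    rcases hle.eq_or_lt with heq | hlt
    · exact Or.inl ⟨i, hi, by simp only [dst, heq], rfl⟩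
    right
    have hcJ : c / (2 * L x) < g ^ J := Nat.div_lt_of_lt_mul
      (hc'.trans_le (hpos x i hiN ((hpk x i).1 hi).2))
    set γ := c / (2 * L x) with hγ
    set γ₀ := pos x i / (2 * L x) with hγ₀
    have hmul : ∀ {a b : ℕ}, a < b → 2 * L x * (a + 1) ≤ 2 * L x * b := fun hab =>
      Nat.mul_le_mul_left _ hab
    have hγc : 2 * L x * γ ≤ c := Nat.mul_div_le c (2 * L x)
    have hγ₀c : 2 * L x * γ₀ ≤ pos x i := Nat.mul_div_le _ _
    have hγ₀c' : pos x i < 2 * L x * (γ₀ + 1) := by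
      rw [mul_add, mul_one, mul_comm]
      exact Nat.lt_div_mul_add (hL0 x)
    have h1 := hmul hlt
    have hcr : Cr x γ₀ (item x i) := ⟨⟨i, hi, rfl, rfl⟩, by rw [v0], by omega⟩
    rw [winSum_first_some]
    clear_value γ γ₀
    refine ⟨g ^ J - 1 - γ₀, by omega, by omega, ?_, fun j hj hj' => ?_⟩
    · rcases h2 : (G x (g ^ J - 1 - γ₀)).val with _ | μ
      · have := hGnone x _ (by omega) h2 (item x i)
        rw [hsub _ (by omega)] at this
        exact absurd hcr this
      · have h3 := (hGsome x _ μ h2).2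
        rw [hsub _ (by omega)] at h3
        obtain ⟨⟨i', hi', -, rfl⟩, h4, h5⟩ := h3
        obtain ⟨v0', v1', -, -⟩ := hv x i' ((hpk x i').1 hi').1
        rw [v0'] at h4 h5
        rw [v1'] at h5
        have h6 : pos x i' < 2 * L x * (γ₀ + 1) := by
          rw [← h4, mul_add, mul_one, mul_comm]
          exact Nat.lt_div_mul_add (hL0 x)
        rw [hdis x i hiN i' ((hpk x i').1 hi').1 (2 * L x * (γ₀ + 1) - 1) (by omega) (by omega)
          (by omega) (by omega)]
    · rcases h2 : (G x j).val with _ | μ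
      · rfl
      · exfalso
        obtain ⟨h3, ⟨i', hi', -, rfl⟩, h4, -⟩ := hGsome x j μ h2
        obtain ⟨v0', v1', -, -⟩ := hv x i' ((hpk x i').1 hi').1
        rw [v0'] at h4
        set γ₁ := g ^ J - 1 - j
        have h5 := hmul (show γ₀ < γ₁ by omega)
        have h6 := hmul (show γ₁ < γ by omega)
        have h7 : 2 * L x * γ₁ ≤ pos x i' := h4 ▸ Nat.mul_div_le _ _
        have h8 : pos x i' < 2 * L x * (γ₁ + 1) := by
          rw [← h4, mul_add, mul_one, mul_comm]
          exact Nat.lt_div_mul_add (hL0 x)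
        have h9 := hdis x i hiN i' ((hpk x i').1 hi').1 (pos x i') (by omega) (by omega) le_rfl
          (by have := ((hpk x i').1 hi').2; omega)
        subst h9
        omega
  let cov : X → ℕ → Msg A w m := fun x c =>
    if H : ∃ μ, Cand x c μ then H.choose else mkMsg none fun _ => 0
  let pk₂ : X → Finset ℕ := fun x => (Finset.range (2 * L x * g ^ J)).filter fun c =>
    ∃ μ, Cand x c μ
  have hpk₂ : ∀ x c, c ∈ pk₂ x ↔ c < 2 * L x * g ^ J ∧ ∃ μ, Cand x c μ := by simp [pk₂]
  have hcovs : ∀ x c, c ∈ pk₂ x → Cand x c (cov x c) := by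
    intro x c hc
    have := ((hpk₂ x c).1 hc).2
    simp only [cov, dif_pos this]
    exact this.choose_spec
  have hkcov : ∀ q x x', viewAfter inp l₂ x q = viewAfter inp l₂ x' q → ∀ c ∈ pk₂ x,
      h (c / (2 * L x)) = q → c ∈ pk₂ x' ∧ L x = L x' ∧ cov x c = cov x' c := by
    intro q x x' hx c hc hq
    have hγ : c / (2 * L x) < g ^ J := Nat.div_lt_of_lt_mul ((hpk₂ x c).1 hc).1
    have hL := (hkL₁ _ hγ).extend e₂ x x' (hq ▸ hx)
    have hRR : R x q = R x' q := (hR q).extend e₂ x x' hx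
    have hSS : S x (c / (2 * L x)) = S x' (c / (2 * L x)) := (hS _ hγ).1 x x' (hq ▸ hx)
    have hCC : Cand x c = Cand x' c := by
      funext μ
      simp only [Cand, ← hL, hq, hRR, hSS]
    refine ⟨?_, hL, ?_⟩
    · rw [hpk₂] at hc ⊢
      rwa [← hL, ← hCC]
    · simp only [cov, hCC]
  let cell : Msg A w m → ℕ → ℕ := fun μ c => μ.val 2 + (c - μ.val 0) * μ.val 3
  have hheld : ∀ x, ∀ c ∈ pk₂ x, ∀ y, (cov x c).atom = some y →
      y ∈ heldAfter inp l₂ x (h (c / (2 * L x))) := by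
    intro x c hc y hy
    rcases (hcovs x c hc).1 with h1 | h1
    · exact heldAfter_extend e₂ x _ (hRheld x _ _ h1 y hy)
    · have h2 : firstMsg (S x (c / (2 * L x))) = cov x c := by
        rw [show S x (c / (2 * L x)) = ⟨some (cov x c)⟩ from First.ext h1]
        rfl
      exact (hS _ (Nat.div_lt_of_lt_mul ((hpk₂ x c).1 hc).1)).2 x y (h2 ▸ hy)
  have e₃ := packet_step (Λ := Λ) e₂.feasible pk₂ (fun x c => h (c / (2 * L x)))
    (fun x c => h (cell (cov x c) c / 3)) (fun x c => mkMsg (cov x c).atom fun _ => 0)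
    (fun q x x' hx c hc hq => by
      obtain ⟨h1, h2, h3⟩ := hkcov q x x' hx c hc hq
      exact ⟨h1, h2 ▸ hq, by rw [h3], by rw [h3]⟩)
    (fun x c hc y hy => hheld x c hc y hy)
    (fun x q => by
      refine le_trans (Finset.card_le_card ?_) ((hφ.div (2 * L x) q).trans
        (le_trans (Nat.mul_le_mul_right φ (by omega)) (hΛ x)))
      intro c hc
      simp only [Finset.mem_filter, hpk₂, Finset.mem_range] at hc ⊢
      exact ⟨hc.1.1, hc.2⟩)
    (fun x q => by
      have hch : ∀ c, ∃ i, c ∈ pk₂ x → i ∈ pk x ∧ item x i = cov x c ∧ pos x i ≤ c ∧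
          c < pos x i + cnt x i := by
        intro c
        by_cases hc : c ∈ pk₂ x
        · obtain ⟨i, h1, h2⟩ := hCand x c _ (hcovs x c hc)
          exact ⟨i, fun _ => ⟨h1, h2⟩⟩
        · exact ⟨0, fun h => absurd h hc⟩
      choose I hI using hch
      have hcl : ∀ c ∈ pk₂ x, cell (cov x c) c =
          c₀ x (I c) + (c - pos x (I c)) * st x (I c) := by
        intro c hc
        obtain ⟨h1, h2, -⟩ := hI c hc
        obtain ⟨v0, -, v2, v3⟩ := hv x (I c) ((hpk x _).1 h1).1
        simp only [cell, ← h2, v0, v2, v3]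
      -- Cell and tag determine the copy. A virtual processor hosts three cells with `2 * L x` tags
      -- each, whence the factor `6` in the load.
      refine le_trans (Finset.card_le_card_of_injOn
        (t := ((Finset.range (3 * g ^ J)).filter fun e => h (e / 3) = q) ×ˢ
          Finset.range (2 * L x))
        (fun c => (cell (cov x c) c, tag x (I c))) ?_ ?_) ?_
      · intro c hc
        simp only [Finset.coe_filter, Set.mem_ofPred_eq] at hc
        obtain ⟨h1, -, h3, h4⟩ := hI c hc.1
        simp only [Finset.coe_product, Set.mem_prod, Finset.mem_coe, Finset.mem_filter,
          Finset.mem_range]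
        refine ⟨⟨?_, hc.2⟩, htag x _ ((hpk x _).1 h1).1 ((hpk x _).1 h1).2⟩
        rw [hcl c hc.1]
        exact hcell x _ ((hpk x _).1 h1).1 _ (by omega)
      · intro c hc c' hc' hcc
        simp only [Finset.coe_filter, Set.mem_ofPred_eq] at hc hc'
        simp only [Prod.mk.injEq, hcl c hc.1, hcl c' hc'.1] at hcc
        obtain ⟨h1, -, h3, h4⟩ := hI c hc.1
        obtain ⟨h1', -, h3', h4'⟩ := hI c' hc'.1
        obtain ⟨h5, h6⟩ := hinj x _ ((hpk x _).1 h1).1 _ ((hpk x _).1 h1').1 _ (by omega) _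
          (by omega) hcc.1 hcc.2
        rw [← h5] at h6 h3'
        omega
      · rw [Finset.card_product, Finset.card_range]
        refine le_trans (Nat.mul_le_mul_right _ (hφ.div 3 q)) (le_trans (le_of_eq ?_) (hΛ x))
        ring)
  refine ⟨_, ((e₁.trans e₂).trans e₃).mono (by omega), fun x i hi u hu y hy => ?_⟩
  have hip : i ∈ pk x := (hpk x i).2 ⟨hi, by omega⟩
  have hca := hcov x i hip (pos x i + u) (by omega) (by omega)
  have hc₂ : pos x i + u ∈ pk₂ x := by
    rw [hpk₂]
    exact ⟨by have := hpos x i hi (by omega); omega, _, hca⟩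
  obtain ⟨i', hi', h2, h3, h4⟩ := hCand x _ _ (hcovs x _ hc₂)
  have hii : i = i' := hdis x i hi i' ((hpk x i').1 hi').1 (pos x i + u) (by omega) (by omega) h3 h4
  subst hii
  have := packet_held (inp := inp) (l := l₂) (src := fun x c => h (c / (2 * L x)))
    (dst := fun x c => h (cell (cov x c) c / 3))
    (msg := fun x c => (mkMsg (cov x c).atom fun _ => 0 : Msg A w m)) (α := y) hc₂
    (by rw [← h2]; exact hy)
  obtain ⟨v0, -, v2, v3⟩ := hv x i hi
  simpa only [cell, ← h2, v0, v2, v3, Nat.add_sub_cancel_left] using this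

end Multicast

/-! ### Joins -/

section Join

variable {p w m : ℕ} {A X α G : Type*} {inp : X → Fin p → Set A} {Λ : X → ℕ}
  {l l' : List (Round X A p w m)} {h : ℕ → Fin p} {φ g J M : ℕ} {enc : α → Msg A w m}
  {a : X → ℕ → α} [LinearOrder G] {key : X → α → G ×ₗ Bool}

theorem joinSize_comp {N : ℕ} (κ : ℕ → G ×ₗ Bool) (σ : Equiv.Perm ℕ)
    (hσ : ∀ i, σ i < N ↔ i < N) : joinSize N (fun i => κ (σ i)) = joinSize N κ := by
  have hmap : ∀ f : ℕ → ℕ, ∑ i ∈ Finset.range N, f (σ i) = ∑ i ∈ Finset.range N, f i := fun f =>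
    Finset.sum_equiv σ (by simp [hσ]) fun _ _ => rfl
  refine Eq.trans (Finset.sum_congr rfl fun i _ => ?_) (hmap (oppCount N κ))
  unfold oppCount
  refine Finset.card_equiv σ fun j => ?_
  rw [Finset.mem_filter, Finset.mem_filter, Finset.mem_range, Finset.mem_range, hσ]
  rfl

theorem oppCount_le (N : ℕ) (κ : ℕ → G ×ₗ Bool) (i : ℕ) : oppCount N κ i ≤ N := by
  simpa [oppCount] using Finset.card_filter_le (Finset.range N) fun j => grp κ j = grp κ i ∧ κ j ≠ κ i

theorem ownCount_le (N : ℕ) (κ : ℕ → G ×ₗ Bool) (i : ℕ) : ownCount N κ i ≤ N := by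
  simpa [ownCount] using Finset.card_filter_le (Finset.range N) fun j => κ j = κ i

theorem joinSize_le (N : ℕ) (κ : ℕ → G ×ₗ Bool) : joinSize N κ ≤ N * N := by
  refine (Finset.sum_le_sum fun i _ => oppCount_le N κ i).trans ?_
  simp

theorem ceilQuot_le {L x : ℕ} (hL : 0 < L) : ceilQuot L x ≤ x := by
  rw [ceilQuot]
  rcases Nat.eq_zero_or_pos x with rfl | hx
  · rw [Nat.div_eq_of_lt] <;> omega
  · rw [Nat.div_le_iff_le_mul_add_pred hL]
    have : x + L ≤ L * x + 1 := by nlinarith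
    omega

/-- The side length of the grid cells. -/
def cellSize (M v Q : ℕ) : ℕ := M + Nat.sqrt (Q / v) + 1

theorem le_cellSize_sq {M v Q : ℕ} (hv : 0 < v) : Q ≤ cellSize M v Q * cellSize M v Q * v := by
  have h1 := Nat.lt_succ_sqrt (Q / v)
  have h2 : (Nat.sqrt (Q / v) + 1) * (Nat.sqrt (Q / v) + 1) ≤
      cellSize M v Q * cellSize M v Q := by
    apply Nat.mul_le_mul <;> (rw [cellSize]; omega)
  have h3 := Nat.lt_div_mul_add hv (a := Q)
  have h4 : Q / v + 1 ≤ cellSize M v Q * cellSize M v Q := by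
    have : Q / v < (Nat.sqrt (Q / v) + 1) * (Nat.sqrt (Q / v) + 1) := h1
    omega
  calc Q ≤ (Q / v + 1) * v := by rw [Nat.succ_mul]; omega
    _ ≤ _ := Nat.mul_le_mul_right v h4

/-- The number of rounds of a join. -/
def joinRounds (J : ℕ) : ℕ := sortRounds J + 2 + 10 * (J + 1) + (J + 3)

/-- A distributed equi-join: any two entries of the array that have the same group and different
sides meet at some processor. -/
theorem HasArray.join [NeZero m] {E : ℕ} (H : HasArray inp l h M (g ^ J) enc a) (hg : 0 < g)
    (hM : 0 < M) (hME : M = E * g) (hMg : 2 * (g * g) ≤ M) (hφ : HostLE h (g ^ J) φ)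
    (henc : Function.Injective enc) (hw : 4 ≤ w) (hm : 8 * (M * g ^ J) ^ 2 + 8 < m)
    (hf : Feasible inp l) (hkey : ∀ q, Knows inp l q key)
    (hΛ : ∀ x, 6 * cellSize M (g ^ J) (joinSize (M * g ^ J) fun i => key x (a x i)) * φ ≤ Λ x) :
    ∃ l', Extends inp Λ (joinRounds J) l l' ∧ ∀ x, ∀ i < M * g ^ J, ∀ j < M * g ^ J,
      grp (fun i => key x (a x i)) i = grp (fun i => key x (a x i)) j →
      side (fun i => key x (a x i)) i = false → side (fun i => key x (a x i)) j = true →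
      ∃ q, (∀ y, (enc (a x i)).atom = some y → y ∈ heldAfter inp l' x q) ∧
        ∀ y, (enc (a x j)).atom = some y → y ∈ heldAfter inp l' x q := by
  classical
  set N := M * g ^ J with hN
  have hv0 : 0 < g ^ J := Nat.pow_pos hg
  have hMN : M ≤ N := Nat.le_mul_of_pos_right M hv0
  have hvN : g ^ J ≤ N := Nat.le_mul_of_pos_left _ hM
  have hNN : N ≤ N * N := Nat.le_mul_of_pos_left N (by omega)
  have hm' : 8 * (N * N) + 8 < m := by rwa [← sq]
  have hMφ : ∀ x, M * φ ≤ Λ x := fun x => le_trans (Nat.mul_le_mul_right φ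
    (by simp only [cellSize]; omega)) (hΛ x)
  have hgM : g ≤ M := by nlinarith
  have hφg : ∀ x, φ * g ≤ Λ x := fun x => by
    rw [mul_comm]
    exact (Nat.mul_le_mul_right φ hgM).trans (hMφ x)
  obtain ⟨l₁, b, e₁, H₁, hb⟩ := H.sort hg hM hME hMg hφ hMφ henc hf hkey
  let κ : X → ℕ → G ×ₗ Bool := fun x i => key x (b x i)
  have hκ : ∀ x, SortedOn N (κ x) := fun x i j hij hj => (hb x).2 i j hij hj
  have hkey₁ : ∀ q, Knows inp l₁ q key := fun q => (hkey q).extend e₁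
  -- neighbouring entries
  obtain ⟨l₂, e₂, H₂⟩ := route (Λ := Λ) e₁.feasible ((Finset.range N).filter fun i => i + 1 < N)
    (fun i => h ((i + 1) / M)) (fun i => h (i / M)) (fun x i => enc (b x (i + 1)))
    (fun i hi => (H₁.knows _ (Finset.mem_filter.1 hi).2).comp enc)
    (fun x i hi y hy => H₁.held _ (Finset.mem_filter.1 hi).2 x y hy)
    (fun x q => by
      refine le_trans (Finset.card_le_card_of_injOn (fun i => i + 1) ?_ (by simp))
        ((hφ.div M q).trans (hMφ x))
      intro i hi
      simp only [Finset.coe_filter, Finset.mem_filter, Finset.mem_range, Set.mem_ofPred_eq] at hi ⊢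
      exact ⟨hi.1.2, hi.2⟩)
    (fun x q => by
      refine le_trans (Finset.card_le_card ?_) ((hφ.div M q).trans (hMφ x))
      intro i hi
      simp only [Finset.mem_filter, Finset.mem_range] at hi ⊢
      exact ⟨hi.1.1, hi.2⟩)
  obtain ⟨l₃, e₃, H₃⟩ := route (Λ := Λ) e₂.feasible ((Finset.range N).filter fun i => 0 < i)
    (fun i => h ((i - 1) / M)) (fun i => h (i / M)) (fun x i => enc (b x (i - 1)))
    (fun i hi => by
      simp only [Finset.mem_filter, Finset.mem_range] at hi
      exact ((H₁.knows (i - 1) (by omega)).extend e₂).comp enc)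
    (fun x i hi y hy => by
      simp only [Finset.mem_filter, Finset.mem_range] at hi
      exact heldAfter_extend e₂ x _ (H₁.held (i - 1) (by omega) x y hy))
    (fun x q => by
      refine le_trans (Finset.card_le_card_of_injOn (fun i => i - 1) ?_ ?_)
        ((hφ.div M q).trans (hMφ x))
      · intro i hi
        simp only [Finset.coe_filter, Finset.mem_filter, Finset.mem_range, Set.mem_ofPred_eq]
          at hi ⊢
        exact ⟨by omega, hi.2⟩
      · intro i hi j hj hij
        simp only [Finset.coe_filter, Finset.mem_filter, Finset.mem_range, Set.mem_ofPred_eq]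
          at hi hj hij
        omega)
    (fun x q => by
      refine le_trans (Finset.card_le_card ?_) ((hφ.div M q).trans (hMφ x))
      intro i hi
      simp only [Finset.mem_filter, Finset.mem_range] at hi ⊢
      exact ⟨hi.1.1, hi.2⟩)
  have e₁₃ := (e₁.trans e₂).trans e₃
  have hkb : ∀ i < N, Knows inp l₃ (h (i / M)) fun x => κ x i := fun i hi =>
    ((H₁.knows i hi).extend (e₂.trans e₃)).comp₂ ((hkey₁ _).extend (e₂.trans e₃))
      fun y k => k y
  have hkn : ∀ i, i + 1 < N → Knows inp l₃ (h (i / M)) fun x => κ x (i + 1) := by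
    intro i hi
    have h1 := (H₂ i (by simp; omega)).1.extend e₃
    have h2 : Knows inp l₃ (h (i / M)) fun x => b x (i + 1) := fun x x' hx => henc (h1 x x' hx)
    exact h2.comp₂ ((hkey₁ _).extend (e₂.trans e₃)) fun y k => k y
  have hkp : ∀ i < N, 0 < i → Knows inp l₃ (h (i / M)) fun x => κ x (i - 1) := by
    intro i hi h0
    have h1 := (H₃ i (by simp; omega)).1
    have h2 : Knows inp l₃ (h (i / M)) fun x => b x (i - 1) := fun x x' hx => henc (h1 x x' hx)
    exact h2.comp₂ ((hkey₁ _).extend (e₂.trans e₃)) fun y k => k y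
  -- ranks
  obtain ⟨l₄, e₄, H₄⟩ := rank_scan (Λ := Λ) (M := M) e₃.feasible hg hφ hφg (by omega)
    (by omega) κ hκ
    (fun i hi h0 => (hkp i hi h0).comp₂ (hkb i hi) fun y z => y = z)
    (fun i hi => (hkb i (by omega)).comp₂ (hkn i hi) fun y z => y = z)
  obtain ⟨l₅, e₅, H₅⟩ := rank_scan (Λ := Λ) (M := M) e₄.feasible hg hφ hφg (by omega)
    (by omega) (fun x => grp (κ x))
    (fun x i j hij hj => grp_le_of_le (hκ x i j hij hj))
    (fun i hi h0 => ((hkp i hi h0).comp₂ (hkb i hi)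
      fun y z => (ofLex y).1 = (ofLex z).1).extend e₄)
    (fun i hi => ((hkb i (by omega)).comp₂ (hkn i hi)
      fun y z => (ofLex y).1 = (ofLex z).1).extend e₄)
  -- The two ranks among the labels and the two among the groups give all four counts by
  -- subtraction.
  have hk₅ : ∀ i < N, Knows inp l₅ (h (i / M)) fun x =>
      (lowPos N (κ x) i, ownCount N (κ x) i, grpPos N (κ x) i, oppCount N (κ x) i) := by
    intro i hi
    have k1 := (H₄ i hi).1.extend e₅
    have k2 := (H₄ i hi).2.extend e₅
    have k3 := (H₅ i hi).1
    have k4 := (H₅ i hi).2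
    intro x x' hx
    have r1 := k1 x x' hx
    have r2 := k2 x x' hx
    have r3 := k3 x x' hx
    have r4 := k4 x x' hx
    have s2 := card_le_lowPos (N := N) (κ := κ x) i
    have s2' := card_le_lowPos (N := N) (κ := κ x') i
    have s4 := card_le_grpPos (N := N) (κ := κ x) i
    have s4' := card_le_grpPos (N := N) (κ := κ x') i
    change lowPos N (κ x) i = lowPos N (κ x') i at r1
    change grpPos N (κ x) i = grpPos N (κ x') i at r3
    change ((Finset.range N).filter fun j => κ x j ≤ κ x i).card =
      ((Finset.range N).filter fun j => κ x' j ≤ κ x' i).card at r2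
    change ((Finset.range N).filter fun j => grp (κ x) j ≤ grp (κ x) i).card =
      ((Finset.range N).filter fun j => grp (κ x') j ≤ grp (κ x') i).card at r4
    simp only [Prod.mk.injEq]
    refine ⟨r1, by omega, r3, ?_⟩
    have hown : ownCount N (κ x) i = ownCount N (κ x') i := by omega
    omega
  -- the side length
  obtain ⟨l₆, e₆, H₆⟩ := sum_scan (Λ := Λ) (M := M) e₅.feasible hg hφ hφg (by omega)
    (fun x i => oppCount N (κ x) i)
    (fun x => lt_of_le_of_lt (joinSize_le N (κ x)) (by omega))
    (fun i hi => (hk₅ i hi).comp fun y => y.2.2.2)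
  let L : X → ℕ := fun x => cellSize M (g ^ J) (joinSize N (κ x))
  have hkL : ∀ bb < g ^ J, Knows inp l₆ (h bb) L := by
    intro bb hbb
    have h1 : bb * M < N := by rw [hN, mul_comm M]; exact Nat.mul_lt_mul_of_pos_right hbb hM
    have h2 := (H₆ (bb * M) h1).2
    rw [Nat.mul_div_cancel _ hM] at h2
    exact h2.comp fun Q => cellSize M (g ^ J) Q
  have hLQ : ∀ x, joinSize N (κ x) ≤ L x * L x * g ^ J := fun x => le_cellSize_sq hv0
  have hML : ∀ x, M ≤ L x := fun x => by simp only [L, cellSize]; omega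
  have hL0 : ∀ x, 0 < L x := fun x => by have := hML x; omega
  have hLN : ∀ x, L x ≤ 2 * N + 1 := by
    intro x
    have h1 : Nat.sqrt (joinSize N (κ x) / g ^ J) ≤ N := by
      refine (Nat.sqrt_le_sqrt ((Nat.div_le_self _ _).trans (joinSize_le N (κ x)))).trans ?_
      rw [Nat.sqrt_eq]
    simp only [L, cellSize]
    omega
  have hk₆ : ∀ i < N, Knows inp l₆ (h (i / M)) fun x =>
      (L x, κ x i, lowPos N (κ x) i, ownCount N (κ x) i, grpPos N (κ x) i,
        oppCount N (κ x) i) := by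
    intro i hi x x' hx
    have r1 := hkL _ (Nat.div_lt_of_lt_mul hi) x x' hx
    have r2 := (hkb i hi).extend ((e₄.trans e₅).trans e₆) x x' hx
    have r3 := (hk₅ i hi).extend e₆ x x' hx
    simp only [Prod.mk.injEq] at r2 r3 ⊢
    exact ⟨r1, r2, r3⟩
  have hheavy : ∀ x x' i, grpPos N (κ x) i = grpPos N (κ x') i →
      ownCount N (κ x) i = ownCount N (κ x') i → oppCount N (κ x) i = oppCount N (κ x') i →
      (IsHeavy N M (κ x) i ↔ IsHeavy N M (κ x') i) := by
    intro x x' i r1 r2 r3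
    simp only [IsHeavy, r1, r2, r3]
  have hkc : ∀ i < N, Knows inp l₆ (h (i / M)) fun x =>
      (copies N M (L x) (κ x) i, gridSize N M (L x) (κ x) i) := by
    intro i hi x x' hx
    have := hk₆ i hi x x' hx
    simp only [Prod.mk.injEq] at this ⊢
    obtain ⟨r1, -, -, r4, r5, r6⟩ := this
    simp only [copies, gridSize, hheavy x x' i r5 r4 r6, r1, r4, r5, r6, and_self]
  have hgrid : ∀ x, ∑ i ∈ Finset.range N, gridSize N M (L x) (κ x) i ≤ 3 * g ^ J := fun x =>
    sum_gridSize_le (hκ x) hN hM (hML x) (hLQ x)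
  have hcop : ∀ x, ∑ i ∈ Finset.range N, copies N M (L x) (κ x) i ≤ 2 * L x * g ^ J := fun x =>
    sum_copies_le hN (hL0 x) (hML x) (hLQ x)
  have hLv : ∀ x, 2 * L x * g ^ J < m := by
    intro x
    calc 2 * L x * g ^ J ≤ 2 * (2 * N + 1) * N :=
          Nat.mul_le_mul (Nat.mul_le_mul_left 2 (hLN x)) hvN
      _ = 4 * (N * N) + 2 * N := by ring
      _ < m := by omega
  obtain ⟨l₇, e₇, H₇⟩ := sum_scan (Λ := Λ) (M := M) e₆.feasible hg hφ hφg (by omega)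
    (fun x i => gridSize N M (L x) (κ x) i)
    (fun x => lt_of_le_of_lt (hgrid x) (by omega))
    (fun i hi => (hkc i hi).comp fun y => y.2)
  obtain ⟨l₈, e₈, H₈⟩ := sum_scan (Λ := Λ) (M := M) e₇.feasible hg hφ hφg (by omega)
    (fun x i => copies N M (L x) (κ x) i)
    (fun x => lt_of_le_of_lt (hcop x) (hLv x))
    (fun i hi => ((hkc i hi).comp fun y => y.1).extend e₇)
  have hkall : ∀ i < N, Knows inp l₈ (h (i / M)) fun x =>
      ((enc (b x i)).atom, copyPos N M (L x) (κ x) i, copies N M (L x) (κ x) i,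
        cell₀ N M (L x) (κ x) i, cellStep N (L x) (κ x) i) := by
    intro i hi x x' hx
    have q1 := (H₁.knows i hi).extend
      ((((((e₂.trans e₃).trans e₄).trans e₅).trans e₆).trans e₇).trans e₈) x x' hx
    have q2 := (H₈ i hi).1 x x' hx
    have q3 := (hkc i hi).extend (e₇.trans e₈) x x' hx
    have q4 := (H₇ i hi).1.extend e₈ x x' hx
    have q5 := (hk₆ i hi).extend (e₇.trans e₈) x x' hx
    change copyPos N M (L x) (κ x) i = copyPos N M (L x') (κ x') i at q2
    change gridBase N M (L x) (κ x) i = gridBase N M (L x') (κ x') i at q4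
    simp only [Prod.mk.injEq] at q1 q3 q5 ⊢
    obtain ⟨r1, r2, r3, r4, -, r6⟩ := q5
    have hside : side (κ x) i = side (κ x') i := by simp only [side, r2]
    refine ⟨by rw [q1], q2, q3.1, ?_, ?_⟩
    · rw [cell₀, cell₀, q4]
      simp only [r3, r1, r6, hside]
    · simp only [cellStep, r4, r1, hside]
  have hposle : ∀ x, ∀ i < N, copyPos N M (L x) (κ x) i + copies N M (L x) (κ x) i ≤
      ∑ j ∈ Finset.Ico i N, copies N M (L x) (κ x) j := by
    intro x i hi
    rw [Finset.sum_eq_sum_Ico_succ_bot hi, add_comm, copyPos]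
  have hpos : ∀ x, ∀ i < N, copyPos N M (L x) (κ x) i + copies N M (L x) (κ x) i ≤
      2 * L x * g ^ J := by
    intro x i hi
    refine (hposle x i hi).trans (le_trans ?_ (hcop x))
    exact Finset.sum_le_sum_of_subset fun j hj => by
      simp only [Finset.mem_Ico, Finset.mem_range] at hj ⊢
      exact hj.2
  have hposlt : ∀ x i j, i < j → j < N →
      copyPos N M (L x) (κ x) j + copies N M (L x) (κ x) j ≤ copyPos N M (L x) (κ x) i := by
    intro x i j hij hj
    exact (hposle x j hj).trans (Finset.sum_le_sum_of_subset (Finset.Ico_subset_Ico_left hij))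
  have hcell₀ : ∀ x, ∀ i < N, cell₀ N M (L x) (κ x) i < m ∧ cellStep N (L x) (κ x) i < m := by
    intro x i hi
    have h1 : gridBase N M (L x) (κ x) i ≤ 3 * g ^ J := by
      refine le_trans ?_ (hgrid x)
      exact Finset.sum_le_sum_of_subset fun j hj => by
        simp only [Finset.mem_Ico, Finset.mem_range] at hj ⊢
        exact hj.2
    have h2 : (i - lowPos N (κ x) i) / L x ≤ N := (Nat.div_le_self _ _).trans (by omega)
    have h3 : ceilQuot (L x) (oppCount N (κ x) i) ≤ N :=
      (ceilQuot_le (hL0 x)).trans (oppCount_le _ _ _)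
    have h4 : ceilQuot (L x) (ownCount N (κ x) i) ≤ N :=
      (ceilQuot_le (hL0 x)).trans (ownCount_le _ _ _)
    have h5 : (i - lowPos N (κ x) i) / L x *
        (if side (κ x) i then 1 else ceilQuot (L x) (oppCount N (κ x) i)) ≤ N * N :=
      Nat.mul_le_mul h2 (by split_ifs <;> omega)
    refine ⟨?_, ?_⟩
    · rw [cell₀]
      omega
    · rw [cellStep]
      split_ifs <;> omega
  have eall := (((((e₁₃.trans e₄).trans e₅).trans e₆).trans e₇).trans e₈)
  obtain ⟨l₉, e₉, H₉⟩ := multicast (Λ := Λ) (N := N) e₈.feasible hg hN hφ L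
    (fun x => hgM.trans (hML x)) hML
    (fun x => by
      refine le_trans (le_of_eq ?_) (hΛ x)
      obtain ⟨σ, hσ, hσ'⟩ := (hb x).1
      have : joinSize N (κ x) = joinSize N fun i => key x (a x i) := by
        refine Eq.trans ?_ (joinSize_comp (fun i => key x (a x i)) σ hσ)
        simp only [κ, hσ']
      simp only [L, this])
    hw (fun x i => (enc (b x i)).atom) (fun x => copyPos N M (L x) (κ x))
    (fun x => copies N M (L x) (κ x)) (fun x => cell₀ N M (L x) (κ x))
    (fun x => cellStep N (L x) (κ x))
    -- The tag encodes the side and the offset modulo `L`, which by `cell_inj` separate the copies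
    -- in one cell.
    (fun x i => (if side (κ x) i then L x else 0) + (i - lowPos N (κ x) i) % L x)
    (fun x i hi => by
      have h1 := hpos x i hi
      have h2 := hLv x
      exact ⟨by omega, by omega, hcell₀ x i hi⟩)
    (fun bb hbb => (hkL bb hbb).extend (e₇.trans e₈)) hkall
    (fun i hi x y hy => heldAfter_extend
      ((((((e₂.trans e₃).trans e₄).trans e₅).trans e₆).trans e₇).trans e₈) x _
        (H₁.held i hi x y hy))
    (fun x i hi i' hi' cc h1 h2 h3 h4 => by
      rcases lt_trichotomy i i' with hlt | heq | hlt
      · have := hposlt x i i' hlt hi'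
        omega
      · exact heq
      · have := hposlt x i' i hlt hi
        omega)
    (fun x i hi _ => hpos x i hi)
    (fun x i hi u hu => by
      obtain ⟨-, -, h3, h4⟩ := (hκ x).cell_lt (hL0 x) hi hu
      refine (h3.trans_le h4).trans_le (le_trans ?_ (hgrid x))
      exact Finset.sum_le_sum_of_subset fun j hj => by
        simp only [Finset.mem_Ico, Finset.mem_range] at hj ⊢
        exact hj.2)
    (fun x i hi _ => by
      have := Nat.mod_lt (i - lowPos N (κ x) i) (hL0 x)
      split_ifs <;> omega)
    (fun x i hi i' hi' u hu u' hu' hc ht => by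
      have h1 := Nat.mod_lt (i - lowPos N (κ x) i) (hL0 x)
      have h2 := Nat.mod_lt (i' - lowPos N (κ x) i') (hL0 x)
      have h3 : side (κ x) i = side (κ x) i' := by
        by_contra hne
        rcases hs : side (κ x) i <;> rcases hs' : side (κ x) i' <;> simp [hs, hs'] at hne ht <;>
          omega
      rw [h3] at ht
      exact (hκ x).cell_inj (hL0 x) hi hu hi' hu' hc h3 (by omega))
  refine ⟨l₉, (eall.trans e₉).mono (by simp only [joinRounds]; omega), fun x i hi j hj hgr hsi hsj => ?_⟩
  obtain ⟨σ, hσ, hσ'⟩ := (hb x).1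
  have hlab : ∀ i, a x i = b x (σ.symm i) := fun i => by rw [hσ', Equiv.apply_symm_apply]
  have hlt : ∀ i < N, σ.symm i < N := fun i hi => by
    rw [← hσ, Equiv.apply_symm_apply]
    exact hi
  rw [hlab i, hlab j]
  have hgr' : grp (κ x) (σ.symm i) = grp (κ x) (σ.symm j) := by
    simpa only [grp, κ, ← hlab] using hgr
  have hsi' : side (κ x) (σ.symm i) = false := by simpa only [side, κ, ← hlab] using hsi
  have hsj' : side (κ x) (σ.symm j) = true := by simpa only [side, κ, ← hlab] using hsj
  have e₂₉ := (((((((e₂.trans e₃).trans e₄).trans e₅).trans e₆).trans e₇).trans e₈).trans e₉)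
  rcases (hκ x).exists_common_cell (M := M) (hL0 x) (hlt i hi) (hlt j hj) hgr' hsi' hsj' with
    heq | ⟨u, hu, u', hu', hc⟩
  · refine ⟨h (σ.symm i / M), fun y hy => heldAfter_extend e₂₉ x _ (H₁.held _ (hlt i hi) x y hy),
      fun y hy => ?_⟩
    rw [heq]
    exact heldAfter_extend e₂₉ x _ (H₁.held _ (hlt j hj) x y hy)
  · refine ⟨_, fun y hy => H₉ x _ (hlt i hi) u hu y hy, fun y hy => ?_⟩
    rw [hc]
    exact H₉ x _ (hlt j hj) u' hu' y hy

end Join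

/-! ### The protocol for the similarity join -/

section Broadcast

variable {p w m : ℕ} {U Ω I X : Type*} {inp : X → Fin p → Set (Atom U Ω I)} {Λ : X → ℕ}
  {l : List (Round X (Atom U Ω I) p w m)} {g : ℕ}

/-- Broadcasting the hash functions along a tree of degree `g`. -/
theorem broadcast [Fintype I] [NeZero m] (hf : Feasible inp l) (hg : 0 < g) (ω : X → I → Ω)
    (hk : ∀ q : Fin p, (q : ℕ) = 0 → Knows inp l q ω)
    (hh : ∀ q : Fin p, (q : ℕ) = 0 → ∀ x idx, Atom.hash idx (ω x idx) ∈ heldAfter inp l x q)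
    (hΛ : ∀ x, g * Fintype.card I ≤ Λ x) (s : ℕ) :
    ∃ l', Extends inp Λ s l l' ∧ ∀ q : Fin p, (q : ℕ) < g ^ s → Knows inp l' q ω ∧
      ∀ x idx, Atom.hash idx (ω x idx) ∈ heldAfter inp l' x q := by
  classical
  induction s with
  | zero =>
    refine ⟨l, Extends.refl hf, fun q hq => ?_⟩
    have : (q : ℕ) = 0 := by simpa using hq
    exact ⟨hk q this, hh q this⟩
  | succ s ih =>
    obtain ⟨l₁, e₁, H₁⟩ := ih
    have hdiv : ∀ q : Fin p, (q : ℕ) / g < p := fun q => (Nat.div_le_self _ _).trans_lt q.2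
    -- Processor `q` is served by `q / g`, which is below `g ^ s` if `q` is below `g ^ (s + 1)`.
    obtain ⟨l₂, e₂, H₂⟩ := route (Λ := Λ) e₁.feasible
      (Finset.univ.filter fun i : Fin p × I => (i.1 : ℕ) < g ^ (s + 1))
      (fun i => ⟨i.1 / g, hdiv i.1⟩) (fun i => i.1)
      (fun x i => mkMsg (some (Atom.hash i.2 (ω x i.2))) fun _ => 0)
      (fun i hi => by
        have h1 : (i.1 : ℕ) / g < g ^ s := by
          rw [Nat.div_lt_iff_lt_mul hg, ← pow_succ]
          simpa using hi
        exact (H₁ ⟨i.1 / g, hdiv i.1⟩ h1).1.comp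
          fun f => mkMsg (some (Atom.hash i.2 (f i.2))) fun _ => 0)
      (fun x i hi y hy => by
        have h1 : (i.1 : ℕ) / g < g ^ s := by
          rw [Nat.div_lt_iff_lt_mul hg, ← pow_succ]
          simpa using hi
        simp only [mkMsg, Option.some.injEq] at hy
        exact hy ▸ (H₁ ⟨i.1 / g, hdiv i.1⟩ h1).2 x i.2)
      (fun x q => by
        refine le_trans ?_ (hΛ x)
        refine le_trans (Finset.card_le_card_of_injOn
          (fun i => ((i.1 : ℕ) % g, i.2)) (t := Finset.range g ×ˢ Finset.univ) ?_ ?_)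
          (by simp)
        · intro i _
          simp [Nat.mod_lt _ hg]
        · rintro ⟨i, a⟩ hi ⟨j, b⟩ hj hij
          simp only [Finset.coe_filter, Finset.mem_filter, Finset.mem_univ, true_and,
            Set.mem_ofPred_eq, Fin.ext_iff] at hi hj
          simp only [Prod.mk.injEq] at hij ⊢
          refine ⟨Fin.ext ?_, hij.2⟩
          rw [← Nat.div_add_mod (i : ℕ) g, ← Nat.div_add_mod (j : ℕ) g, hij.1, hi.2, hj.2])
      (fun x q => by
        refine le_trans ?_ (hΛ x)
        refine le_trans (Finset.card_le_card_of_injOn (fun i => i.2) (t := Finset.univ)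
          (by simp) ?_) (Nat.le_mul_of_pos_left _ hg)
        rintro ⟨i, a⟩ hi ⟨j, b⟩ hj hij
        simp only [Finset.coe_filter, Finset.mem_filter, Finset.mem_univ, true_and,
          Set.mem_ofPred_eq] at hi hj
        simp only [Prod.mk.injEq]
        exact ⟨hi.2.trans hj.2.symm, hij⟩)
    refine ⟨l₂, e₁.trans e₂, fun q hq => ⟨fun x x' hx => ?_, fun x idx => ?_⟩⟩
    · funext idx
      have h1 := (H₂ (q, idx) (by simpa using hq)).1 x x' hx
      simp only [mkMsg, Msg.mk.injEq, Option.some.injEq, Atom.hash.injEq] at h1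
      exact h1.1.2
    · exact (H₂ (q, idx) (by simpa using hq)).2 x _ (by simp [mkMsg])

end Broadcast

/-! ### The input as a distributed array of tuples, and the assembled protocol -/

section Scenario

/-- The input of the algorithm together with the drawn hash functions. -/
structure Scenario (U Ω I : Type*) (p n : ℕ) where
  R : Finset U
  S : Finset U
  lvl : U ⊕ U → ℕ
  owner : U ⊕ U → Fin p
  ω : I → Ω
  card_eq : R.card + S.card = n
  even : IsEven R S owner

variable {U Ω I B : Type*} {p n κ w m M : ℕ} {t : ℕ → ℕ}

/-- The initial distribution of a scenario. -/
def Scenario.input (x : Scenario U Ω I p n) (q : Fin p) : Set (Atom U Ω I) :=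
  initialInput x.R x.S x.lvl x.owner x.ω q

theorem Scenario.point_mem {x : Scenario U Ω I p n} {q : Fin p} {z : U ⊕ U} {l : ℕ} :
    Atom.point z l ∈ x.input q ↔ z ∈ x.R.disjSum x.S ∧ x.owner z = q ∧ l = x.lvl z := by
  simp only [Scenario.input, initialInput, Set.mem_ofPred_eq, Atom.point.injEq, reduceCtorEq,
    exists_false, and_false, or_false]
  constructor
  · rintro ⟨z', h1, h2, rfl, rfl⟩
    exact ⟨h1, h2, rfl⟩
  · rintro ⟨h1, h2, rfl⟩
    exact ⟨z, h1, h2, rfl, rfl⟩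

theorem Scenario.hash_mem {x : Scenario U Ω I p n} {q : Fin p} {idx : I} {f : Ω} :
    Atom.hash idx f ∈ x.input q ↔ (q : ℕ) = 0 ∧ f = x.ω idx := by
  simp only [Scenario.input, initialInput, Set.mem_ofPred_eq, Atom.hash.injEq, reduceCtorEq,
    and_false, exists_false, false_or]
  constructor
  · rintro ⟨h1, idx', rfl, rfl⟩
    exact ⟨h1, rfl⟩
  · rintro ⟨h1, rfl⟩
    exact ⟨h1, idx, rfl, rfl⟩

theorem Scenario.knows_hash {q : Fin p} (hq : (q : ℕ) = 0) :
    Knows (w := w) (m := m) (fun x : Scenario U Ω I p n => x.input) [] q fun x => x.ω := by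
  intro x x' hx
  have h1 : x.input q = x'.input q := knows_input x x' hx
  funext idx
  have h2 : Atom.hash idx (x.ω idx) ∈ x'.input q := h1 ▸ Scenario.hash_mem.2 ⟨hq, rfl⟩
  exact (Scenario.hash_mem.1 h2).2

/-- The tuples `(k, z, l)` that are generated from the points in `s`, where `l` is the level of `z`,
for the join in which the points of the relation `τ` are active. -/
def entrySet (κ : ℕ) (t : ℕ → ℕ) (τ : Bool) (s : Set (Atom U Ω I)) :
    Set (FunIdx κ t × (U ⊕ U) × ℕ) :=
  {e | Atom.point e.2.1 e.2.2 ∈ s ∧ 1 ≤ (e.1.1 : ℕ) ∧ (e.1.1 : ℕ) ≤ e.2.2 ∧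
    (e.2.1.isRight = τ → e.2.2 = (e.1.1 : ℕ))}

open Classical in
/-- The tuples of `entrySet` in some order. -/
noncomputable def entryList (κ : ℕ) (t : ℕ → ℕ) (τ : Bool) (s : Set (Atom U Ω I)) :
    List (FunIdx κ t × (U ⊕ U) × ℕ) :=
  if h : (entrySet κ t τ s).Finite then h.toFinset.toList else []

theorem nodup_entryList (τ : Bool) (s : Set (Atom U Ω I)) : (entryList κ t τ s).Nodup := by
  rw [entryList]
  split_ifs
  exacts [Finset.nodup_toList _, List.nodup_nil]

theorem mem_entrySet_of_mem {τ : Bool} {s : Set (Atom U Ω I)} {e : FunIdx κ t × (U ⊕ U) × ℕ}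
    (h : e ∈ entryList κ t τ s) : e ∈ entrySet κ t τ s := by
  rw [entryList] at h
  split_ifs at h with hs
  · simpa using h
  · simp at h

theorem Scenario.entrySet_subset (x : Scenario U Ω I p n) (q : Fin p) (τ : Bool) :
    entrySet κ t τ (x.input q) ⊆ (fun y : FunIdx κ t × (U ⊕ U) => (y.1, y.2, x.lvl y.2)) ''
      (Set.univ ×ˢ {z | z ∈ x.R.disjSum x.S ∧ x.owner z = q}) := by
  rintro ⟨k, z, l⟩ ⟨h1, -⟩
  obtain ⟨h1, h2, h3⟩ := Scenario.point_mem.1 h1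
  dsimp only at h3
  exact ⟨(k, z), ⟨trivial, h1, h2⟩, by rw [h3]⟩

theorem Scenario.finite_owned (x : Scenario U Ω I p n) (q : Fin p) :
    {z | z ∈ x.R.disjSum x.S ∧ x.owner z = q}.Finite :=
  (x.R.disjSum x.S).finite_toSet.subset fun _ h => h.1

theorem Scenario.finite_entrySet (x : Scenario U Ω I p n) (q : Fin p) (τ : Bool) :
    (entrySet κ t τ (x.input q)).Finite :=
  ((Set.finite_univ.prod (x.finite_owned q)).image _).subset (x.entrySet_subset q τ)

theorem Scenario.mem_entryList (x : Scenario U Ω I p n) (q : Fin p) (τ : Bool)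
    {e : FunIdx κ t × (U ⊕ U) × ℕ} :
    e ∈ entryList κ t τ (x.input q) ↔ e ∈ entrySet κ t τ (x.input q) := by
  rw [entryList, dif_pos (x.finite_entrySet q τ)]
  simp

theorem Scenario.length_entryList (x : Scenario U Ω I p n) (q : Fin p) (τ : Bool) :
    (entryList κ t τ (x.input q)).length ≤ Fintype.card (FunIdx κ t) * ⌈(n : ℝ) / p⌉₊ := by
  rw [entryList, dif_pos (x.finite_entrySet q τ), Finset.length_toList,
    ← Set.ncard_eq_toFinset_card _ (x.finite_entrySet q τ)]
  refine (Set.ncard_le_ncard (x.entrySet_subset q τ)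
    ((Set.finite_univ.prod (x.finite_owned q)).image _)).trans ?_
  refine (Set.ncard_image_le (Set.finite_univ.prod (x.finite_owned q))).trans ?_
  rw [Set.ncard_prod, Set.ncard_univ, Nat.card_eq_fintype_card]
  refine Nat.mul_le_mul_left _ ?_
  have := x.even q
  rwa [x.card_eq] at this

/-- The initial array: block `b < p` consists of the tuples of processor `b`. -/
noncomputable def Scenario.array (κ : ℕ) (t : ℕ → ℕ) (M : ℕ) (τ : Bool)
    (x : Scenario U Ω I p n) (i : ℕ) : Option (FunIdx κ t × (U ⊕ U) × ℕ) :=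
  if hb : i / M < p then (entryList κ t τ (x.input ⟨i / M, hb⟩))[i % M]? else none

/-- The message that contains a tuple. -/
noncomputable def encTuple [NeZero m] :
    Option (FunIdx κ t × (U ⊕ U) × ℕ) → Msg (Atom U Ω I) w m
  | none => mkMsg none fun _ => 0
  | some e => mkMsg (some (Atom.point e.2.1 e.2.2)) fun _ => Fintype.equivFin _ e.1

theorem encTuple_injective [NeZero m] (hw : 0 < w) (hm : Fintype.card (FunIdx κ t) ≤ m) :
    Function.Injective
      (encTuple : Option (FunIdx κ t × (U ⊕ U) × ℕ) → Msg (Atom U Ω I) w m) := by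
  have h0 : ∀ k : FunIdx κ t, (Fintype.equivFin _ k : ℕ) < m := fun k =>
    (Fintype.equivFin _ k).2.trans_le hm
  rintro (_ | ⟨k, z, l⟩) (_ | ⟨k', z', l'⟩) he
  · rfl
  · simp [encTuple, mkMsg] at he
  · simp [encTuple, mkMsg] at he
  · have h1 := congrArg (fun μ => Msg.val μ 0) he
    have h2 := congrArg Msg.atom he
    simp only [encTuple] at h1 h2
    rw [mkMsg_val hw (h0 _), mkMsg_val hw (h0 _)] at h1
    simp only [mkMsg, Option.some.injEq, Atom.point.injEq] at h2
    have h3 := (Fintype.equivFin _).injective (Fin.ext h1)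
    rw [h3, h2.1, h2.2]

theorem Scenario.array_eq_some {τ : Bool} {x : Scenario U Ω I p n} {i : ℕ}
    {e : FunIdx κ t × (U ⊕ U) × ℕ} (h : x.array κ t M τ i = some e) :
    (e.2.1 ∈ x.R.disjSum x.S ∧ e.2.2 = x.lvl e.2.1) ∧ (1 ≤ (e.1.1 : ℕ) ∧
      (e.1.1 : ℕ) ≤ x.lvl e.2.1 ∧ (e.2.1.isRight = τ → x.lvl e.2.1 = (e.1.1 : ℕ))) ∧
      (x.owner e.2.1 : ℕ) = i / M ∧
      (entryList κ t τ (x.input (x.owner e.2.1)))[i % M]? = some e := by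
  rw [Scenario.array] at h
  split_ifs at h with hb
  obtain ⟨h1, h2, h3, h4⟩ := mem_entrySet_of_mem (List.mem_of_getElem? h)
  obtain ⟨h5, h6, h7⟩ := Scenario.point_mem.1 h1
  rw [h7] at h3 h4
  refine ⟨⟨h5, h7⟩, ⟨h2, h3, h4⟩, by rw [h6], by rwa [h6]⟩

/-- The owner of the point determines the block, and the list of a processor has no duplicates. -/
theorem Scenario.array_inj {τ : Bool} {x : Scenario U Ω I p n} {i j : ℕ}
    {e : FunIdx κ t × (U ⊕ U) × ℕ} (hi : x.array κ t M τ i = some e)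
    (hj : x.array κ t M τ j = some e) : i = j := by
  obtain ⟨-, -, h1, h2⟩ := Scenario.array_eq_some hi
  obtain ⟨-, -, h3, h4⟩ := Scenario.array_eq_some hj
  have h5 : i % M = j % M :=
    (List.getElem?_inj (List.getElem?_eq_some_iff.1 h2).1 (nodup_entryList _ _)).1
      (h2.trans h4.symm)
  rw [← Nat.div_add_mod i M, ← Nat.div_add_mod j M, h5, ← h1, ← h3]

theorem Scenario.exists_array {τ : Bool} {x : Scenario U Ω I p n} {k : FunIdx κ t} {z : U ⊕ U}
    {v : ℕ} (hz : z ∈ x.R.disjSum x.S) (h1 : 1 ≤ (k.1 : ℕ)) (h2 : (k.1 : ℕ) ≤ x.lvl z)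
    (h3 : z.isRight = τ → x.lvl z = (k.1 : ℕ)) (hpv : p ≤ v)
    (hM : Fintype.card (FunIdx κ t) * ⌈(n : ℝ) / p⌉₊ ≤ M) :
    ∃ i < M * v, x.array κ t M τ i = some (k, z, x.lvl z) := by
  have h4 : (k, z, x.lvl z) ∈ entryList κ t τ (x.input (x.owner z)) :=
    (x.mem_entryList _ _).2 ⟨Scenario.point_mem.2 ⟨hz, rfl, rfl⟩, h1, h2, h3⟩
  obtain ⟨e, he⟩ := List.mem_iff_getElem?.1 h4
  have heM : e < M := ((List.getElem?_eq_some_iff.1 he).1.trans_le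
    (x.length_entryList _ _)).trans_le hM
  refine ⟨x.owner z * M + e, ?_, ?_⟩
  · calc (x.owner z : ℕ) * M + e < (x.owner z + 1) * M := by rw [Nat.succ_mul]; omega
      _ ≤ v * M := Nat.mul_le_mul_right M ((x.owner z).2.trans_le hpv)
      _ = M * v := mul_comm _ _
  · have h5 : ((x.owner z : ℕ) * M + e) / M = x.owner z := div_block heM
    have h6 : ((x.owner z : ℕ) * M + e) % M = e := by
      rw [Nat.mul_add_mod_self_right, Nat.mod_eq_of_lt heM]
    rw [Scenario.array, dif_pos (by rw [h5]; exact (x.owner z).2)]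
    simp only [h5, h6, Fin.eta, he]

/-- Virtual processor `b` is simulated by processor `b mod p`. -/
def modHost (p : ℕ) [NeZero p] (b : ℕ) : Fin p := Fin.ofNat p b

theorem hostLE_modHost [NeZero p] (v : ℕ) : HostLE (modHost p) v (v / p + 1) := by
  classical
  intro q
  have hp : 0 < p := Nat.pos_of_ne_zero (NeZero.ne p)
  refine (Finset.card_le_card_of_injOn (fun b => b / p) (t := Finset.range (v / p + 1)) ?_
    ?_).trans (by simp)
  · intro b hb
    obtain ⟨hb, -⟩ := Finset.mem_filter.1 (Finset.mem_coe.1 hb)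
    rw [Finset.mem_coe, Finset.mem_range]
    exact Nat.lt_succ_of_le (Nat.div_le_div_right (Finset.mem_range.1 hb).le)
  · intro b hb b' hb' h
    have h1 : b % p = b' % p := by
      have := (Finset.mem_filter.1 (Finset.mem_coe.1 hb)).2.trans
        (Finset.mem_filter.1 (Finset.mem_coe.1 hb')).2.symm
      simpa [modHost, Fin.ext_iff] using this
    rw [← Nat.div_add_mod b p, ← Nat.div_add_mod b' p, h1]
    simp only at h
    rw [h]

theorem Scenario.hasArray [NeZero m] [NeZero p] (v : ℕ) (τ : Bool) :
    HasArray (fun x : Scenario U Ω I p n => x.input) ([] : List (Round _ _ p w m)) (modHost p) M v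
      (encTuple : Option (FunIdx κ t × (U ⊕ U) × ℕ) → _) fun x => x.array κ t M τ := by
  have hhost : ∀ i (hb : i / M < p), modHost p (i / M) = ⟨i / M, hb⟩ := fun i hb =>
    Fin.ext (by simp [modHost, Nat.mod_eq_of_lt hb])
  refine ⟨fun i _ => ?_, fun i _ x y hy => ?_⟩
  · by_cases hb : i / M < p
    · simp only [Scenario.array, dif_pos hb]
      rw [hhost i hb]
      exact knows_input.comp fun s => (entryList κ t τ s)[i % M]?
    · simp only [Scenario.array, dif_neg hb]
      exact Knows.const _
  · rcases he : x.array κ t M τ i with _ | e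
    · simp [he, encTuple, mkMsg] at hy
    · simp only [he, encTuple, mkMsg, Option.some.injEq] at hy
      obtain ⟨⟨h1, h2⟩, -, h3, -⟩ := Scenario.array_eq_some he
      refine mem_heldAfter.2 (Or.inl ?_)
      rw [← hy]
      refine Scenario.point_mem.2 ⟨h1, ?_, h2⟩
      have hb : i / M < p := h3 ▸ (x.owner _).2
      rw [hhost i hb]
      exact Fin.ext h3

/-- A key of a tuple: a hash function and a hash value. -/
abbrev JoinKey (κ : ℕ) (t : ℕ → ℕ) (B : Type*) : Type _ := Option ((k : FunIdx κ t) × (Fin k.1 → B))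

open Classical in
-- Any linear order will do: sorting only has to bring equal keys together, and hash values carry no
-- order of their own.
noncomputable instance : LinearOrder (JoinKey κ t B) := linearOrderOfSTO WellOrderingRel

/-- The key of a tuple with the relation that its point belongs to. -/
def tupleKey (h : Ω → U → B) (ω : BaseIdx κ t → Ω) :
    Option (FunIdx κ t × (U ⊕ U) × ℕ) → JoinKey κ t B ×ₗ Bool
  | none => toLex (none, false)
  | some e => toLex (some ⟨e.1, hashVal h ω e.1 e.2.1⟩, e.2.1.isRight)

/-- A join result contains an active point, which keeps the common key alive. The removal of keys
without active points therefore does not affect the result and need not be carried out. -/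
theorem mem_joinResults {h : Ω → U → B} {ω : BaseIdx κ t → Ω} {R S : Finset U} {lvl : U ⊕ U → ℕ}
    {k : FunIdx κ t} {u v : U} :
    (k, u, v) ∈ joinResults h ω R S lvl ↔ (u ∈ R ∧ v ∈ S) ∧ 1 ≤ (k.1 : ℕ) ∧
      (k.1 : ℕ) ≤ lvl (Sum.inl u) ∧ (k.1 : ℕ) ≤ lvl (Sum.inr v) ∧
      hashVal h ω k (Sum.inl u) = hashVal h ω k (Sum.inr v) ∧
      (lvl (Sum.inl u) = k.1 ∨ lvl (Sum.inr v) = k.1) := by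
  simp only [joinResults, keptTuples, tuples, Set.mem_ofPred_eq, Finset.inl_mem_disjSum,
    Finset.inr_mem_disjSum]
  constructor
  · rintro ⟨⟨⟨h1, h2, h3⟩, -⟩, ⟨⟨h4, -, h5⟩, -⟩, h6, h7⟩
    exact ⟨⟨h1, h4⟩, h2, h3, h5, h6, h7⟩
  · rintro ⟨⟨h1, h4⟩, h2, h3, h5, h6, h7⟩
    have key : ∃ z, (z ∈ R.disjSum S ∧ 1 ≤ (k.1 : ℕ) ∧ (k.1 : ℕ) ≤ lvl z) ∧ lvl z = k.1 ∧
        hashVal h ω k z = hashVal h ω k (Sum.inl u) := by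
      rcases h7 with h7 | h7
      · exact ⟨Sum.inl u, ⟨by simpa, h2, h3⟩, h7, rfl⟩
      · exact ⟨Sum.inr v, ⟨by simpa, h2, h5⟩, h7, h6.symm⟩
    exact ⟨⟨⟨h1, h2, h3⟩, key⟩, ⟨⟨h4, h2, h5⟩, h6 ▸ key⟩, h6, h7⟩

theorem finite_joinResults (h : Ω → U → B) (ω : BaseIdx κ t → Ω) (R S : Finset U)
    (lvl : U ⊕ U → ℕ) : (joinResults h ω R S lvl).Finite := by
  refine (Set.finite_univ.prod (R.finite_toSet.prod S.finite_toSet)).subset ?_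
  rintro ⟨k, u, v⟩ hg
  exact ⟨trivial, (mem_joinResults.1 hg).1⟩

/-- If two tuples of one group lie on different sides, the one from the relation `τ` is active, so
they form a join result. Each result is counted from at most two ordered pairs of positions; the
`Bool` tells which position holds the point of `R`. Blank entries all lie on the same side and meet
nothing. -/
theorem Scenario.joinSize_le (h : Ω → U → B) (x : Scenario U Ω (BaseIdx κ t) p n) (τ : Bool)
    (N : ℕ) : joinSize N (fun i => tupleKey h x.ω (x.array κ t M τ i)) ≤
      2 * (joinResults h x.ω x.R x.S x.lvl).ncard := by
  have hfin := finite_joinResults h x.ω x.R x.S x.lvl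
  let r (i : (_ : ℕ) × ℕ) (b : (FunIdx κ t × U × U) × Bool) : Prop :=
    x.array κ t M τ (if b.2 then i.1 else i.2) =
        some (b.1.1, Sum.inl b.1.2.1, x.lvl (Sum.inl b.1.2.1)) ∧
      x.array κ t M τ (if b.2 then i.2 else i.1) =
        some (b.1.1, Sum.inr b.1.2.2, x.lvl (Sum.inr b.1.2.2))
  have key : ∀ i j k u l v l', x.array κ t M τ i = some (k, Sum.inl u, l) →
      x.array κ t M τ j = some (k, Sum.inr v, l') →
      hashVal h x.ω k (Sum.inl u) = hashVal h x.ω k (Sum.inr v) →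
      (k, u, v) ∈ joinResults h x.ω x.R x.S x.lvl ∧ l = x.lvl (Sum.inl u) ∧
        l' = x.lvl (Sum.inr v) := by
    intro i j k u l v l' hi hj hh
    obtain ⟨⟨h1, h2⟩, ⟨h3, h4, h5⟩, -⟩ := Scenario.array_eq_some hi
    obtain ⟨⟨h6, h7⟩, ⟨-, h8, h9⟩, -⟩ := Scenario.array_eq_some hj
    refine ⟨mem_joinResults.2 ⟨⟨by simpa using h1, by simpa using h6⟩, h3, h4, h8, hh, ?_⟩, h2, h7⟩
    cases τ
    · exact Or.inl (h5 rfl)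
    · exact Or.inr (h9 rfl)
  have h1 : joinSize N (fun i => tupleKey h x.ω (x.array κ t M τ i)) ≤
      (hfin.toFinset ×ˢ (Finset.univ : Finset Bool)).card := by
    unfold joinSize oppCount
    rw [← Finset.card_sigma]
    refine Finset.card_le_card_of_forall_subsingleton r ?_ ?_
    · rintro ⟨i, j⟩ hij
      obtain ⟨h1, h2⟩ := (Finset.mem_filter.1 (Finset.mem_sigma.1 hij).2).2
      dsimp only [grp] at h1 h2
      rcases hi : x.array κ t M τ i with _ | ⟨k, z, l⟩ <;>
        rcases hj : x.array κ t M τ j with _ | ⟨k', z', l'⟩ <;>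
        rw [hi, hj] at h1 h2
      · exact absurd rfl h2
      · simp [tupleKey] at h1
      · simp [tupleKey] at h1
      · simp only [tupleKey, ofLex_toLex, Option.some.injEq] at h1
        have hk : k' = k := congrArg Sigma.fst h1
        subst hk
        have hh : hashVal h x.ω k' z' = hashVal h x.ω k' z := eq_of_heq (Sigma.mk.inj h1).2
        rcases z with u | u <;> rcases z' with v | v
        · exact absurd (by simp [tupleKey, hh]) h2
        · obtain ⟨h3, h4, h5⟩ := key i j k' u l v l' hi hj hh.symm
          refine ⟨((k', u, v), true), by simpa using h3, ?_⟩
          simp only [r, if_true]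
          exact ⟨h4 ▸ hi, h5 ▸ hj⟩
        · obtain ⟨h3, h4, h5⟩ := key j i k' v l' u l hj hi hh
          refine ⟨((k', v, u), false), by simpa using h3, ?_⟩
          simp only [r]
          exact ⟨h4 ▸ hj, h5 ▸ hi⟩
        · exact absurd (by simp [tupleKey, hh]) h2
    · rintro ⟨⟨k, u, v⟩, b⟩ - ⟨i, j⟩ hi ⟨i', j'⟩ hj
      have h1 := hi.2
      have h2 := hj.2
      cases b
      · have h3 := Scenario.array_inj h1.1 h2.1
        have h4 := Scenario.array_inj h1.2 h2.2
        simp only [Bool.false_eq_true, if_false] at h3 h4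
        rw [h3, h4]
      · have h3 := Scenario.array_inj h1.1 h2.1
        have h4 := Scenario.array_inj h1.2 h2.2
        simp only [if_true] at h3 h4
        rw [h3, h4]
  refine h1.trans (le_of_eq ?_)
  rw [Finset.card_product, Set.ncard_eq_toFinset_card _ hfin]
  simp [mul_comm]

theorem cellSize_mono {M v Q Q' : ℕ} (h : Q ≤ Q') : cellSize M v Q ≤ cellSize M v Q' := by
  have := Nat.sqrt_le_sqrt (Nat.div_le_div_right (c := v) h)
  simp only [cellSize]
  omega

/-- The similarity join protocol, with explicit parameters. -/
theorem exists_join_protocol (h : Ω → U → B) {g J E : ℕ} (hp : 0 < p) (hn : 0 < n) (hg : 0 < g)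
    (hpg : p ≤ g ^ J) (hM : 0 < M) (hME : M = E * g) (hMg : 2 * (g * g) ≤ M)
    (hFM : Fintype.card (FunIdx κ t) * ⌈(n : ℝ) / p⌉₊ ≤ M) (hw : 4 ≤ w)
    (hm : 8 * (M * g ^ J) ^ 2 + 8 < m) :
    ∃ P : Protocol p w m U Ω (BaseIdx κ t) (FunIdx κ t), P.rounds ≤ J + 2 * joinRounds J ∧
      ∀ x : Scenario U Ω (BaseIdx κ t) p n, P.generated (initialInput x.R x.S x.lvl x.owner x.ω) =
          joinResults h x.ω x.R x.S x.lvl ∧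
        P.load (initialInput x.R x.S x.lvl x.owner x.ω) ≤
          6 * cellSize M (g ^ J) (2 * (joinResults h x.ω x.R x.S x.lvl).ncard) * (g ^ J / p + 1) +
            g * Fintype.card (BaseIdx κ t) := by
  have : NeZero p := ⟨hp.ne'⟩
  have : NeZero m := ⟨by omega⟩
  let inp : Scenario U Ω (BaseIdx κ t) p n → Fin p → Set (Atom U Ω (BaseIdx κ t)) :=
    fun x => x.input
  let Λ : Scenario U Ω (BaseIdx κ t) p n → ℕ := fun x =>
    6 * cellSize M (g ^ J) (2 * (joinResults h x.ω x.R x.S x.lvl).ncard) * (g ^ J / p + 1) +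
      g * Fintype.card (BaseIdx κ t)
  have hcard : Fintype.card (FunIdx κ t) ≤ m := by
    have h1 : 0 < ⌈(n : ℝ) / p⌉₊ := Nat.ceil_pos.2 (by positivity)
    have h2 := Nat.le_mul_of_pos_right (Fintype.card (FunIdx κ t)) h1
    have h3 : M ≤ M * g ^ J := Nat.le_mul_of_pos_right M (Nat.pow_pos hg)
    have h4 : M * g ^ J ≤ (M * g ^ J) ^ 2 := Nat.le_self_pow (by norm_num) _
    omega
  have henc := encTuple_injective (U := U) (Ω := Ω) (I := BaseIdx κ t) (w := w) (κ := κ) (t := t)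
    (by omega) hcard
  obtain ⟨l₁, e₁, H₁⟩ := broadcast (inp := inp) (Λ := Λ) (l := ([] : List (Round _ _ p w m)))
    trivial hg (fun x => x.ω) (fun q hq => Scenario.knows_hash hq)
    (fun q hq x idx => mem_heldAfter.2 (Or.inl (Scenario.hash_mem.2 ⟨hq, rfl⟩)))
    (fun x => Nat.le_add_left _ _) J
  have hω : ∀ q, Knows inp l₁ q fun x => x.ω := fun q => (H₁ q (q.2.trans_le hpg)).1
  have hΛ : ∀ τ x, 6 * cellSize M (g ^ J)
      (joinSize (M * g ^ J) fun i => tupleKey h x.ω (x.array κ t M τ i)) * (g ^ J / p + 1) ≤ Λ x := by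
    intro τ x
    refine le_trans ?_ (Nat.le_add_right _ _)
    exact Nat.mul_le_mul_right _ (Nat.mul_le_mul_left _ (cellSize_mono (x.joinSize_le h τ _)))
  -- One join for each relation that provides the active points.
  obtain ⟨l₂, e₂, H₂⟩ := ((Scenario.hasArray (M := M) (κ := κ) (t := t) (g ^ J) false).extend
    e₁).join hg hM hME hMg (hostLE_modHost (g ^ J)) henc hw hm e₁.feasible
    (key := fun x => tupleKey h x.ω) (fun q => (hω q).comp (tupleKey h)) (hΛ false)
  obtain ⟨l₃, e₃, H₃⟩ := ((Scenario.hasArray (M := M) (κ := κ) (t := t) (g ^ J) true).extend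
    (e₁.trans e₂)).join hg hM hME hMg (hostLE_modHost (g ^ J)) henc hw hm e₂.feasible
    (key := fun x => tupleKey h x.ω) (fun q => ((hω q).extend e₂).comp (tupleKey h)) (hΛ true)
  -- A processor emits every qualifying pair among the points that it holds. Nothing wrong is
  -- emitted, as all held points and levels come from the input; nothing is missed, as the join in
  -- which the relation of an active point plays the active part brings the pair together.
  let emitted (s : Set (Atom U Ω (BaseIdx κ t))) (ω : BaseIdx κ t → Ω) :
      Set (FunIdx κ t × U × U) :=
    {e | ∃ l l', Atom.point (Sum.inl e.2.1) l ∈ s ∧ Atom.point (Sum.inr e.2.2) l' ∈ s ∧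
      1 ≤ (e.1.1 : ℕ) ∧ (e.1.1 : ℕ) ≤ l ∧ (e.1.1 : ℕ) ≤ l' ∧
      hashVal h ω e.1 (Sum.inl e.2.1) = hashVal h ω e.1 (Sum.inr e.2.2) ∧ (l = e.1.1 ∨ l' = e.1.1)}
  obtain ⟨P, hP₁, hP₂, hP₃⟩ := exists_protocol (K := FunIdx κ t) e₃.feasible
    (fun x q => emitted (heldAfter inp l₃ x q) x.ω)
    (fun q => knows_held.comp₂ ((hω q).extend (e₂.trans e₃)) emitted)
    (fun x q g hg => by
      obtain ⟨l, l', h1, h2, -⟩ := hg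
      exact ⟨⟨l, h1⟩, ⟨l', h2⟩⟩)
  obtain ⟨-, l₄, h₄, hT, hL⟩ := (e₁.trans e₂).trans e₃
  rw [List.append_nil] at h₄
  subst h₄
  refine ⟨P, by rw [hP₁]; omega, fun x => ⟨(hP₂ x).trans ?_, hP₃ Λ hL x⟩⟩
  ext ⟨k, u, v⟩
  rw [mem_joinResults]
  constructor
  · rintro ⟨q, l, l', h1, h2, h3, h4, h5, h6, h7⟩
    obtain ⟨q₁, h1⟩ := e₃.feasible.held_input h1
    obtain ⟨q₂, h2⟩ := e₃.feasible.held_input h2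
    obtain ⟨hu, -, rfl⟩ := Scenario.point_mem.1 h1
    obtain ⟨hv, -, rfl⟩ := Scenario.point_mem.1 h2
    exact ⟨⟨by simpa using hu, by simpa using hv⟩, h3, h4, h5, h6, h7⟩
  · rintro ⟨⟨h1, h2⟩, h3, h4, h5, h6, h7⟩
    have hu : Sum.inl u ∈ x.R.disjSum x.S := by simpa
    have hv : Sum.inr v ∈ x.R.disjSum x.S := by simpa
    suffices ∃ q, Atom.point (Sum.inl u) (x.lvl (Sum.inl u)) ∈ heldAfter inp l₃ x q ∧
        Atom.point (Sum.inr v) (x.lvl (Sum.inr v)) ∈ heldAfter inp l₃ x q by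
      obtain ⟨q, hq₁, hq₂⟩ := this
      exact ⟨q, _, _, hq₁, hq₂, h3, h4, h5, h6, h7⟩
    rcases h7 with h7 | h7
    · obtain ⟨i, hi, hi'⟩ := Scenario.exists_array (τ := false) hu h3 h4 (fun _ => h7) hpg hFM
      obtain ⟨j, hj, hj'⟩ := Scenario.exists_array (τ := false) hv h3 h5 (by simp) hpg hFM
      obtain ⟨q, hq₁, hq₂⟩ := H₂ x i hi j hj (by simp [grp, hi', hj', tupleKey, h6])
        (by simp [side, hi', tupleKey]) (by simp [side, hj', tupleKey])
      rw [hi'] at hq₁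
      rw [hj'] at hq₂
      exact ⟨q, heldAfter_extend e₃ x q (hq₁ _ rfl), heldAfter_extend e₃ x q (hq₂ _ rfl)⟩
    · obtain ⟨i, hi, hi'⟩ := Scenario.exists_array (τ := true) hu h3 h4 (by simp) hpg hFM
      obtain ⟨j, hj, hj'⟩ := Scenario.exists_array (τ := true) hv h3 h5 (fun _ => h7) hpg hFM
      obtain ⟨q, hq₁, hq₂⟩ := H₃ x i hi j hj (by simp [grp, hi', hj', tupleKey, h6])
        (by simp [side, hi', tupleKey]) (by simp [side, hj', tupleKey])
      rw [hi'] at hq₁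
      rw [hj'] at hq₂
      exact ⟨q, hq₁ _ rfl, hq₂ _ rfl⟩

end Scenario

/-! ### Collision probabilities -/

section Collision

variable {U Ω B : Type*} [MeasurableSpace Ω] {μ : Measure Ω} [IsProbabilityMeasure μ]
  {h : Ω → U → B} {κ : ℕ} {t : ℕ → ℕ}

theorem setOf_forall_eq_pi (h : Ω → U → B) (i : ℕ) (x y : U) :
    {g : Fin i → Ω | ∀ a, h (g a) x = h (g a) y} =
      Set.univ.pi fun _ => {ω | h ω x = h ω y} := by
  ext g
  simp

theorem measurableSet_concat (hm : ∀ x y, MeasurableSet {ω | h ω x = h ω y}) (i : ℕ) (x y : U) :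
    MeasurableSet {g : Fin i → Ω | ∀ a, h (g a) x = h (g a) y} := by
  rw [setOf_forall_eq_pi]
  exact MeasurableSet.univ_pi fun _ => hm x y

theorem concatProb_eq (i : ℕ) (x y : U) :
    concatProb μ h i x y = μ.real {ω | h ω x = h ω y} ^ i := by
  rw [concatProb, setOf_forall_eq_pi, Measure.real, Measure.pi_pi, Finset.prod_const,
    Finset.card_univ, Fintype.card_fin, ENNReal.toReal_pow, Measure.real]

/-- Grouping the independent base functions by `k` shows that the concatenated functions are
independent, each distributed as in `concatProb`. -/
theorem measurePreserving_curry : MeasurePreserving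
    (fun (ω : BaseIdx κ t → Ω) (k : FunIdx κ t) (a : Fin k.1) => ω ⟨k, a⟩)
    (Measure.pi fun _ => μ) (Measure.pi fun k : FunIdx κ t => Measure.pi fun _ : Fin k.1 => μ) := by
  refine ⟨by fun_prop, ?_⟩
  have := Measure.infinitePi_map_piCurry fun (k : FunIdx κ t) (_ : Fin k.1) => μ
  simp only [Measure.infinitePi_eq_pi] at this
  exact this

theorem setOf_hashVal_eq (h : Ω → U → B) (k : FunIdx κ t) (z z' : U ⊕ U) :
    {ω : BaseIdx κ t → Ω | hashVal h ω k z = hashVal h ω k z'} =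
      (fun (ω : BaseIdx κ t → Ω) (k : FunIdx κ t) (a : Fin k.1) => ω ⟨k, a⟩) ⁻¹'
        (Function.eval k ⁻¹' {g | ∀ a, h (g a) (z.elim id id) = h (g a) (z'.elim id id)}) := by
  ext ω
  simp [hashVal, funext_iff]

theorem measurableSet_hashVal (hm : ∀ x y, MeasurableSet {ω | h ω x = h ω y}) (k : FunIdx κ t)
    (z z' : U ⊕ U) :
    MeasurableSet {ω : BaseIdx κ t → Ω | hashVal h ω k z = hashVal h ω k z'} := by
  rw [setOf_hashVal_eq]
  exact (measurable_pi_apply k (measurableSet_concat hm _ _ _)).preimage (by fun_prop)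

theorem real_hashVal (hm : ∀ x y, MeasurableSet {ω | h ω x = h ω y}) (k : FunIdx κ t)
    (z z' : U ⊕ U) :
    (Measure.pi fun _ => μ).real {ω : BaseIdx κ t → Ω | hashVal h ω k z = hashVal h ω k z'} =
      concatProb μ h k.1 (z.elim id id) (z'.elim id id) := by
  rw [setOf_hashVal_eq, concatProb, Measure.real, Measure.real,
    measurePreserving_curry.measure_preimage
      (measurable_pi_apply k (measurableSet_concat hm _ _ _)).nullMeasurableSet,
    (measurePreserving_eval _ k).measure_preimage (measurableSet_concat hm _ _ _).nullMeasurableSet]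

/-- The probability that `z` and `z'` collide under no function of level `i`. -/
theorem real_forall_hashVal_ne (hm : ∀ x y, MeasurableSet {ω | h ω x = h ω y}) (i : Fin (κ + 1))
    (z z' : U ⊕ U) :
    (Measure.pi fun _ => μ).real {ω : BaseIdx κ t → Ω |
        ∀ k : FunIdx κ t, k.1 = i → hashVal h ω k z ≠ hashVal h ω k z'} =
      (1 - concatProb μ h i (z.elim id id) (z'.elim id id)) ^ t i := by
  classical
  have h1 : {ω : BaseIdx κ t → Ω |
        ∀ k : FunIdx κ t, k.1 = i → hashVal h ω k z ≠ hashVal h ω k z'} =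
      (fun (ω : BaseIdx κ t → Ω) (k : FunIdx κ t) (a : Fin k.1) => ω ⟨k, a⟩) ⁻¹'
        (Set.univ.pi fun k : FunIdx κ t => if k.1 = i then
          {g | ∀ a, h (g a) (z.elim id id) = h (g a) (z'.elim id id)}ᶜ else Set.univ) := by
    ext ω
    simp only [Set.mem_ofPred_eq, Set.mem_preimage, Set.mem_univ_pi, ne_eq, hashVal, funext_iff]
    refine forall_congr' fun k => ?_
    split_ifs with hk
    · simp [hk]
    · simp [hk]
  have h2 : ∀ k : FunIdx κ t, MeasurableSet (if k.1 = i then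
      {g : Fin k.1 → Ω | ∀ a, h (g a) (z.elim id id) = h (g a) (z'.elim id id)}ᶜ
        else Set.univ) := by
    intro k
    split_ifs
    exacts [(measurableSet_concat hm _ _ _).compl, MeasurableSet.univ]
  rw [h1, Measure.real, measurePreserving_curry.measure_preimage
    (MeasurableSet.univ_pi h2).nullMeasurableSet, Measure.pi_pi, ENNReal.toReal_prod]
  have h3 : ∀ k : FunIdx κ t, ((Measure.pi fun _ : Fin k.1 => μ) (if k.1 = i then
      {g : Fin k.1 → Ω | ∀ a, h (g a) (z.elim id id) = h (g a) (z'.elim id id)}ᶜ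
        else Set.univ)).toReal =
      if k.1 = i then 1 - concatProb μ h i (z.elim id id) (z'.elim id id) else 1 := by
    intro k
    split_ifs with hk
    · rw [← hk, concatProb]
      exact probReal_compl_eq_one_sub (measurableSet_concat hm _ _ _)
    · simp
  rw [Finset.prod_congr rfl fun k _ => h3 k, Fintype.prod_sigma, Finset.prod_eq_single i]
  · simp
  · intro j _ hj
    simp [hj]
  · simp

end Collision

/-! ### The success probability -/

section Output

variable {U Ω B : Type*} [MeasurableSpace Ω] {μ : Measure Ω} [IsProbabilityMeasure μ]
  {h : Ω → U → B} {κ n : ℕ} {d : U → U → ℝ} {r c p₁ p₂ a : ℝ} {R S : Finset U} {lvl : U ⊕ U → ℕ}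

/-- The pairs that are generated in the join results. -/
def joinOutput (d : U → U → ℝ) (r : ℝ) {K : Type*} (G : Set (K × U × U)) : Set (U × U) :=
  {g | d g.1 g.2 ≤ r ∧ ∃ k, (k, g) ∈ G}

theorem one_sub_pow_le {P q x : ℝ} {m : ℕ} (hP : 0 < P) (hPq : P ≤ q) (hq : q ≤ 1)
    (hm : x * P⁻¹ ≤ m) : (1 - q) ^ m ≤ Real.exp (-x) := by
  have h1 : (1 - q) ^ m ≤ Real.exp (-P) ^ m := by
    refine pow_le_pow_left₀ (by linarith) ?_ m
    have := Real.add_one_le_exp (-P)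
    linarith
  refine h1.trans ?_
  rw [← Real.exp_nat_mul, Real.exp_le_exp]
  have := mul_le_mul_of_nonneg_right hm hP.le
  rw [mul_assoc, inv_mul_cancel₀ hP.ne', mul_one] at this
  linarith

/-- At the smaller of its two levels a pair has one active point and none that is dead, so a near
pair is missed only if all functions of that level separate it. The number of repetitions makes this
probability at most `n ^ (-(a + 2))`, and a union bound over at most `n ^ 2` pairs concludes. -/
theorem measure_output_ne (H : IsLSH d μ h r c p₁ p₂) (hp₁ : 0 < p₁) (hn : 0 < n)
    (hcard : R.card + S.card = n) (hlvl : IsBestLevel μ h p₁ κ R S lvl) :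
    (Measure.pi fun _ => μ) {ω : BaseIdx κ (reps p₁ a n) → Ω |
        joinOutput d r (joinResults h ω R S lvl) ≠ simJoin d r R S} ≤
      ENNReal.ofReal ((n : ℝ) ^ (-a)) := by
  classical
  let lv (g : U × U) : ℕ := min (lvl (Sum.inl g.1)) (lvl (Sum.inr g.2))
  let F (g : U × U) : Set (BaseIdx κ (reps p₁ a n) → Ω) :=
    {ω | ∀ k : FunIdx κ (reps p₁ a n), (k.1 : ℕ) = lv g →
      hashVal h ω k (Sum.inl g.1) ≠ hashVal h ω k (Sum.inr g.2)}
  let near := (R ×ˢ S).filter fun g => d g.1 g.2 ≤ r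
  have hsub : {ω : BaseIdx κ (reps p₁ a n) → Ω |
      joinOutput d r (joinResults h ω R S lvl) ≠ simJoin d r R S} ⊆ ⋃ g ∈ near, F g := by
    intro ω hω
    by_contra hcon
    apply hω
    ext ⟨u, v⟩
    constructor
    · rintro ⟨h1, k, h2⟩
      obtain ⟨⟨h3, h4⟩, -⟩ := mem_joinResults.1 h2
      exact ⟨h3, h4, h1⟩
    · rintro ⟨h1, h2, h3⟩
      refine ⟨h3, ?_⟩
      have h4 : (u, v) ∈ near := by
        simp only [near, Finset.mem_filter, Finset.mem_product]
        exact ⟨⟨h1, h2⟩, h3⟩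
      have h5 : ω ∉ F (u, v) := fun hF => hcon (Set.mem_biUnion h4 hF)
      simp only [F, Set.mem_ofPred_eq, not_forall, not_not] at h5
      obtain ⟨k, hk, h6⟩ := h5
      have l1 := hlvl (Sum.inl u) (by simpa)
      have l2 := hlvl (Sum.inr v) (by simpa)
      simp only [lv] at hk
      exact ⟨k, mem_joinResults.2 ⟨⟨h1, h2⟩, by omega, by omega, by omega, h6, by omega⟩⟩
  have hF : ∀ g ∈ near, (Measure.pi fun _ => μ) (F g) ≤
      ENNReal.ofReal ((n : ℝ) ^ (-(a + 2))) := by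
    rintro ⟨u, v⟩ hg
    simp only [near, Finset.mem_filter, Finset.mem_product] at hg
    have l1 := hlvl (Sum.inl u) (by simpa using hg.1.1)
    have hi : lv (u, v) < κ + 1 := by
      simp only [lv]
      omega
    have h1 := real_forall_hashVal_ne (μ := μ) (t := reps p₁ a n) H.measurableSet_collision
      ⟨lv (u, v), hi⟩ (Sum.inl u) (Sum.inr v)
    have h2 : F (u, v) = {ω | ∀ k : FunIdx κ (reps p₁ a n), k.1 = ⟨lv (u, v), hi⟩ →
        hashVal h ω k (Sum.inl u) ≠ hashVal h ω k (Sum.inr v)} := by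
      simp only [F, Fin.ext_iff]
    rw [h2, ← ENNReal.ofReal_toReal (measure_ne_top _ _)]
    refine ENNReal.ofReal_le_ofReal ?_
    rw [Measure.real] at h1
    rw [h1]
    have h3 : Real.exp (-((a + 2) * Real.log n)) = (n : ℝ) ^ (-(a + 2)) := by
      rw [Real.rpow_def_of_pos (by positivity)]
      congr 1
      ring
    rw [← h3]
    refine one_sub_pow_le (P := p₁ ^ lv (u, v)) (pow_pos hp₁ _) ?_ ?_ ?_
    · rw [concatProb_eq]
      exact pow_le_pow_left₀ hp₁.le (H.near u v hg.2) _
    · rw [concatProb_eq]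
      exact pow_le_one₀ measureReal_nonneg measureReal_le_one
    · refine le_trans (le_of_eq ?_) (Nat.le_ceil _)
      ring
  have hnear : (near.card : ℝ) ≤ (n : ℝ) ^ (2 : ℝ) := by
    have h1 : near.card ≤ n * n := by
      refine (Finset.card_filter_le _ _).trans ?_
      rw [Finset.card_product]
      exact Nat.mul_le_mul (by omega) (by omega)
    rw [Real.rpow_two, sq]
    exact_mod_cast h1
  calc _ ≤ (Measure.pi fun _ => μ) (⋃ g ∈ near, F g) := measure_mono hsub
    _ ≤ ∑ g ∈ near, (Measure.pi fun _ => μ) (F g) := measure_biUnion_finset_le _ _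
    _ ≤ ∑ g ∈ near, ENNReal.ofReal ((n : ℝ) ^ (-(a + 2))) := Finset.sum_le_sum hF
    _ = ENNReal.ofReal (near.card * (n : ℝ) ^ (-(a + 2))) := by
      rw [Finset.sum_const, nsmul_eq_mul, ENNReal.ofReal_mul (by positivity),
        ENNReal.ofReal_natCast]
    _ ≤ _ := by
      refine ENNReal.ofReal_le_ofReal ?_
      refine (mul_le_mul_of_nonneg_right hnear (by positivity)).trans (le_of_eq ?_)
      rw [← Real.rpow_add (by positivity)]
      congr 1
      ring

end Output

/-! ### The expected number of join results -/

section JoinWork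

variable {U Ω B : Type*} [MeasurableSpace Ω] {μ : Measure Ω} [IsProbabilityMeasure μ]
  {h : Ω → U → B} {κ n : ℕ} {p₁ a : ℝ} {R S : Finset U} {lvl : U ⊕ U → ℕ}

theorem concatProb_nonneg (i : ℕ) (x y : U) : 0 ≤ concatProb μ h i x y := measureReal_nonneg

/-- Since `(p₁ ^ i)⁻¹ * log n` is at least `1`, the rounding is absorbed by replacing `a + 2` with
`a + 3`. -/
theorem reps_le (ha : 0 < a) (hp₁ : 0 < p₁) (hp₁' : p₁ < 1) (hn : 1 ≤ Real.log n) (i : ℕ) :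
    (reps p₁ a n i : ℝ) ≤ (a + 3) * (p₁ ^ i)⁻¹ * Real.log n := by
  have h1 : 1 ≤ (p₁ ^ i)⁻¹ := (one_le_inv₀ (pow_pos hp₁ i)).2 (pow_le_one₀ hp₁.le hp₁'.le)
  have h2 : 1 ≤ (p₁ ^ i)⁻¹ * Real.log n := one_le_mul_of_one_le_of_one_le h1 hn
  have h3 : 0 ≤ (a + 2) * (p₁ ^ i)⁻¹ * Real.log n := by positivity
  have h4 := (Nat.ceil_lt_add_one h3).le
  rw [reps]
  linarith

theorem sum_active_le {ρ : FunIdx κ (reps p₁ a n) → ℝ} {l : ℕ} {b : ℝ} (hb : 0 ≤ b)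
    (hρ : ∀ k, (k.1 : ℕ) = l → ρ k = b) (hρ₀ : ∀ k, (k.1 : ℕ) ≠ l → ρ k = 0) :
    ∑ k, ρ k ≤ reps p₁ a n l * b := by
  rw [Fintype.sum_sigma]
  by_cases hl : l < κ + 1
  · rw [Finset.sum_eq_single (⟨l, hl⟩ : Fin (κ + 1))]
    · rw [Finset.sum_congr rfl fun j _ => hρ ⟨⟨l, hl⟩, j⟩ rfl]
      simp
    · intro i _ hi
      refine Finset.sum_eq_zero fun j _ => hρ₀ ⟨i, j⟩ fun h => hi (Fin.ext h)
    · simp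
  · rw [Finset.sum_eq_zero]
    · positivity
    · intro i _
      refine Finset.sum_eq_zero fun j _ => hρ₀ ⟨i, j⟩ fun h => hl ?_
      rw [← h]
      exact i.2

/-- The number of join results is bounded by a measurable function whose expectation is at most the
total expected cost, up to a logarithmic factor. -/
theorem exists_joinWork_bound (hm : ∀ x y, MeasurableSet {ω | h ω x = h ω y}) (ha : 0 < a)
    (hp₁ : 0 < p₁) (hp₁' : p₁ < 1) (hn : 1 ≤ Real.log n) :
    ∃ W : (BaseIdx κ (reps p₁ a n) → Ω) → ℕ, Measurable W ∧
      (∀ ω, (joinResults h ω R S lvl).ncard ≤ W ω) ∧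
      ∫⁻ ω, (W ω : ℝ≥0∞) ∂(Measure.pi fun _ => μ) ≤ ENNReal.ofReal ((a + 3) * Real.log n *
        ∑ z ∈ R.disjSum S, expectedCost μ h p₁ R S (lvl z) z) := by
  classical
  -- For the upper bound it is enough that one point is active; that the other one is not dead is
  -- dropped.
  let T : Finset (FunIdx κ (reps p₁ a n) × U × U) := (Finset.univ ×ˢ R ×ˢ S).filter fun e =>
    (e.1.1 : ℕ) = lvl (Sum.inl e.2.1) ∨ (e.1.1 : ℕ) = lvl (Sum.inr e.2.2)
  let A (e : FunIdx κ (reps p₁ a n) × U × U) : Set (BaseIdx κ (reps p₁ a n) → Ω) :=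
    {ω | hashVal h ω e.1 (Sum.inl e.2.1) = hashVal h ω e.1 (Sum.inr e.2.2)}
  have hA : ∀ e, MeasurableSet (A e) := fun e => measurableSet_hashVal hm _ _ _
  refine ⟨fun ω => ∑ e ∈ T, (A e).indicator 1 ω,
    Finset.measurable_sum _ fun e _ => measurable_one.indicator (hA e), fun ω => ?_, ?_⟩
  · have h1 : joinResults h ω R S lvl ⊆ (T.filter fun e => ω ∈ A e : Finset _) := by
      rintro ⟨k, u, v⟩ hg
      obtain ⟨⟨h1, h2⟩, -, -, -, h3, h4⟩ := mem_joinResults.1 hg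
      simp only [T, A, Finset.coe_filter, Finset.mem_filter, Finset.mem_product, Finset.mem_univ,
        true_and, Set.mem_ofPred_eq]
      exact ⟨⟨⟨h1, h2⟩, h4.imp Eq.symm Eq.symm⟩, h3⟩
    refine (Set.ncard_le_ncard h1 (Finset.finite_toSet _)).trans (le_of_eq ?_)
    rw [Set.ncard_coe_finset, Finset.card_filter]
    exact Finset.sum_congr rfl fun e _ => by simp [Set.indicator_apply]
  · let q (e : FunIdx κ (reps p₁ a n) × U × U) : ℝ := concatProb μ h e.1.1 e.2.1 e.2.2
    have hq : ∀ e, 0 ≤ q e := fun e => concatProb_nonneg _ _ _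
    have h1 : ∫⁻ ω, ((∑ e ∈ T, (A e).indicator 1 ω : ℕ) : ℝ≥0∞) ∂(Measure.pi fun _ => μ) =
        ENNReal.ofReal (∑ e ∈ T, q e) := by
      have h2 : ∀ ω, ((∑ e ∈ T, (A e).indicator 1 ω : ℕ) : ℝ≥0∞) =
          ∑ e ∈ T, (A e).indicator 1 ω := fun ω => by
        rw [Nat.cast_sum]
        exact Finset.sum_congr rfl fun e _ => by
          simp only [Set.indicator_apply]
          split_ifs <;> simp
      simp only [h2]
      rw [lintegral_finsetSum _ fun e _ => measurable_one.indicator (hA e),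
        ENNReal.ofReal_sum_of_nonneg fun e _ => hq e]
      refine Finset.sum_congr rfl fun e _ => ?_
      rw [lintegral_indicator_one (hA e), ← ENNReal.ofReal_toReal (measure_ne_top _ (A e))]
      congr 1
      exact real_hashVal hm e.1 (Sum.inl e.2.1) (Sum.inr e.2.2)
    rw [h1]
    refine ENNReal.ofReal_le_ofReal ?_
    -- `ρ` charges a collision to its point of `R` and `σ` to its point of `S`, in each case only if
    -- that point is active.
    let ρ (e : FunIdx κ (reps p₁ a n) × U × U) : ℝ :=
      if (e.1.1 : ℕ) = lvl (Sum.inl e.2.1) then q e else 0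
    let σ (e : FunIdx κ (reps p₁ a n) × U × U) : ℝ :=
      if (e.1.1 : ℕ) = lvl (Sum.inr e.2.2) then q e else 0
    have h2 : ∑ e ∈ T, q e ≤ ∑ e ∈ Finset.univ ×ˢ R ×ˢ S, (ρ e + σ e) := by
      rw [Finset.sum_filter]
      refine Finset.sum_le_sum fun e _ => ?_
      have := hq e
      simp only [ρ, σ]
      split_ifs with h3 h4 h5 h4 h5 <;> first | linarith | simp_all
    have hR : ∑ e ∈ Finset.univ ×ˢ R ×ˢ S, ρ e ≤
        ∑ u ∈ R, (a + 3) * Real.log n * expectedCost μ h p₁ R S (lvl (Sum.inl u)) (Sum.inl u) := by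
      rw [Finset.sum_product_right, Finset.sum_product]
      refine Finset.sum_le_sum fun u _ => ?_
      have h3 : ∀ v ∈ S, ∑ k, ρ (k, u, v) ≤
          reps p₁ a n (lvl (Sum.inl u)) * concatProb μ h (lvl (Sum.inl u)) u v := fun v _ =>
        sum_active_le (concatProb_nonneg _ _ _)
          (fun k hk => by simp only [ρ, q, if_pos hk]; rw [hk])
          (fun k hk => by simp only [ρ, if_neg hk])
      refine (Finset.sum_le_sum h3).trans ?_
      rw [← Finset.mul_sum, expectedCost]
      have h4 : 0 ≤ ∑ v ∈ S, concatProb μ h (lvl (Sum.inl u)) u v :=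
        Finset.sum_nonneg fun v _ => concatProb_nonneg _ _ _
      have h5 := mul_le_mul_of_nonneg_right (reps_le ha hp₁ hp₁' hn (lvl (Sum.inl u))) h4
      refine h5.trans ?_
      have h6 : 0 ≤ (a + 3) * (p₁ ^ lvl (Sum.inl u))⁻¹ * Real.log n := by positivity
      nlinarith
    have hS : ∑ e ∈ Finset.univ ×ˢ R ×ˢ S, σ e ≤
        ∑ v ∈ S, (a + 3) * Real.log n * expectedCost μ h p₁ R S (lvl (Sum.inr v)) (Sum.inr v) := by
      rw [Finset.sum_product_right, Finset.sum_product_right]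
      refine Finset.sum_le_sum fun v _ => ?_
      have h3 : ∀ u ∈ R, ∑ k, σ (k, u, v) ≤
          reps p₁ a n (lvl (Sum.inr v)) * concatProb μ h (lvl (Sum.inr v)) u v := fun u _ =>
        sum_active_le (concatProb_nonneg _ _ _)
          (fun k hk => by simp only [σ, q, if_pos hk]; rw [hk])
          (fun k hk => by simp only [σ, if_neg hk])
      refine (Finset.sum_le_sum h3).trans ?_
      rw [← Finset.mul_sum, expectedCost]
      have h4 : 0 ≤ ∑ u ∈ R, concatProb μ h (lvl (Sum.inr v)) u v :=
        Finset.sum_nonneg fun v _ => concatProb_nonneg _ _ _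
      have h5 := mul_le_mul_of_nonneg_right (reps_le ha hp₁ hp₁' hn (lvl (Sum.inr v))) h4
      refine h5.trans ?_
      have h6 : 0 ≤ (a + 3) * (p₁ ^ lvl (Sum.inr v))⁻¹ * Real.log n := by positivity
      nlinarith
    rw [Finset.sum_disjSum, mul_add, Finset.mul_sum, Finset.mul_sum]
    refine h2.trans ?_
    rw [Finset.sum_add_distrib]
    exact add_le_add hR hS

end JoinWork

/-! ### Dense points and the numbers of near and medium pairs -/

section Density

variable {U : Type*} {d : U → U → ℝ} {r c p₁ p₂ : ℝ} {R S : Finset U} {κ : ℕ}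

open Classical in
theorem nearCount_inl (x : U) :
    nearCount d r R S (Sum.inl x) = (S.filter fun y => d x y ≤ r).card := by
  rw [nearCount, ← Set.ncard_coe_finset]
  simp

open Classical in
theorem nearCount_inr (y : U) :
    nearCount d r R S (Sum.inr y) = (R.filter fun x => d x y ≤ r).card := by
  rw [nearCount, ← Set.ncard_coe_finset]
  simp

open Classical in
/-- The number of points of the other relation at distance in `(r, cr]`. -/
noncomputable def cnearCount (d : U → U → ℝ) (r c : ℝ) (R S : Finset U) : U ⊕ U → ℕ
  | Sum.inl x => (S.filter fun y => r < d x y ∧ d x y ≤ c * r).card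
  | Sum.inr y => (R.filter fun x => r < d x y ∧ d x y ≤ c * r).card

theorem nearCount_lt {z : U ⊕ U} (hz : z ∈ R.disjSum S) :
    nearCount d r R S z < R.card + S.card := by
  classical
  rcases z with x | y
  · rw [nearCount_inl]
    have h1 := Finset.card_pos.2 ⟨x, Finset.inl_mem_disjSum.1 hz⟩
    have h2 := Finset.card_filter_le S fun y => d x y ≤ r
    omega
  · rw [nearCount_inr]
    have h1 := Finset.card_pos.2 ⟨y, Finset.inr_mem_disjSum.1 hz⟩
    have h2 := Finset.card_filter_le R fun x => d x y ≤ r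
    omega

/-- If `z` is not `κ`-dense, let `j` be least with `n * p₂ ^ j ≤ N_r(z)`. Then `j ≠ 0`, because `z`
itself is counted in `n` and so `N_r(z) < n`; hence `z` is `(j - 1)`-dense. -/
theorem exists_isDense {z : U ⊕ U} (hz : z ∈ R.disjSum S) :
    ∃ i ≤ κ, IsDense d r p₂ κ R S i z := by
  classical
  by_cases hκ : (nearCount d r R S z : ℝ) < ((R.card + S.card : ℕ) : ℝ) * p₂ ^ κ
  · exact ⟨κ, le_rfl, Or.inr ⟨rfl, hκ⟩⟩
  · have hex : ∃ j, ((R.card + S.card : ℕ) : ℝ) * p₂ ^ j ≤ nearCount d r R S z :=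
      ⟨κ, not_lt.1 hκ⟩
    have h1 := Nat.find_spec hex
    have h2 := Nat.find_min' hex (not_lt.1 hκ)
    have h3 : Nat.find hex ≠ 0 := by
      intro h0
      rw [h0, pow_zero, mul_one, Nat.cast_le] at h1
      exact absurd h1 (not_le.2 (nearCount_lt hz))
    have h4 := Nat.find_min hex (m := Nat.find hex - 1) (by omega)
    refine ⟨Nat.find hex - 1, by omega, Or.inl ⟨by omega, ?_, not_le.1 h4⟩⟩
    rwa [Nat.sub_add_cancel (by omega)]

open Classical in
-- A near pair is counted at most once from each of its two ends.
theorem sum_isDense_le (i : ℕ) : ∑ z ∈ R.disjSum S,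
    (if IsDense d r p₂ κ R S i z then nearCount d r R S z else 0) ≤
      2 * outNear d r p₂ κ R S i := by
  have hfin : {g : U × U | g.1 ∈ R ∧ g.2 ∈ S ∧ d g.1 g.2 ≤ r ∧
      (IsDense d r p₂ κ R S i (Sum.inl g.1) ∨ IsDense d r p₂ κ R S i (Sum.inr g.2))}.Finite :=
    (R ×ˢ S).finite_toSet.subset fun g hg => by simpa using ⟨hg.1, hg.2.1⟩
  have h1 : ∑ x ∈ R, (if IsDense d r p₂ κ R S i (Sum.inl x) then
      nearCount d r R S (Sum.inl x) else 0) ≤ outNear d r p₂ κ R S i := by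
    have h2 : ∑ x ∈ R, (if IsDense d r p₂ κ R S i (Sum.inl x) then
        nearCount d r R S (Sum.inl x) else 0) = ((R ×ˢ S).filter fun g =>
          IsDense d r p₂ κ R S i (Sum.inl g.1) ∧ d g.1 g.2 ≤ r).card := by
      rw [Finset.card_filter, Finset.sum_product]
      refine Finset.sum_congr rfl fun x _ => ?_
      rw [nearCount_inl, Finset.card_filter]
      split_ifs with h <;> simp [h]
    rw [h2, outNear, ← Set.ncard_coe_finset]
    refine Set.ncard_le_ncard (fun g hg => ?_) hfin
    simp only [Finset.coe_filter, Finset.mem_product, Set.mem_ofPred_eq] at hg ⊢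
    exact ⟨hg.1.1, hg.1.2, hg.2.2, Or.inl hg.2.1⟩
  have h2 : ∑ y ∈ S, (if IsDense d r p₂ κ R S i (Sum.inr y) then
      nearCount d r R S (Sum.inr y) else 0) ≤ outNear d r p₂ κ R S i := by
    have h2 : ∑ y ∈ S, (if IsDense d r p₂ κ R S i (Sum.inr y) then
        nearCount d r R S (Sum.inr y) else 0) = ((R ×ˢ S).filter fun g =>
          IsDense d r p₂ κ R S i (Sum.inr g.2) ∧ d g.1 g.2 ≤ r).card := by
      rw [Finset.card_filter, Finset.sum_product_right]
      refine Finset.sum_congr rfl fun y _ => ?_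
      rw [nearCount_inr, Finset.card_filter]
      split_ifs with h <;> simp [h]
    rw [h2, outNear, ← Set.ncard_coe_finset]
    refine Set.ncard_le_ncard (fun g hg => ?_) hfin
    simp only [Finset.coe_filter, Finset.mem_product, Set.mem_ofPred_eq] at hg ⊢
    exact ⟨hg.1.1, hg.1.2, hg.2.2, Or.inr hg.2.1⟩
  rw [Finset.sum_disjSum]
  omega

theorem sum_cnearCount : ∑ z ∈ R.disjSum S, cnearCount d r c R S z = 2 * outCNear d r c R S := by
  classical
  have h0 : outCNear d r c R S =
      ((R ×ˢ S).filter fun g => r < d g.1 g.2 ∧ d g.1 g.2 ≤ c * r).card := by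
    rw [outCNear, ← Set.ncard_coe_finset]
    congr 1
    ext g
    simp [and_assoc]
  have h1 : ∑ x ∈ R, cnearCount d r c R S (Sum.inl x) = outCNear d r c R S := by
    rw [h0, Finset.card_filter, Finset.sum_product]
    exact Finset.sum_congr rfl fun x _ => by rw [cnearCount, Finset.card_filter]
  have h2 : ∑ y ∈ S, cnearCount d r c R S (Sum.inr y) = outCNear d r c R S := by
    rw [h0, Finset.card_filter, Finset.sum_product_right]
    exact Finset.sum_congr rfl fun y _ => by rw [cnearCount, Finset.card_filter]
  rw [Finset.sum_disjSum, h1, h2]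
  ring

open Classical in
-- The three ranges of distance are estimated separately by `1`, `p₁ ^ i` and `p₂ ^ i`; the last
-- bound is granted to all of `Y`.
theorem sum_pow_le {Y : Finset U} {δ q : U → ℝ} (hp₂ : 0 < p₂) (h0 : ∀ y, 0 ≤ q y)
    (h1 : ∀ y, q y ≤ 1) (h2 : ∀ y, r < δ y → δ y ≤ c * r → q y ≤ p₁)
    (h3 : ∀ y, c * r < δ y → q y ≤ p₂) (hp₁ : 0 < p₁) (i : ℕ) :
    ∑ y ∈ Y, q y ^ i ≤ (Y.filter fun y => δ y ≤ r).card +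
      (Y.filter fun y => r < δ y ∧ δ y ≤ c * r).card * p₁ ^ i + Y.card * p₂ ^ i := by
  have key : ∀ y ∈ Y, q y ^ i ≤ (if δ y ≤ r then 1 else 0) +
      (if r < δ y ∧ δ y ≤ c * r then 1 else 0) * p₁ ^ i + p₂ ^ i := by
    intro y _
    have e1 : 0 ≤ p₁ ^ i := by positivity
    have e2 : 0 ≤ p₂ ^ i := by positivity
    by_cases c1 : δ y ≤ r
    · have := pow_le_one₀ (n := i) (h0 y) (h1 y)
      rw [if_pos c1, if_neg (by rintro ⟨h, -⟩; linarith)]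
      linarith
    · rw [not_le] at c1
      by_cases c2 : δ y ≤ c * r
      · have := pow_le_pow_left₀ (h0 y) (h2 y c1 c2) i
        rw [if_neg (not_le.2 c1), if_pos ⟨c1, c2⟩]
        linarith
      · have := pow_le_pow_left₀ (h0 y) (h3 y (not_le.1 c2)) i
        rw [if_neg (not_le.2 c1), if_neg (fun h => c2 h.2)]
        linarith
  refine (Finset.sum_le_sum key).trans (le_of_eq ?_)
  rw [Finset.sum_add_distrib, Finset.sum_add_distrib, ← Finset.sum_mul]
  simp only [Finset.card_filter, Finset.sum_const, nsmul_eq_mul, Nat.cast_sum, Nat.cast_ite,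
    Nat.cast_one, Nat.cast_zero]

end Density

/-! ### The expected cost of a point at its level -/

section Cost

variable {U Ω B : Type*} [MeasurableSpace Ω] {μ : Measure Ω} [IsProbabilityMeasure μ]
  {h : Ω → U → B} {κ n : ℕ} {d : U → U → ℝ} {r c p₁ p₂ : ℝ} {R S : Finset U} {lvl : U ⊕ U → ℕ}

/-- For points at distance in `(r, cr]` the factor `(p₁ ^ i)⁻¹` cancels the collision probability,
so each of them costs at most `1` at every level. -/
theorem expectedCost_le (H : IsLSH d μ h r c p₁ p₂) (hp₁ : 0 < p₁) (hp₂ : 0 < p₂) (i : ℕ)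
    (z : U ⊕ U) : expectedCost μ h p₁ R S i z ≤
      (p₁ ^ i)⁻¹ * (1 + nearCount d r R S z + ((R.card + S.card : ℕ) : ℝ) * p₂ ^ i) +
        cnearCount d r c R S z := by
  classical
  have h0 : 0 < (p₁ ^ i)⁻¹ := by positivity
  have h2 : 0 ≤ p₂ ^ i := by positivity
  have key : ∀ (N C : ℕ) (Y : Finset U) (s : ℝ), Y.card ≤ R.card + S.card →
      s ≤ N + C * p₁ ^ i + Y.card * p₂ ^ i → (p₁ ^ i)⁻¹ * (1 + s) ≤
        (p₁ ^ i)⁻¹ * (1 + N + ((R.card + S.card : ℕ) : ℝ) * p₂ ^ i) + C := by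
    intro N C Y s hY hs
    have h3 : (Y.card : ℝ) * p₂ ^ i ≤ ((R.card + S.card : ℕ) : ℝ) * p₂ ^ i :=
      mul_le_mul_of_nonneg_right (by exact_mod_cast hY) h2
    have h4 : (C : ℝ) = (p₁ ^ i)⁻¹ * (C * p₁ ^ i) := by field_simp
    rw [h4, ← mul_add]
    exact mul_le_mul_of_nonneg_left (by linarith) h0.le
  rcases z with x | y
  · rw [expectedCost, nearCount_inl, cnearCount]
    refine key _ _ S _ (by omega) ?_
    simp only [concatProb_eq]
    exact sum_pow_le (δ := fun y => d x y) hp₂ (fun y => measureReal_nonneg)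
      (fun y => measureReal_le_one) (fun y => H.cnear x y) (fun y => H.far x y) hp₁ i
  · rw [expectedCost, nearCount_inr, cnearCount]
    refine key _ _ R _ (by omega) ?_
    simp only [concatProb_eq]
    exact sum_pow_le (δ := fun x => d x y) hp₂ (fun x => measureReal_nonneg)
      (fun x => measureReal_le_one) (fun x => H.cnear x y) (fun x => H.far x y) hp₁ i

open Classical in
/-- The expected cost of a point at its best level. -/
theorem expectedCost_lvl_le (H : IsLSH d μ h r c p₁ p₂) (hp₂ : 0 < p₂) (hp : p₂ < p₁)
    (hp₁' : p₁ < 1) (hκ : 1 ≤ κ) (hlvl : IsBestLevel μ h p₁ κ R S lvl) {z : U ⊕ U}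
    (hz : z ∈ R.disjSum S) : expectedCost μ h p₁ R S (lvl z) z ≤
      (1 + p₂⁻¹) * p₁⁻¹ * ∑ i ∈ Finset.range (κ + 1), (p₁ ^ i)⁻¹ *
        ((if IsDense d r p₂ κ R S i z then nearCount d r R S z else 0 : ℕ) : ℝ) +
      cnearCount d r c R S z +
        (p₁ ^ κ)⁻¹ * (1 + ((R.card + S.card : ℕ) : ℝ) * p₂ ^ κ) := by
  have hp₁ : 0 < p₁ := hp₂.trans hp
  obtain ⟨i, hi, hd⟩ := exists_isDense (κ := κ) (d := d) (r := r) (p₂ := p₂) hz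
  set N : ℝ := ((nearCount d r R S z : ℕ) : ℝ) with hN
  set n' : ℝ := ((R.card + S.card : ℕ) : ℝ) with hn
  have hN0 : 0 ≤ N := Nat.cast_nonneg _
  have hn0 : 0 ≤ n' := Nat.cast_nonneg _
  have hD : 1 ≤ p₂⁻¹ := (one_le_inv₀ hp₂).2 (hp.trans hp₁').le
  have hp₁i : 1 ≤ p₁⁻¹ := (one_le_inv₀ hp₁).2 hp₁'.le
  have hmono : ∀ j ≤ κ, (p₁ ^ j)⁻¹ ≤ (p₁ ^ κ)⁻¹ := fun j hj =>
    inv_anti₀ (by positivity) (pow_le_pow_of_le_one hp₁.le hp₁'.le hj)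
  have hsum : (p₁ ^ i)⁻¹ * N ≤ ∑ i ∈ Finset.range (κ + 1), (p₁ ^ i)⁻¹ *
        ((if IsDense d r p₂ κ R S i z then nearCount d r R S z else 0 : ℕ) : ℝ) := by
    refine le_trans (le_of_eq ?_) (Finset.single_le_sum (f := fun i => (p₁ ^ i)⁻¹ *
        ((if IsDense d r p₂ κ R S i z then nearCount d r R S z else 0 : ℕ) : ℝ))
      (fun j _ => by positivity) (Finset.mem_range.2 (Nat.lt_succ_of_le hi)))
    simp only [if_pos hd, hN]
  have hcost : ∀ j, 1 ≤ j → j ≤ κ → expectedCost μ h p₁ R S (lvl z) z ≤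
      (p₁ ^ j)⁻¹ * (1 + N + n' * p₂ ^ j) + cnearCount d r c R S z := fun j h1 h2 =>
    ((hlvl z hz).2.2 j h1 h2).trans (expectedCost_le H hp₁ hp₂ j z)
  have hκn : 0 ≤ (p₁ ^ κ)⁻¹ * (n' * p₂ ^ κ) := by positivity
  have hmain : (1 + p₂⁻¹) * p₁⁻¹ * ((p₁ ^ i)⁻¹ * N) ≤ (1 + p₂⁻¹) * p₁⁻¹ *
      ∑ i ∈ Finset.range (κ + 1), (p₁ ^ i)⁻¹ *
        ((if IsDense d r p₂ κ R S i z then nearCount d r R S z else 0 : ℕ) : ℝ) :=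
    mul_le_mul_of_nonneg_left hsum (by positivity)
  have hX : 0 ≤ (p₁ ^ i)⁻¹ * N := by positivity
  rcases hd with ⟨hiκ, hlo, -⟩ | ⟨rfl, hlo⟩
  -- Density bounds the expected number of colliding far points by the number of near points.
  · have hlo' : n' * p₂ ^ i ≤ p₂⁻¹ * N := by
      rw [← div_eq_inv_mul, le_div_iff₀ hp₂, mul_assoc, ← pow_succ]
      exact hlo
    -- There is no level `0`, so a `0`-dense point is compared with level `1`. This is the source of
    -- the factor `p₁⁻¹`.
    rcases Nat.eq_zero_or_pos i with rfl | hi0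
    · have h1 := hcost 1 le_rfl hκ
      have h2 := hmono 1 hκ
      rw [zero_add, pow_one] at hlo
      simp only [pow_one, pow_zero, inv_one, one_mul] at h1 h2 hmain
      have h3 : p₁⁻¹ * (n' * p₂) ≤ p₁⁻¹ * N := mul_le_mul_of_nonneg_left hlo (by positivity)
      have h4 : p₁⁻¹ * N ≤ p₂⁻¹ * (p₁⁻¹ * N) := le_mul_of_one_le_left (by positivity) hD
      linarith
    · have h1 := hcost i hi0 hiκ.le
      have h2 := hmono i hiκ.le
      have h3 : (p₁ ^ i)⁻¹ * (n' * p₂ ^ i) ≤ (p₁ ^ i)⁻¹ * (p₂⁻¹ * N) :=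
        mul_le_mul_of_nonneg_left hlo' (by positivity)
      have h4 : (1 + p₂⁻¹) * ((p₁ ^ i)⁻¹ * N) ≤ p₁⁻¹ * ((1 + p₂⁻¹) * ((p₁ ^ i)⁻¹ * N)) :=
        le_mul_of_one_le_left (by positivity) hp₁i
      linarith
  -- For `κ`-dense points the near points do not control the far ones; their cost is the last
  -- summand of the bound.
  · have h1 := hcost i hκ le_rfl
    have h4 : (p₁ ^ i)⁻¹ * N ≤ ((1 + p₂⁻¹) * p₁⁻¹) * ((p₁ ^ i)⁻¹ * N) :=
      le_mul_of_one_le_left hX (by nlinarith)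
    linarith

/-- The total expected cost. -/
theorem sum_expectedCost_le (H : IsLSH d μ h r c p₁ p₂) (hp₂ : 0 < p₂) (hp : p₂ < p₁)
    (hp₁' : p₁ < 1) (hκ : 1 ≤ κ) (hlvl : IsBestLevel μ h p₁ κ R S lvl)
    (hcard : R.card + S.card = n) :
    ∑ z ∈ R.disjSum S, expectedCost μ h p₁ R S (lvl z) z ≤
      2 * ((1 + p₂⁻¹) * p₁⁻¹) *
        ∑ i ∈ Finset.range (κ + 1), (p₁ ^ i)⁻¹ * (outNear d r p₂ κ R S i : ℝ) +
      2 * outCNear d r c R S + n * ((p₁ ^ κ)⁻¹ * (1 + n * p₂ ^ κ)) := by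
  classical
  have hp₁ : 0 < p₁ := hp₂.trans hp
  refine (Finset.sum_le_sum fun z hz => expectedCost_lvl_le H hp₂ hp hp₁' hκ hlvl hz).trans ?_
  rw [Finset.sum_add_distrib, Finset.sum_add_distrib, ← Finset.mul_sum, Finset.sum_comm, hcard]
  refine add_le_add (add_le_add ?_ ?_) ?_
  · have hD : 0 ≤ (1 + p₂⁻¹) * p₁⁻¹ := by positivity
    generalize (1 + p₂⁻¹) * p₁⁻¹ = D at hD ⊢
    rw [mul_comm (2 : ℝ) D, mul_assoc]
    refine mul_le_mul_of_nonneg_left ?_ hD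
    rw [Finset.mul_sum]
    refine Finset.sum_le_sum fun i _ => ?_
    rw [← Finset.mul_sum, mul_left_comm]
    refine mul_le_mul_of_nonneg_left ?_ (by positivity)
    exact_mod_cast sum_isDense_le (d := d) (r := r) (p₂ := p₂) (R := R) (S := S) (κ := κ) i
  · have := sum_cnearCount (d := d) (r := r) (c := c) (R := R) (S := S)
    exact_mod_cast this.le
  · rw [Finset.sum_const, Finset.card_disjSum, hcard, nsmul_eq_mul]

end Cost

/-! ### Choice of the parameters -/

section Parameters

variable {p₁ p₂ a : ℝ} {n p : ℕ}

theorem rho_pos (hp₁ : 0 < p₁) (hp₁' : p₁ < 1) (hp₂ : 0 < p₂) (hp₂' : p₂ < 1) :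
    0 < rho p₁ p₂ :=
  div_pos_of_neg_of_neg (Real.log_neg hp₁ hp₁') (Real.log_neg hp₂ hp₂')

theorem inv_pow_eq_exp (hp₁ : 0 < p₁) (k : ℕ) : (p₁ ^ k)⁻¹ = Real.exp (k * Real.log p₁⁻¹) := by
  rw [← inv_pow, ← Real.rpow_natCast, Real.rpow_def_of_pos (by positivity), mul_comm]

/-- Up to rounding, `p₁ ^ (-κ)` equals `p ^ (ρ / (1 + ρ))`, which is `p * p ^ (-1 / (1 + ρ))`. As
`p₂ = p₁ ^ (1 / ρ)`, the power `p₂ ^ κ` is then `p ^ (-1 / (1 + ρ))`. Rounding up costs a factor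
`p₁⁻¹` in the first bound and nothing in the second. -/
theorem kappa_bounds (hp₂ : 0 < p₂) (hp₂₁ : p₂ < p₁) (hp₁' : p₁ < 1) (hp : 2 ≤ p) :
    1 ≤ kappa p₁ p₂ p ∧
      (p₁ ^ kappa p₁ p₂ p)⁻¹ ≤ p₁⁻¹ * (p * (p : ℝ) ^ (-(1 / (1 + rho p₁ p₂)))) ∧
      p₂ ^ kappa p₁ p₂ p ≤ (p : ℝ) ^ (-(1 / (1 + rho p₁ p₂))) ∧
      (kappa p₁ p₂ p : ℝ) ≤ (Real.log p₁⁻¹)⁻¹ * Real.log p + 1 := by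
  have hp₁ : 0 < p₁ := hp₂.trans hp₂₁
  have hρ := rho_pos hp₁ hp₁' hp₂ (hp₂₁.trans hp₁')
  have hL : 0 < Real.log p₁⁻¹ := Real.log_pos ((one_lt_inv₀ hp₁).2 hp₁')
  have hp0 : (0 : ℝ) < p := by positivity
  have hlp : 0 < Real.log p := Real.log_pos (by exact_mod_cast hp)
  have hρL : Real.log p₂⁻¹ = Real.log p₁⁻¹ / rho p₁ p₂ := by
    rw [rho, Real.log_inv, Real.log_inv]
    have h1 := (Real.log_neg hp₁ hp₁').ne
    have h2 := (Real.log_neg hp₂ (hp₂₁.trans hp₁')).ne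
    field_simp
  set ρ := rho p₁ p₂
  set κ := kappa p₁ p₂ p with hκ
  have hx : 0 < ρ / (1 + ρ) * Real.logb p₁⁻¹ p := by
    rw [Real.logb]
    positivity
  have h1 : ρ / (1 + ρ) * Real.logb p₁⁻¹ p ≤ κ := Nat.le_ceil _
  have h2 : (κ : ℝ) < ρ / (1 + ρ) * Real.logb p₁⁻¹ p + 1 := Nat.ceil_lt_add_one hx.le
  have h3 : ρ / (1 + ρ) * Real.logb p₁⁻¹ p * Real.log p₁⁻¹ = ρ / (1 + ρ) * Real.log p := by
    rw [Real.logb, mul_assoc, div_mul_cancel₀ _ hL.ne']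
  have h4 : ρ / (1 + ρ) * Real.log p ≤ κ * Real.log p₁⁻¹ := by
    rw [← h3]
    exact mul_le_mul_of_nonneg_right h1 hL.le
  refine ⟨Nat.ceil_pos.2 hx, ?_, ?_, ?_⟩
  · rw [inv_pow_eq_exp hp₁]
    have h5 : (κ : ℝ) * Real.log p₁⁻¹ ≤ ρ / (1 + ρ) * Real.log p + Real.log p₁⁻¹ := by
      have := mul_le_mul_of_nonneg_right h2.le hL.le
      rwa [add_mul, h3, one_mul] at this
    refine (Real.exp_le_exp.2 h5).trans (le_of_eq ?_)
    rw [Real.exp_add, Real.exp_log (by positivity), mul_comm]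
    congr 1
    conv_rhs => rw [← Real.rpow_one (p : ℝ), Real.rpow_one, ← Real.rpow_one_add' hp0.le (by
      rw [← sub_eq_add_neg, one_sub_div (by positivity)]
      have : (1 + ρ - 1) / (1 + ρ) = ρ / (1 + ρ) := by ring
      rw [this]
      positivity)]
    rw [Real.rpow_def_of_pos hp0, mul_comm (Real.log p)]
    congr 2
    field_simp
    ring
  · rw [← inv_le_inv₀ (by positivity) (by positivity), inv_pow_eq_exp hp₂, hρL, Real.rpow_neg hp0.le,
      inv_inv, Real.rpow_def_of_pos hp0, Real.exp_le_exp]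
    have := div_le_div_of_nonneg_right h4 hρ.le
    refine le_trans (le_of_eq ?_) (this.trans (le_of_eq ?_))
    · field_simp
    · ring
  · refine h2.le.trans (add_le_add_left ?_ 1)
    rw [Real.logb, ← mul_div_assoc, div_eq_inv_mul]
    refine mul_le_mul_of_nonneg_left ?_ (by positivity)
    refine mul_le_of_le_one_left hlp.le ?_
    rw [div_le_one (by positivity)]
    linarith

theorem card_funIdx_le (ha : 0 < a) (hp₁ : 0 < p₁) (hp₁' : p₁ < 1) (hn : 1 ≤ Real.log n)
    (κ : ℕ) : (Fintype.card (FunIdx κ (reps p₁ a n)) : ℝ) ≤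
      (κ + 1) * ((a + 3) * (p₁ ^ κ)⁻¹ * Real.log n) := by
  rw [Fintype.card_sigma]
  push_cast
  simp only [Fintype.card_fin]
  refine (Finset.sum_le_card_nsmul Finset.univ _ ((a + 3) * (p₁ ^ κ)⁻¹ * Real.log n)
    fun i _ => ?_).trans (le_of_eq (by simp))
  refine (reps_le ha hp₁ hp₁' hn i).trans ?_
  have h1 : (p₁ ^ (i : ℕ))⁻¹ ≤ (p₁ ^ κ)⁻¹ := inv_anti₀ (by positivity)
    (pow_le_pow_of_le_one hp₁.le hp₁'.le (Nat.le_of_lt_succ i.2))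
  gcongr

theorem card_baseIdx_le (κ : ℕ) (t : ℕ → ℕ) :
    Fintype.card (BaseIdx κ t) ≤ Fintype.card (FunIdx κ t) * κ := by
  rw [Fintype.card_sigma]
  refine (Finset.sum_le_card_nsmul _ _ κ fun k _ => ?_).trans (le_of_eq ?_)
  · rw [Fintype.card_fin]
    exact Nat.le_of_lt_succ k.1.2
  · simp

/-- The degree of the trees and the block length. -/
theorem exists_degree {ε : ℝ} (hε₀ : 0 < ε) (hε₁ : ε < 1) {J : ℕ} (hJ : 2 ≤ J * (1 - ε))
    (hp : 2 ≤ p) (hpn : (p : ℝ) < (n : ℝ) ^ ε) (m₀ : ℕ) :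
    ∃ g E M : ℕ, 0 < g ∧ p ≤ g ^ J ∧ 0 < M ∧ M = E * g ∧ 2 * (g * g) ≤ M ∧ m₀ ≤ M ∧
      ((g ^ J : ℕ) : ℝ) ≤ 2 ^ J * p ∧ (M : ℝ) ≤ m₀ + 12 * (n / p) ∧ (g : ℝ) ≤ 4 * (n / p) := by
  have hp1 : (1 : ℝ) ≤ p := by exact_mod_cast (by omega : 1 ≤ p)
  have hp0 : (0 : ℝ) < p := by linarith
  have hJ0 : 0 < J := by
    rcases Nat.eq_zero_or_pos J with rfl | h
    · norm_num at hJ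
    · exact h
  have hJR : (0 : ℝ) < J := by exact_mod_cast hJ0
  have hn0 : (1 : ℝ) ≤ n := by
    rcases Nat.eq_zero_or_pos n with rfl | h
    · rw [Nat.cast_zero, Real.zero_rpow hε₀.ne'] at hpn
      linarith
    · exact_mod_cast h
  set b : ℝ := (p : ℝ) ^ (J : ℝ)⁻¹ with hb
  have hbJ : b ^ J = p := Real.rpow_inv_natCast_pow hp0.le hJ0.ne'
  have hb1 : 1 ≤ b := Real.one_le_rpow hp1 (by positivity)
  set g := ⌈b⌉₊ with hg
  have hbg : b ≤ g := Nat.le_ceil b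
  have hgb : (g : ℝ) ≤ 2 * b := by
    have := (Nat.ceil_lt_add_one (by linarith : 0 ≤ b)).le
    linarith
  have hg1 : (1 : ℝ) ≤ g := hb1.trans hbg
  have hg0 : 0 < g := by exact_mod_cast (by linarith : (0 : ℝ) < g)
  -- The exponent of `n` works out because `2 / J ≤ 1 - ε` and `ε * (2 - ε) ≤ 1`.
  have hb2 : b ^ 2 * p ≤ n := by
    have h1 : 2 / (J : ℝ) ≤ 1 - ε := by
      rw [div_le_iff₀ hJR]
      linarith
    have h2 : b ^ 2 * p = (p : ℝ) ^ (2 / (J : ℝ) + 1) := by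
      rw [Real.rpow_add hp0, Real.rpow_one, hb, ← Real.rpow_natCast, ← Real.rpow_mul hp0.le]
      congr 2
      push_cast
      field_simp
    rw [h2]
    calc (p : ℝ) ^ (2 / (J : ℝ) + 1) ≤ ((n : ℝ) ^ ε) ^ (2 / (J : ℝ) + 1) :=
          Real.rpow_le_rpow hp0.le hpn.le (by positivity)
      _ = (n : ℝ) ^ (ε * (2 / (J : ℝ) + 1)) := (Real.rpow_mul (by linarith) _ _).symm
      _ ≤ (n : ℝ) ^ (1 : ℝ) := Real.rpow_le_rpow_of_exponent_le hn0 (by nlinarith)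
      _ = n := Real.rpow_one _
  have hg2 : (g : ℝ) ^ 2 ≤ 4 * (n / p) := by
    have h1 : b ^ 2 ≤ n / p := (le_div_iff₀ hp0).2 hb2
    nlinarith
  have hgg : (g : ℝ) ≤ (g : ℝ) ^ 2 := by nlinarith
  -- The length is a multiple of `g`: the first two summands make it at least `m₀` and the third one
  -- at least `2 * g ^ 2`.
  refine ⟨g, m₀ / g + 1 + 2 * g, (m₀ / g + 1 + 2 * g) * g, hg0, ?_, by positivity, rfl, ?_, ?_,
    ?_, ?_, by linarith⟩
  · have : (p : ℝ) ≤ (g : ℝ) ^ J := hbJ ▸ pow_le_pow_left₀ (by linarith) hbg J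
    exact_mod_cast this
  · rw [← mul_assoc]
    exact Nat.mul_le_mul_right g (Nat.le_add_left _ _)
  · have := Nat.lt_div_mul_add hg0 (a := m₀)
    rw [add_mul, add_mul, one_mul]
    omega
  · push_cast
    refine (pow_le_pow_left₀ (by linarith) hgb J).trans (le_of_eq ?_)
    rw [mul_pow, hbJ]
  · have h1 : (((m₀ / g : ℕ) : ℝ)) * g ≤ m₀ := by exact_mod_cast Nat.div_mul_le_self m₀ g
    push_cast
    nlinarith

theorem three_le_of_lt_rpow {ε : ℝ} (hε₀ : 0 < ε) (hε₁ : ε < 1) (hp : 2 ≤ p)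
    (hpn : (p : ℝ) < (n : ℝ) ^ ε) : 3 ≤ n ∧ p ≤ n := by
  have hn1 : (1 : ℝ) ≤ n := by
    rcases Nat.eq_zero_or_pos n with rfl | h
    · rw [Nat.cast_zero, Real.zero_rpow hε₀.ne'] at hpn
      have : (0 : ℝ) ≤ p := Nat.cast_nonneg p
      linarith
    · exact_mod_cast h
  have h1 : (p : ℝ) < n := by
    refine hpn.trans_le ?_
    calc (n : ℝ) ^ ε ≤ (n : ℝ) ^ (1 : ℝ) := Real.rpow_le_rpow_of_exponent_le hn1 hε₁.le
      _ = n := Real.rpow_one _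
  have h2 : p < n := by exact_mod_cast h1
  exact ⟨by omega, h2.le⟩

theorem one_le_log (hn : 3 ≤ n) : 1 ≤ Real.log n := by
  rw [Real.le_log_iff_exp_le (by positivity)]
  have h1 := Real.exp_one_lt_d9
  have h2 : (3 : ℝ) ≤ n := by exact_mod_cast hn
  linarith

end Parameters

/-! ### Numerical bounds on block length, word size and load -/

section Bounds

variable {p₁ p₂ a ε : ℝ} {n p : ℕ}

theorem one_le_baseline (hs : 0 < 1 + rho p₁ p₂) (hρ : 0 < rho p₁ p₂) (hp : 1 ≤ p) (hpn : p ≤ n) :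
    1 ≤ (n : ℝ) / (p : ℝ) ^ (1 / (1 + rho p₁ p₂)) ∧
      (n : ℝ) / p ≤ (n : ℝ) / (p : ℝ) ^ (1 / (1 + rho p₁ p₂)) ∧
      (n : ℝ) / (p : ℝ) ^ (1 / (1 + rho p₁ p₂)) ≤ n := by
  have hp1 : (1 : ℝ) ≤ p := by exact_mod_cast hp
  have hpn' : (p : ℝ) ≤ n := by exact_mod_cast hpn
  have h1 : (p : ℝ) ^ (1 / (1 + rho p₁ p₂)) ≤ p := by
    calc (p : ℝ) ^ (1 / (1 + rho p₁ p₂)) ≤ (p : ℝ) ^ (1 : ℝ) :=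
          Real.rpow_le_rpow_of_exponent_le hp1 ((div_le_one hs).2 (by linarith))
      _ = p := Real.rpow_one _
  have h2 : 1 ≤ (p : ℝ) ^ (1 / (1 + rho p₁ p₂)) := Real.one_le_rpow hp1 (by positivity)
  refine ⟨(one_le_div (by linarith)).2 (h1.trans hpn'), ?_, ?_⟩
  · exact div_le_div_of_nonneg_left (by linarith) (by linarith) h1
  · exact div_le_self (by linarith) h2

/-- The constant in the bound on the number of levels. -/
noncomputable def levelConst (p₁ : ℝ) : ℝ := (Real.log p₁⁻¹)⁻¹ + 2

/-- The constant in the bound on the number of hash functions. -/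
noncomputable def funConst (p₁ a : ℝ) : ℝ := levelConst p₁ * (a + 3) * p₁⁻¹

/-- A processor starts with at most about `n / p` points and generates at most one tuple per hash
function and point. There are `O(log n ^ 2) * p₁ ^ (-κ)` functions, and `p₁ ^ (-κ)` times `n / p` is
`O(n / p ^ (1 / (1 + ρ)))`, the baseline term of the load. -/
theorem exists_parameters (hε₀ : 0 < ε) (hε₁ : ε < 1) {J : ℕ} (hJ : 2 ≤ J * (1 - ε))
    (hp₂ : 0 < p₂) (hp₂₁ : p₂ < p₁) (hp₁' : p₁ < 1) (ha : 0 < a) (hp : 2 ≤ p)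
    (hpn : (p : ℝ) < (n : ℝ) ^ ε) :
    ∃ g E M : ℕ, 0 < g ∧ p ≤ g ^ J ∧ 0 < M ∧ M = E * g ∧ 2 * (g * g) ≤ M ∧
      Fintype.card (FunIdx (kappa p₁ p₂ p) (reps p₁ a n)) * ⌈(n : ℝ) / p⌉₊ ≤ M ∧
      ((g ^ J : ℕ) : ℝ) ≤ 2 ^ J * p ∧
      (M : ℝ) ≤ (2 * funConst p₁ a + 12) * Real.log n ^ 2 *
        ((n : ℝ) / (p : ℝ) ^ (1 / (1 + rho p₁ p₂))) ∧
      ((g * Fintype.card (BaseIdx (kappa p₁ p₂ p) (reps p₁ a n)) : ℕ) : ℝ) ≤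
        4 * funConst p₁ a * levelConst p₁ * Real.log n ^ 3 *
          ((n : ℝ) / (p : ℝ) ^ (1 / (1 + rho p₁ p₂))) := by
  have hp₁ : 0 < p₁ := hp₂.trans hp₂₁
  have hρ := rho_pos hp₁ hp₁' hp₂ (hp₂₁.trans hp₁')
  obtain ⟨hn3, hpn'⟩ := three_le_of_lt_rpow hε₀ hε₁ hp hpn
  have hX := one_le_log hn3
  obtain ⟨hG1, hGp, -⟩ := one_le_baseline (p₁ := p₁) (p₂ := p₂) (n := n) (p := p) (by linarith) hρ
    (by omega) hpn'
  obtain ⟨hκ1, hκ2, -, hκ3⟩ := kappa_bounds hp₂ hp₂₁ hp₁' hp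
  obtain ⟨g, E, M, h1, h2, h3, h4, h5, h6, h7, h8, h9⟩ := exists_degree hε₀ hε₁ hJ hp hpn
    (Fintype.card (FunIdx (kappa p₁ p₂ p) (reps p₁ a n)) * ⌈(n : ℝ) / p⌉₊)
  refine ⟨g, E, M, h1, h2, h3, h4, h5, h6, h7, ?_, ?_⟩
  all_goals
    have hF := card_funIdx_le ha hp₁ hp₁' hX (kappa p₁ p₂ p)
    have hBase : (Fintype.card (BaseIdx (kappa p₁ p₂ p) (reps p₁ a n)) : ℝ) ≤
        Fintype.card (FunIdx (kappa p₁ p₂ p) (reps p₁ a n)) * (kappa p₁ p₂ p : ℝ) := by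
      exact_mod_cast card_baseIdx_le (kappa p₁ p₂ p) (reps p₁ a n)
    have hp0 : (0 : ℝ) < p := by positivity
    have hL : 0 < Real.log p₁⁻¹ := Real.log_pos ((one_lt_inv₀ hp₁).2 hp₁')
    have hlog : Real.log p ≤ Real.log n := Real.log_le_log hp0 (by exact_mod_cast hpn')
    have hK : (kappa p₁ p₂ p : ℝ) + 1 ≤ levelConst p₁ * Real.log n := by
      have := mul_le_mul_of_nonneg_left hlog (inv_pos.2 hL).le
      rw [levelConst, add_mul]
      linarith
    have hK0 : 0 < levelConst p₁ := by rw [levelConst]; positivity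
    set Q : ℝ := p * (p : ℝ) ^ (-(1 / (1 + rho p₁ p₂))) with hQ
    have hQ0 : 0 < Q := by positivity
    have hG : (n : ℝ) / (p : ℝ) ^ (1 / (1 + rho p₁ p₂)) = n / p * Q := by
      rw [hQ, Real.rpow_neg hp0.le]
      field_simp
    have hFQ : (Fintype.card (FunIdx (kappa p₁ p₂ p) (reps p₁ a n)) : ℝ) ≤
        funConst p₁ a * Real.log n ^ 2 * Q := by
      refine hF.trans ?_
      calc ((kappa p₁ p₂ p : ℝ) + 1) * ((a + 3) * (p₁ ^ kappa p₁ p₂ p)⁻¹ * Real.log n)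
          ≤ levelConst p₁ * Real.log n * ((a + 3) * (p₁⁻¹ * Q) * Real.log n) := by gcongr
        _ = _ := by rw [funConst]; ring
    have hf0 : 0 < funConst p₁ a := by rw [funConst]; positivity
    have hnp : 0 < (n : ℝ) / p := by positivity
  · have hc : (⌈(n : ℝ) / p⌉₊ : ℝ) ≤ 2 * (n / p) := by
      have e1 := (Nat.ceil_lt_add_one hnp.le).le
      have e2 : 1 ≤ (n : ℝ) / p := (one_le_div hp0).2 (by exact_mod_cast hpn')
      linarith
    have e1 : ((Fintype.card (FunIdx (kappa p₁ p₂ p) (reps p₁ a n)) * ⌈(n : ℝ) / p⌉₊ : ℕ) : ℝ) ≤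
        funConst p₁ a * Real.log n ^ 2 * Q * (2 * (n / p)) := by
      push_cast
      gcongr
    have e2 : (n : ℝ) / p ≤ Real.log n ^ 2 * ((n : ℝ) / (p : ℝ) ^ (1 / (1 + rho p₁ p₂))) :=
      hGp.trans (le_mul_of_one_le_left (by linarith) (one_le_pow₀ hX))
    have e3 : funConst p₁ a * Real.log n ^ 2 * Q * (2 * (n / p)) =
        2 * funConst p₁ a * Real.log n ^ 2 *
          ((n : ℝ) / (p : ℝ) ^ (1 / (1 + rho p₁ p₂))) := by
      rw [hG]
      ring
    rw [e3] at e1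
    linarith
  · rw [hG]
    push_cast
    calc (g : ℝ) * Fintype.card (BaseIdx (kappa p₁ p₂ p) (reps p₁ a n))
        ≤ 4 * (n / p) * (funConst p₁ a * Real.log n ^ 2 * Q * (levelConst p₁ * Real.log n)) := by
          refine mul_le_mul h9 (hBase.trans ?_) (Nat.cast_nonneg _) (by positivity)
          exact mul_le_mul hFQ (by linarith) (Nat.cast_nonneg _) (by positivity)
      _ = _ := by ring

/-- The number of words of a message. -/
noncomputable def wordConst (p₁ a : ℝ) (J : ℕ) : ℕ :=
  9 + ⌈8 * (2 * funConst p₁ a + 12) ^ 2 * (2 ^ J) ^ 2 + 8⌉₊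

/-- `M` is `O(n ^ 3)` and `v` is `O(n)`, so the left side is at most `c * n ^ 8` with a constant
`c`, which is absorbed by `c < n ^ c`. -/
theorem modulus_lt {J M v : ℕ} {G : ℝ} (hf : 0 ≤ funConst p₁ a) (hn : 3 ≤ n) (hpn : p ≤ n)
    (hG : G ≤ n) (hM : (M : ℝ) ≤ (2 * funConst p₁ a + 12) * Real.log n ^ 2 * G)
    (hv : (v : ℝ) ≤ 2 ^ J * p) : 8 * (M * v) ^ 2 + 8 < n ^ wordConst p₁ a J := by
  have hn0 : (1 : ℝ) ≤ n := by exact_mod_cast (by omega : 1 ≤ n)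
  have hX : Real.log n ≤ n := Real.log_le_self (by linarith)
  have hX0 : 0 ≤ Real.log n := Real.log_nonneg hn0
  set K := 2 * funConst p₁ a + 12 with hK
  have hK0 : 0 ≤ K := by positivity
  have h1 : (M : ℝ) ≤ K * n ^ 2 * n :=
    calc (M : ℝ) ≤ K * Real.log n ^ 2 * G := hM
      _ ≤ K * Real.log n ^ 2 * n := by gcongr
      _ ≤ K * n ^ 2 * n := by gcongr
  have h2 : (v : ℝ) ≤ 2 ^ J * n := hv.trans (by gcongr)
  have h3 : (8 * (M * v : ℝ) ^ 2 + 8) ≤ (8 * K ^ 2 * (2 ^ J) ^ 2 + 8) * n ^ 8 := by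
    calc (8 * (M * v : ℝ) ^ 2 + 8) ≤ 8 * ((K * n ^ 2 * n) * (2 ^ J * n)) ^ 2 + 8 * n ^ 8 := by
          have : (1 : ℝ) ≤ n ^ 8 := one_le_pow₀ hn0
          have h4 : (M : ℝ) * v ≤ (K * n ^ 2 * n) * (2 ^ J * n) := by gcongr
          have h5 := pow_le_pow_left₀ (by positivity) h4 2
          linarith
      _ = _ := by ring
  set c := ⌈8 * K ^ 2 * (2 ^ J) ^ 2 + 8⌉₊ with hc
  have h4 : 8 * K ^ 2 * (2 ^ J) ^ 2 + 8 ≤ (c : ℝ) := Nat.le_ceil _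
  have h5 : c < n ^ c := Nat.lt_pow_self (by omega)
  have h6 : 8 * (M * v) ^ 2 + 8 ≤ c * n ^ 8 := by
    have : (8 * (M * v : ℝ) ^ 2 + 8) ≤ c * n ^ 8 := h3.trans (by gcongr)
    exact_mod_cast this
  calc 8 * (M * v) ^ 2 + 8 ≤ c * n ^ 8 := h6
    _ < n ^ c * n ^ 8 := Nat.mul_lt_mul_of_pos_right h5 (by positivity)
    _ ≤ n ^ c * n ^ 9 := Nat.mul_le_mul_left _ (Nat.pow_le_pow_right (by omega) (by norm_num))
    _ = n ^ wordConst p₁ a J := by rw [← pow_add, wordConst, add_comm]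

/-- The inequality of arithmetic and geometric means. It makes the load affine in the number of join
results, so that linearity of the expectation replaces Jensen's inequality. -/
theorem sqrt_le_add {Q : ℕ} {b s : ℝ} (hs : 0 < s) (hb : (Q : ℝ) ≤ b) :
    (Nat.sqrt Q : ℝ) ≤ b / (2 * s) + s / 2 := by
  have h1 : (Nat.sqrt Q : ℝ) * Nat.sqrt Q ≤ b := by
    have : (Nat.sqrt Q : ℝ) * Nat.sqrt Q ≤ Q := by exact_mod_cast Nat.sqrt_le Q
    linarith
  have h2 : b / (2 * s) + s / 2 = (b + s * s) / (2 * s) := by field_simp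
  rw [h2, le_div_iff₀ (by positivity)]
  nlinarith [sq_nonneg ((Nat.sqrt Q : ℝ) - s)]

/-- The load bound of the protocol in terms of the number `W` of join results. -/
theorem load_bound {J M v p W A : ℕ} {Kf Kb X s : ℝ} (hX : 1 ≤ X) (hs : 1 ≤ s)
    (hp : 0 < p) (hpv : p ≤ v) (hv : (v : ℝ) ≤ 2 ^ J * p) (hKf : 0 ≤ Kf)
    (hM : (M : ℝ) ≤ Kf * X ^ 2 * s) (hA : (A : ℝ) ≤ Kb * X ^ 3 * s) :
    ((6 * cellSize M v (2 * W) * (v / p + 1) + A : ℕ) : ℝ) ≤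
      (6 * (2 ^ J + 1) * (Kf + 2) + Kb) * X ^ 3 * s + 6 * (2 ^ J + 1) / (p * s) * W := by
  have hp0 : (0 : ℝ) < p := by exact_mod_cast hp
  have hs0 : 0 < s := by linarith
  have hφ : ((v / p + 1 : ℕ) : ℝ) ≤ 2 ^ J + 1 := by
    push_cast
    refine add_le_add_left ((Nat.cast_div_le).trans ?_) 1
    rwa [div_le_iff₀ hp0]
  have hQ : ((2 * W / v : ℕ) : ℝ) ≤ 2 * W / p := by
    refine (Nat.cast_div_le).trans ?_
    push_cast
    exact div_le_div_of_nonneg_left (by positivity) hp0 (by exact_mod_cast hpv)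
  have h1 := sqrt_le_add hs0 hQ
  have h2 : 2 * (W : ℝ) / p / (2 * s) = W / (p * s) := by field_simp
  rw [h2] at h1
  have hX3 : 1 ≤ X ^ 3 := one_le_pow₀ hX
  have hXX : X ^ 2 ≤ X ^ 3 := pow_le_pow_right₀ hX (by norm_num)
  have h3 : (cellSize M v (2 * W) : ℝ) ≤ (Kf + 2) * X ^ 3 * s + W / (p * s) := by
    rw [cellSize]
    push_cast
    have e1 : Kf * X ^ 2 * s ≤ Kf * X ^ 3 * s := by gcongr
    have e2 : s ≤ X ^ 3 * s := le_mul_of_one_le_left hs0.le hX3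
    linarith
  have h4 : (cellSize M v (2 * W) : ℝ) * ((v / p + 1 : ℕ) : ℝ) ≤
      ((Kf + 2) * X ^ 3 * s + W / (p * s)) * (2 ^ J + 1) :=
    mul_le_mul h3 hφ (Nat.cast_nonneg _) ((Nat.cast_nonneg _).trans h3)
  rw [Nat.cast_add, Nat.cast_mul, Nat.cast_mul, mul_assoc]
  have h5 : 6 * (((Kf + 2) * X ^ 3 * s + W / (p * s)) * (2 ^ J + 1)) =
      6 * (2 ^ J + 1) * (Kf + 2) * X ^ 3 * s + 6 * (2 ^ J + 1) / (p * s) * W := by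
    ring
  have h6 : (((6 : ℕ) : ℝ)) = 6 := by norm_num
  rw [h6]
  linarith

/-- The total expected cost in terms of the target load. -/
theorem cost_le {D A₂ B₂ N p T₁ T₂ Q : ℝ} {x y : ℝ} (hp : 0 < p) (hD : 2 * p₁⁻¹ ≤ D)
    (hp₁ : 0 < p₁) (hp₁' : p₁ < 1) (hA : 0 ≤ A₂) (hB : 0 ≤ B₂) (hT₁ : T₁ = p * A₂)
    (hT₂ : T₂ = p * B₂) (hQ : 0 < Q) (hN : 1 ≤ N * Q) (hN0 : 0 < N)
    (hx : x ≤ p₁⁻¹ * (p * Q)) (hy0 : 0 ≤ y) (hy : y ≤ Q) :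
    2 * D * T₁ + 2 * T₂ + N * (x * (1 + N * y)) ≤
      2 * D * p * (Real.sqrt A₂ + Real.sqrt B₂ + N * Q) ^ 2 := by
  have h1 : 1 ≤ p₁⁻¹ := (one_le_inv₀ hp₁).2 hp₁'.le
  have hD0 : 0 < D := by linarith
  -- Here `N * Q` is the baseline load. One factor `Q` comes from `p₁ ^ (-κ)` and one from `p₂ ^ κ`;
  -- the summand `1` is absorbed by `N * Q ≥ 1`.
  have h2 : N * (x * (1 + N * y)) ≤ 2 * p₁⁻¹ * p * (N * Q) ^ 2 := by
    have e1 : x * (1 + N * y) ≤ p₁⁻¹ * (p * Q) * (2 * (N * Q)) := by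
      have e2 : 1 + N * y ≤ 2 * (N * Q) := by nlinarith
      exact mul_le_mul hx e2 (by positivity) (by positivity)
    calc N * (x * (1 + N * y)) ≤ N * (p₁⁻¹ * (p * Q) * (2 * (N * Q))) :=
          mul_le_mul_of_nonneg_left e1 hN0.le
      _ = _ := by ring
  have h3 : 2 * p₁⁻¹ * p * (N * Q) ^ 2 ≤ D * p * (N * Q) ^ 2 := by gcongr
  have h4 : A₂ + B₂ + (N * Q) ^ 2 ≤ (Real.sqrt A₂ + Real.sqrt B₂ + N * Q) ^ 2 := by
    have a1 := Real.sqrt_nonneg A₂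
    have b1 := Real.sqrt_nonneg B₂
    have a2 := Real.sq_sqrt hA
    have b2 := Real.sq_sqrt hB
    have := mul_nonneg a1 b1
    have := mul_nonneg a1 (by linarith : 0 ≤ N * Q)
    have := mul_nonneg b1 (by linarith : 0 ≤ N * Q)
    nlinarith
  have h5 : 2 * T₂ ≤ 2 * D * (p * B₂) := by
    rw [hT₂]
    have : 0 ≤ p * B₂ := by positivity
    nlinarith
  have h6 := mul_le_mul_of_nonneg_left h4 (by positivity : 0 ≤ 2 * D * p)
  have h7 : 0 ≤ D * p * (N * Q) ^ 2 := by positivity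
  rw [hT₁]
  linarith

end Bounds

/-- The load itself need not be measurable; the affine function of the measurable `W` is the
majorant used in the infimum. -/
theorem outerExpectation_le {X : Type*} [MeasurableSpace X] {ν : Measure X} [IsProbabilityMeasure ν]
    {f W : X → ℕ} (hW : Measurable W) {α β b : ℝ} (hα : 0 ≤ α) (hβ : 0 ≤ β) (hb : 0 ≤ b)
    (hf : ∀ x, (f x : ℝ) ≤ α + β * W x) (hWb : ∫⁻ x, (W x : ℝ≥0∞) ∂ν ≤ ENNReal.ofReal b) :
    outerExpectation ν (fun x => (f x : ℝ≥0∞)) ≤ ENNReal.ofReal (α + β * b) := by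
  have hm : Measurable fun x => (W x : ℝ≥0∞) := (measurable_from_nat (f := Nat.cast)).comp hW
  have h : outerExpectation ν (fun x => (f x : ℝ≥0∞)) ≤
      ∫⁻ x, (ENNReal.ofReal α + ENNReal.ofReal β * W x) ∂ν := by
    refine iInf_le_of_le _ (iInf_le_of_le (measurable_const.add (hm.const_mul _))
      (iInf_le_of_le (fun x => ?_) le_rfl))
    change (f x : ℝ≥0∞) ≤ ENNReal.ofReal α + ENNReal.ofReal β * W x
    rw [← ENNReal.ofReal_natCast, ← ENNReal.ofReal_natCast, ← ENNReal.ofReal_mul hβ,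
      ← ENNReal.ofReal_add hα (by positivity)]
    exact ENNReal.ofReal_le_ofReal (hf x)
  refine h.trans ?_
  rw [lintegral_add_left measurable_const, lintegral_const, measure_univ, mul_one,
    lintegral_const_mul _ hm, ENNReal.ofReal_add hα (by positivity), ENNReal.ofReal_mul hβ]
  gcongr

/-- The constant in the load bound. -/
noncomputable def loadConst (p₁ p₂ a : ℝ) (J : ℕ) : ℝ :=
  6 * (2 ^ J + 1) * (2 * funConst p₁ a + 12 + 2) + 4 * funConst p₁ a * levelConst p₁ +
    6 * (2 ^ J + 1) * ((a + 3) * (2 * ((1 + p₂⁻¹) * p₁⁻¹)))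

/-- With `s` the target load, the load is `O(log n ^ 3 * s)` plus `O(W / (p * s))`, and `W` has
expectation `O(log n * p * s ^ 2)`. Taking `s` itself as the parameter in `sqrt_le_add` makes the
second term `O(log n * s)`. -/
theorem expected_load_le {p₁ p₂ a : ℝ} (hp₂ : 0 < p₂) (hp₂₁ : p₂ < p₁) (hp₁' : p₁ < 1) (ha : 0 < a)
    {U Ω B : Type*} [MeasurableSpace Ω] {μ : Measure Ω} [IsProbabilityMeasure μ]
    {h : Ω → U → B} {d : U → U → ℝ} {r c : ℝ} (H : IsLSH d μ h r c p₁ p₂) {n p : ℕ} (hp : 2 ≤ p)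
    (hn3 : 3 ≤ n) (hpn' : p ≤ n) {R S : Finset U} {lvl : U ⊕ U → ℕ} (hcard : R.card + S.card = n)
    (hlvl : IsBestLevel μ h p₁ (kappa p₁ p₂ p) R S lvl) {g J M : ℕ} (hpg : p ≤ g ^ J)
    (hgJ : ((g ^ J : ℕ) : ℝ) ≤ 2 ^ J * p)
    (hMK : (M : ℝ) ≤ (2 * funConst p₁ a + 12) * Real.log n ^ 2 *
        ((n : ℝ) / (p : ℝ) ^ (1 / (1 + rho p₁ p₂))))
    (hBK : ((g * Fintype.card (BaseIdx (kappa p₁ p₂ p) (reps p₁ a n)) : ℕ) : ℝ) ≤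
        4 * funConst p₁ a * levelConst p₁ * Real.log n ^ 3 *
          ((n : ℝ) / (p : ℝ) ^ (1 / (1 + rho p₁ p₂))))
    {load : (BaseIdx (kappa p₁ p₂ p) (reps p₁ a n) → Ω) → ℕ}
    (hP : ∀ ω, load ω ≤
      6 * cellSize M (g ^ J) (2 * (joinResults h ω R S lvl).ncard) * (g ^ J / p + 1) +
        g * Fintype.card (BaseIdx (kappa p₁ p₂ p) (reps p₁ a n))) :
    outerExpectation (Measure.pi fun _ => μ) (fun ω => (load ω : ℝ≥0∞)) ≤
      ENNReal.ofReal (loadConst p₁ p₂ a J * Real.log n ^ 3 *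
        (Real.sqrt (∑ i ∈ Finset.range (kappa p₁ p₂ p + 1),
            (outNear d r p₂ (kappa p₁ p₂ p) R S i : ℝ) / (p * p₁ ^ i)) +
          Real.sqrt ((outCNear d r c R S : ℝ) / p) +
          (n : ℝ) / (p : ℝ) ^ (1 / (1 + rho p₁ p₂)))) := by
  have hp₁ : 0 < p₁ := hp₂.trans hp₂₁
  have hX := one_le_log hn3
  have hL : 0 < Real.log p₁⁻¹ := Real.log_pos ((one_lt_inv₀ hp₁).2 hp₁')
  have hK0 : 0 < levelConst p₁ := by rw [levelConst]; positivity
  have hf0 : 0 < funConst p₁ a := by rw [funConst]; positivity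
  have hρ := rho_pos hp₁ hp₁' hp₂ (hp₂₁.trans hp₁')
  obtain ⟨hG1, -, -⟩ := one_le_baseline (p₁ := p₁) (p₂ := p₂) (n := n) (p := p) (by linarith) hρ
    (by omega) hpn'
  obtain ⟨hκ1, hκ2, hκ3, -⟩ := kappa_bounds hp₂ hp₂₁ hp₁' hp
  obtain ⟨W, hW, hJW, hWE⟩ := exists_joinWork_bound (κ := kappa p₁ p₂ p) (n := n) (R := R) (S := S)
    (lvl := lvl) (μ := μ) H.measurableSet_collision ha hp₁ hp₁' hX
  have hp0 : (0 : ℝ) < p := by positivity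
  have hn0 : (0 : ℝ) < n := by positivity
  set A₂ : ℝ := ∑ i ∈ Finset.range (kappa p₁ p₂ p + 1),
    (outNear d r p₂ (kappa p₁ p₂ p) R S i : ℝ) / (p * p₁ ^ i) with hA₂
  set B₂ : ℝ := (outCNear d r c R S : ℝ) / p with hB₂
  set G : ℝ := (n : ℝ) / (p : ℝ) ^ (1 / (1 + rho p₁ p₂)) with hG
  set s : ℝ := Real.sqrt A₂ + Real.sqrt B₂ + G with hs
  have hGs : G ≤ s := by
    have := Real.sqrt_nonneg A₂
    have := Real.sqrt_nonneg B₂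
    linarith
  have hs1 : 1 ≤ s := hG1.trans hGs
  have hs0 : 0 < s := by linarith
  have hcost := (sum_expectedCost_le H hp₂ hp₂₁ hp₁' hκ1 hlvl hcard).trans
    (cost_le (D := (1 + p₂⁻¹) * p₁⁻¹) (A₂ := A₂) (B₂ := B₂) (Q := (p : ℝ) ^ (-(1 / (1 + rho p₁ p₂)))) hp0
      (by
        have : 1 ≤ p₂⁻¹ := (one_le_inv₀ hp₂).2 (hp₂₁.trans hp₁').le
        have : 0 < p₁⁻¹ := by positivity
        nlinarith) hp₁ hp₁' (Finset.sum_nonneg fun i _ => by positivity) (by positivity)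
      (by
        rw [hA₂, Finset.mul_sum]
        refine Finset.sum_congr rfl fun i _ => ?_
        field_simp)
      (by rw [hB₂]; field_simp) (by positivity)
      (by rwa [Real.rpow_neg hp0.le, ← div_eq_mul_inv]) hn0 hκ2 (by positivity) hκ3)
  have hnG : (n : ℝ) * (p : ℝ) ^ (-(1 / (1 + rho p₁ p₂))) = G := by
    rw [Real.rpow_neg hp0.le, ← div_eq_mul_inv]
  rw [hnG, ← hs] at hcost
  have hC₁ : 0 ≤ 6 * (2 ^ J + 1) * (2 * funConst p₁ a + 12 + 2) +
    4 * funConst p₁ a * levelConst p₁ := by positivity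
  rw [loadConst]
  set D : ℝ := (1 + p₂⁻¹) * p₁⁻¹ with hD
  have hD0 : 0 < D := by positivity
  clear_value A₂ B₂ G s D
  have hβ : 0 ≤ 6 * (2 ^ J + 1) / (p * s) := by positivity
  have hload : ∀ ω, (load ω : ℝ) ≤ (6 * (2 ^ J + 1) * (2 * funConst p₁ a + 12 + 2) +
      4 * funConst p₁ a * levelConst p₁) * Real.log n ^ 3 * s +
        6 * (2 ^ J + 1) / (p * s) * W ω := by
    intro ω
    have h2 := load_bound (M := M) (v := g ^ J) (W := (joinResults h ω R S lvl).ncard)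
      (A := g * Fintype.card (BaseIdx (kappa p₁ p₂ p) (reps p₁ a n))) hX hs1 (by omega) hpg hgJ
      (by positivity) (hMK.trans (mul_le_mul_of_nonneg_left hGs (by positivity)))
      (hBK.trans (mul_le_mul_of_nonneg_left hGs (by positivity)))
    have h3 : ((joinResults h ω R S lvl).ncard : ℝ) ≤ (W ω : ℝ) := by exact_mod_cast hJW ω
    have h4 : 6 * (2 ^ J + 1) / (p * s) * ((joinResults h ω R S lvl).ncard : ℝ) ≤
        6 * (2 ^ J + 1) / (p * s) * W ω := mul_le_mul_of_nonneg_left h3 hβ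
    have h5 : (load ω : ℝ) ≤ _ := Nat.cast_le.2 (hP ω)
    exact (h5.trans h2).trans (by linarith)
  generalize 6 * (2 ^ J + 1) * (2 * funConst p₁ a + 12 + 2) +
    4 * funConst p₁ a * levelConst p₁ = C₁ at hC₁ hload ⊢
  refine (outerExpectation_le hW (by positivity) (by positivity) (by positivity) hload
    (hWE.trans (ENNReal.ofReal_le_ofReal (mul_le_mul_of_nonneg_left hcost
      (by positivity))))).trans (ENNReal.ofReal_le_ofReal ?_)
  have h5 : 6 * (2 ^ J + 1) / (p * s) * ((a + 3) * Real.log n * (2 * D * p * s ^ 2)) =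
      6 * (2 ^ J + 1) * ((a + 3) * (2 * D)) * Real.log n * s := by
    field_simp
  have h6 : 6 * (2 ^ J + 1) * ((a + 3) * (2 * D)) * Real.log n * s ≤
      6 * (2 ^ J + 1) * ((a + 3) * (2 * D)) * Real.log n ^ 3 * s := by
    have : Real.log n ≤ Real.log n ^ 3 := le_self_pow₀ hX (by norm_num)
    gcongr
  rw [h5]
  linarith

end LSHJoin

theorem mainTheorem1 (ε : ℝ) (hε₀ : 0 < ε) (hε₁ : ε < 1) :
    -- the number of rounds is bounded by a constant `T`
    ∃ T : ℕ, ∀ p₁ p₂ a : ℝ, 0 < p₂ → p₂ < p₁ → p₁ < 1 → 0 < a →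
    -- `C`, `b`: constant and power of the logarithm hidden in the load;
    -- a message has `w` words of `w log n` bits
    ∃ (C : ℝ) (b w : ℕ),
    ∀ {U : Type*} {Ω : Type*} {B : Type*} [MeasurableSpace Ω] (μ : Measure Ω)
      [IsProbabilityMeasure μ] (h : Ω → U → B) (d : U → U → ℝ) (r c : ℝ),
      0 < r → 1 < c → IsLSH d μ h r c p₁ p₂ →
    ∀ n p : ℕ, 2 ≤ p → (p : ℝ) < (n : ℝ) ^ ε →
    ∃ P : Protocol p w (n ^ w) U Ω
        (BaseIdx (kappa p₁ p₂ p) (reps p₁ a n)) (FunIdx (kappa p₁ p₂ p) (reps p₁ a n)),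
      P.rounds ≤ T ∧
      ∀ (R S : Finset U) (lvl : U ⊕ U → ℕ) (owner : U ⊕ U → Fin p),
        R.card + S.card = n → IsBestLevel μ h p₁ (kappa p₁ p₂ p) R S lvl → IsEven R S owner →
        -- for every draw of the hash functions, `P` generates the join results of the algorithm
        (∀ ω, P.generated (initialInput R S lvl owner ω) = joinResults h ω R S lvl) ∧
        -- with high probability, the output is the similarity join
        (Measure.pi fun _ => μ)
            {ω | P.output d r (initialInput R S lvl owner ω) ≠ simJoin d r R S} ≤
          ENNReal.ofReal ((n : ℝ) ^ (-a)) ∧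
        -- the expected load
        outerExpectation (Measure.pi fun _ => μ)
            (fun ω => (P.load (initialInput R S lvl owner ω) : ℝ≥0∞)) ≤
          ENNReal.ofReal (C * Real.log n ^ b *
            (Real.sqrt (∑ i ∈ Finset.range (kappa p₁ p₂ p + 1),
                (outNear d r p₂ (kappa p₁ p₂ p) R S i : ℝ) / (p * p₁ ^ i)) +
              Real.sqrt ((outCNear d r c R S : ℝ) / p) +
              (n : ℝ) / (p : ℝ) ^ (1 / (1 + rho p₁ p₂)))) := by
  -- `J` is the depth of all trees, chosen from `ε` alone so that `exists_degree` applies; therefore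
  -- the number of rounds depends only on `ε`.
  obtain ⟨J, hJ'⟩ : ∃ J : ℕ, 2 / (1 - ε) ≤ J := ⟨_, Nat.le_ceil _⟩
  have hJ : 2 ≤ J * (1 - ε) := (div_le_iff₀ (by linarith)).1 hJ'
  refine ⟨J + 2 * joinRounds J, fun p₁ p₂ a hp₂ hp₂₁ hp₁' ha => ?_⟩
  have hp₁ : 0 < p₁ := hp₂.trans hp₂₁
  have hL : 0 < Real.log p₁⁻¹ := Real.log_pos ((one_lt_inv₀ hp₁).2 hp₁')
  have hK0 : 0 < levelConst p₁ := by rw [levelConst]; positivity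
  have hf0 : 0 < funConst p₁ a := by rw [funConst]; positivity
  have hρ := rho_pos hp₁ hp₁' hp₂ (hp₂₁.trans hp₁')
  refine ⟨loadConst p₁ p₂ a J, 3, wordConst p₁ a J, ?_⟩
  intro U Ω B _ μ _ h d r c hr hc H n p hp hpn
  obtain ⟨hn3, hpn'⟩ := three_le_of_lt_rpow hε₀ hε₁ hp hpn
  obtain ⟨-, -, hGn⟩ := one_le_baseline (p₁ := p₁) (p₂ := p₂) (n := n) (p := p) (by linarith) hρ
    (by omega) hpn'
  obtain ⟨g, E, M, hg, hpg, hM, hME, hMg, hFM, hgJ, hMK, hBK⟩ :=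
    exists_parameters hε₀ hε₁ hJ hp₂ hp₂₁ hp₁' ha hp hpn
  obtain ⟨P, hPr, hP⟩ := exists_join_protocol (U := U) (w := wordConst p₁ a J)
    (m := n ^ wordConst p₁ a J) h (by omega) (by omega) hg hpg hM hME hMg hFM
    (by rw [wordConst]; omega) (modulus_lt hf0.le hn3 hpn' hGn hMK hgJ)
  refine ⟨P, hPr, fun R S lvl owner hcard hlvl heven => ?_⟩
  have hgen : ∀ ω, P.generated (initialInput R S lvl owner ω) = joinResults h ω R S lvl :=
    fun ω => (hP ⟨R, S, lvl, owner, ω, hcard, heven⟩).1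
  refine ⟨hgen, ?_, ?_⟩
  · have hout : ∀ ω, P.output d r (initialInput R S lvl owner ω) =
        joinOutput d r (joinResults h ω R S lvl) := fun ω => by
      rw [← hgen ω]
      rfl
    simp only [hout]
    exact measure_output_ne H hp₁ (by omega) hcard hlvl
  · exact expected_load_le hp₂ hp₂₁ hp₁' ha H hp hn3 hpn' hcard hlvl hpg hgJ hMK hBK fun ω =>
      (hP ⟨R, S, lvl, owner, ω, hcard, heven⟩).2
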